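/- Let $N,s\ge 1$ be integers, let $1<p<\infty$ with $sp<N$, and put $q=Np/(N-sp)$. For a real function $f\in W^{s,1}_{\mathrm{loc}}(\mathbb R^N)$ and $\xi\in\mathbb S^{N-1}$ let $\partial^s_\xi f(x)=D^s f(x)(\xi,\dots,\xi)$ (weak derivative). Let $\dot W^{s,p}$ be the space of $f\in W^{s,1}_{\mathrm{loc}}(\mathbb R^N)$ with $\int_{\mathbb R^N}\|D^s f(x)\|^p\,dx<\infty$, and let $\mathring W^{s,p}=L^q(\mathbb R^N)\cap\dot W^{s,p}$. Define the affine energy $$\mathscr E_{s,p}(f)=\left(\int_{\mathbb S^{N-1}}\left(\int_{\mathbb R^N}|\partial^s_\xi f(x)|^p\,dx\right)^{-N/(sp)}d\mathscr H^{N-1}(\xi)\right)^{-s/N},$$ and let $S$ be the best (largest) constant such that $S\,\|f\|_{L^q}\le\mathscr E_{s,p}(f)$ for all $f\in\mathring W^{s,p}$. (Conventions: $0^{-a}=\infty$ and $\infty^{-a}=0$ for $a>0$.) Let $(f_n)\subset\mathring W^{s,p}$ and $f\in\mathring W^{s,p}$ be such that $f_n\rightharpoonup f$ in $\dot W^{s,p}$,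 i.e. $\partial^s_\xi f_n\rightharpoonup\partial^s_\xi f$ weakly in $L^p(\mathbb R^N)$ for each $\xi\in\mathbb S^{N-1}$. Let $\nu$ and $\mu_\xi$ ($\xi\in\mathbb S^{N-1}$) be finite Borel measures on $\mathbb R^N$ such that $|f_n|^q\,dx\overset{*}{\rightharpoonup}\nu$ and $$|\partial^s_\xi f_n|^p\,dx\overset{*}{\rightharpoonup}|\partial^s_\xi f|^p\,dx+\mu_\xi\qquad\text{for all }\xi\in\mathbb S^{N-1},$$ where $\overset{*}{\rightharpoonup}$ denotes convergence against every function in $C_0(\mathbb R^N)$ (continuous, vanishing at infinity). Then there are a countable set $I$, distinct points $x_i\in\mathbb R^N$ and numbers $\nu_i\in(0,\infty)$ ($i\in I$) such that: (a) $\displaystyle \nu=|f|^q\,dx+\sum_{i\in I}\nu_i\,\delta_{x_i}$; (b) $\displaystyle \sum_{i\in I}S^p\,\nu_i^{p/q}\le\left(\int_{\mathbb S^{N-1}}\left(\sum_{i\in I}\mu_\xi(\{x_i\})\right)^{-N/(sp)}d\mathscr H^{N-1}(\xi)\right)^{-sp/N}.$ -/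

import Mathlib

open MeasureTheory Filter Topology
open scoped ENNReal NNReal ContDiff ZeroAtInfty

noncomputable section

namespace AffineSobolev

/-- The Euclidean space `ℝ^N`. -/
abbrev Eucl (N : ℕ) : Type := EuclideanSpace ℝ (Fin N)

/-- The unit sphere of `ℝ^N`. -/
abbrev UnitSphere (N : ℕ) : Type := Metric.sphere (0 : Eucl N) 1

/-- The surface measure of the unit sphere, i.e. the (normalised) `(N-1)`-dimensional Hausdorff
measure on it. -/
abbrev surfaceMeasure (N : ℕ) : Measure (UnitSphere N) :=
  (volume : Measure (Eucl N)).toSphere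

/-- `G`, a locally integrable function with values in the `k`-linear forms on `ℝ^N`, is the weak
(distributional) derivative `D^k f` of the locally integrable function `f`. -/
def HasWeakDeriv {N : ℕ} (k : ℕ) (f : Eucl N → ℝ)
    (G : Eucl N → ContinuousMultilinearMap ℝ (fun _ : Fin k => Eucl N) ℝ) : Prop :=
  LocallyIntegrable f ∧ LocallyIntegrable G ∧
    ∀ φ : Eucl N → ℝ, ContDiff ℝ ∞ φ → HasCompactSupport φ → ∀ v : Fin k → Eucl N,
      ∫ x, f x * iteratedFDeriv ℝ k φ x v = (-1) ^ k * ∫ x, G x v * φ x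

open Classical in
/-- The weak derivative `D^k f` (unique up to a null set when it exists, and `0` when it does
not exist). -/
def weakDeriv {N : ℕ} (k : ℕ) (f : Eucl N → ℝ) :
    Eucl N → ContinuousMultilinearMap ℝ (fun _ : Fin k => Eucl N) ℝ :=
  if h : ∃ G, HasWeakDeriv k f G then h.choose else 0

/-- The directional derivative `∂^s_ξ f (x) = D^s f (x) (ξ, …, ξ)`. -/
def dirDeriv {N : ℕ} (s : ℕ) (ξ : UnitSphere N) (f : Eucl N → ℝ) (x : Eucl N) : ℝ :=
  weakDeriv s f x (fun _ => (ξ : Eucl N))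

/-- The local Sobolev space `W^{s,1}_loc`. -/
def MemSobolevLoc {N : ℕ} (s : ℕ) (f : Eucl N → ℝ) : Prop :=
  ∀ k ≤ s, ∃ G, HasWeakDeriv k f G

/-- The homogeneous Sobolev space of the `f ∈ W^{s,1}_loc` with `∫ ‖D^s f‖^p < ∞`, where `‖·‖` is
the operator norm of multilinear forms. -/
def MemHomSobolev {N : ℕ} (s : ℕ) (p : ℝ) (f : Eucl N → ℝ) : Prop :=
  MemSobolevLoc s f ∧ MemLp (weakDeriv s f) (ENNReal.ofReal p) volume

/-- The critical exponent `q = N p / (N - s p)`. -/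
def critExp (N s : ℕ) (p : ℝ) : ℝ := N * p / (N - s * p)

/-- The intersection of `L^q` and the homogeneous Sobolev space of order `(s, p)`. -/
def MemSobolev {N : ℕ} (s : ℕ) (p : ℝ) (f : Eucl N → ℝ) : Prop :=
  MemLp f (ENNReal.ofReal (critExp N s p)) volume ∧ MemHomSobolev s p f

/-- The affine energy
`(∫_{S^{N-1}} (∫ |∂^s_ξ f|^p dx)^{-N/(sp)} dξ)^{-s/N}`, with values in `[0, ∞]` and with the
conventions `0^{-a} = ∞`, `∞^{-a} = 0` for `a > 0`. -/
def affineEnergy {N : ℕ} (s : ℕ) (p : ℝ) (f : Eucl N → ℝ) : ℝ≥0∞ :=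
  (∫⁻ ξ, (∫⁻ x, ‖dirDeriv s ξ f x‖ₑ ^ p) ^ (-(N / (s * p) : ℝ)) ∂(surfaceMeasure N))
    ^ (-(s / N : ℝ))

/-- The best constant `S` in the affine Sobolev inequality
`S ‖f‖_{L^q} ≤ affineEnergy f`. -/
def bestConst (N s : ℕ) (p : ℝ) : ℝ≥0∞ :=
  sSup {C : ℝ≥0∞ | ∀ f : Eucl N → ℝ, MemSobolev s p f →
    C * eLpNorm f (ENNReal.ofReal (critExp N s p)) volume ≤ affineEnergy s p f}

/-- Weak convergence in the homogeneous Sobolev space: for each direction `ξ`,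
`∂^s_ξ f_n` converges to `∂^s_ξ f` weakly in `L^p`, i.e. against every `g ∈ L^{p'}`,
`p' = p / (p - 1)`. -/
def WeakTendsto {N : ℕ} (s : ℕ) (p : ℝ) (f : ℕ → Eucl N → ℝ) (f₀ : Eucl N → ℝ) : Prop :=
  ∀ ξ : UnitSphere N, ∀ g : Eucl N → ℝ,
    MemLp g (ENNReal.ofReal (Real.conjExponent p)) volume →
      Tendsto (fun n => ∫ x, dirDeriv s ξ (f n) x * g x) atTop
        (𝓝 (∫ x, dirDeriv s ξ f₀ x * g x))

/-- The measure `|u|^r dx`. -/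
def powMeasure {N : ℕ} (u : Eucl N → ℝ) (r : ℝ) : Measure (Eucl N) :=
  volume.withDensity (fun x => ‖u x‖ₑ ^ r)

/-- Weak-`*` convergence of finite Borel measures on `ℝ^N`, in duality with the continuous
functions vanishing at infinity. -/
def WeakStarTendsto {N : ℕ} (μ : ℕ → Measure (Eucl N)) (μ₀ : Measure (Eucl N)) : Prop :=
  ∀ φ : C₀(Eucl N, ℝ), Tendsto (fun n => ∫ x, φ x ∂(μ n)) atTop (𝓝 (∫ x, φ x ∂μ₀))

end AffineSobolev

end

/-!
Concentration-compactness for the affine Sobolev inequality. All estimates are localised by test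
functions `φ`, and applied to smooth functions `G_n` close to `f_n - f₀`
(`Concentrates.exists_weaklyNull`).

The link between `ν` and the measures `μ ξ` is that multiplication by `φ` almost commutes with
`D^s` along `G_n`: by the Leibniz formula the commutator involves only derivatives of `G_n` of
order less than `s` on the support of `φ`, and these tend to zero in `L^p_loc` by a Rellich type
theorem (`WeaklyNull.tendsto_eLpNorm_iteratedFDeriv`, `WeaklyNull.tendsto_commutator`). Only the
derivatives of top order are assumed to converge, so polynomials of degree less than `s` have to be
excluded as limits. Differences of order `s` along a line detect them, because the `L^q` norms of
`G_n` on balls of fixed radius are small far away, as `ν` is finite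
(`WeaklyNull.tendsto_mollify`).

For the structure of `ν`, the ordinary Sobolev inequality for `φ G_n` gives a reverse Hölder
inequality `‖φ‖_{L^q(ν)} ≤ ‖φ‖_{L^q(|f₀|^q dx)} + C ‖φ‖_{L^p(m)}` with a finite measure `m`
(`Concentrates.exists_eLpNorm_le`); since `p < q`, summation over a partition into sets of small
`m`-measure shows that `ν` is at most `|f₀|^q dx` away from the atoms of `m`
(`measure_le_of_forall_singleton_eq_zero`). The converse inequality is Fatou's lemma
(`Concentrates.eLpNorm_powMeasure_le`).

For the inequality between the masses, the affine Sobolev inequality for `φ G_n` is used with `φ`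
shrinking to an atom (`Concentrates.exists_measurable_le_atom`), and the resulting inequalities for
the single atoms are added by the reverse Minkowski inequality for the exponent `-N / (s p) < 0`
(`lintegral_rpow_neg_add_le`). As `μ ξ {x}` need not be measurable in `ξ`, while the
reverse Minkowski inequality needs measurable functions, it is first replaced by a measurable
function of `ξ` below it, obtained as a lower limit in Fatou's lemma.
-/

namespace AffineSobolev

/-! ### Symmetric multilinear forms and iterated derivatives -/

section Multilinear
variable {E F : Type*} [NormedAddCommGroup E] [NormedSpace ℝ E]
  [NormedAddCommGroup F] [NormedSpace ℝ F]

instance finiteDimensional_continuousMultilinearMap [FiniteDimensional ℝ E]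
    [FiniteDimensional ℝ F] (k : ℕ) :
    FiniteDimensional ℝ (ContinuousMultilinearMap ℝ (fun _ : Fin k => E) F) :=
  FiniteDimensional.of_injective
    (ContinuousMultilinearMap.toMultilinearMapLinear (R' := ℝ) (A := ℝ)
      (M₁ := fun _ : Fin k => E) (M₂ := F))
    ContinuousMultilinearMap.toMultilinearMap_injective

theorem contDiff_iteratedFDeriv {f : E → F} (hf : ContDiff ℝ ∞ f) (k : ℕ) :
    ContDiff ℝ ∞ (iteratedFDeriv ℝ k f) := by
  refine hf.iteratedFDeriv_right (m := ∞) (i := k) ?_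
  exact_mod_cast le_top

theorem iteratedFDeriv_succ_apply_left' {f : E → F} (hf : ContDiff ℝ ∞ f) (k : ℕ)
    (v : Fin (k + 1) → E) (x : E) :
    iteratedFDeriv ℝ (k + 1) f x v
      = fderiv ℝ (fun y => iteratedFDeriv ℝ k f y (Fin.tail v)) x (v 0) :=
  DifferentiableAt.iteratedFDeriv_succ_apply_left'
    ((contDiff_iteratedFDeriv hf k).differentiable (by simp) x)

theorem contDiff_iteratedFDeriv_apply {f : E → F} (hf : ContDiff ℝ ∞ f) (k : ℕ)
    (v : Fin k → E) : ContDiff ℝ ∞ (fun y => iteratedFDeriv ℝ k f y v) :=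
  (ContinuousMultilinearMap.apply ℝ (fun _ : Fin k => E) F v).contDiff.comp
    (contDiff_iteratedFDeriv hf k)

/-- Iterated directional derivatives of a smooth function commute, whence the `k`-th derivative
depends on its `k` arguments only up to order. -/
theorem iteratedFDeriv_comp_perm {f : E → F} (hf : ContDiff ℝ ∞ f) {k : ℕ} (x : E)
    (v : Fin k → E) (σ : Equiv.Perm (Fin k)) :
    iteratedFDeriv ℝ k f x (v ∘ σ) = iteratedFDeriv ℝ k f x v := by
  let S := {g : E → F // ContDiff ℝ ∞ g}
  let D : E → S → S := fun w g => ⟨fun x => fderiv ℝ g.1 x w,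
    (g.2.fderiv_right (m := ∞) (by simp)).clm_apply contDiff_const⟩
  have hD : LeftCommutative D := ⟨fun a b g => by
    apply Subtype.ext
    funext y
    have h2 : ContDiffAt ℝ ∞ g.1 y := g.2.contDiffAt
    have hsymm := h2.isSymmSndFDerivAt (by
      simp only [minSmoothness_of_isRCLikeNormedField]
      exact WithTop.coe_le_coe.2 le_top)
    have hd : DifferentiableAt ℝ (fderiv ℝ g.1) y :=
      (g.2.fderiv_right (m := ∞) (by simp)).differentiable (by simp) y
    have e : ∀ a b : E, fderiv ℝ (fun x => fderiv ℝ g.1 x b) y a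
        = fderiv ℝ (fderiv ℝ g.1) y a b := by
      intro a b
      rw [fderiv_clm_apply hd (differentiableAt_const b)]
      simp
    change fderiv ℝ (fun x => fderiv ℝ g.1 x b) y a = fderiv ℝ (fun x => fderiv ℝ g.1 x a) y b
    rw [e, e]
    exact hsymm a b⟩
  have key : ∀ (k : ℕ) (v : Fin k → E) (y : E),
      iteratedFDeriv ℝ k f y v = ((List.ofFn v).foldr D ⟨f, hf⟩).1 y := by
    intro k
    induction k with
    | zero => intro v y; simp
    | succ k ih =>
      intro v y
      rw [iteratedFDeriv_succ_apply_left' hf, List.ofFn_succ, List.foldr_cons]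
      change _ = fderiv ℝ _ y (v 0)
      congr 2
      funext z
      exact ih _ z
  rw [key, key, (Equiv.Perm.ofFn_comp_perm σ v).foldr_eq]

/-- Polarisation: a symmetric multilinear map is determined by its restriction to the diagonal. -/
theorem eq_zero_of_diagonal_eq_zero {k : ℕ}
    (T : ContinuousMultilinearMap ℝ (fun _ : Fin k => E) F)
    (hT : ∀ (v : Fin k → E) (σ : Equiv.Perm (Fin k)), T (v ∘ σ) = T v)
    (h0 : ∀ x, T (fun _ => x) = 0) : T = 0 := by
  ext v
  have h1 := T.iteratedFDeriv_comp_diagonal 0 v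
  have h2 : (fun x => T (fun _ => x)) = fun _ => (0 : F) := funext h0
  rw [h2, iteratedFDeriv_fun_zero] at h1
  have h3 : ∀ σ : Equiv.Perm (Fin k), T (fun i => v (σ i)) = T v := fun σ => hT v σ
  simp only [h3, Finset.sum_const, Finset.card_univ, Fintype.card_perm, Fintype.card_fin] at h1
  have h4 : ((k.factorial : ℕ) : ℝ) • T v = 0 := by
    rw [Nat.cast_smul_eq_nsmul]; exact h1.symm
  exact (smul_eq_zero.1 h4).resolve_left (by exact_mod_cast k.factorial_ne_zero)

/-- On a finite-dimensional space, a family of linear forms that separates the points of a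
subspace bounds the norm there through finitely many of its members. -/
theorem exists_finset_norm_le_sum {M ι : Type*} [NormedAddCommGroup M] [NormedSpace ℝ M]
    [FiniteDimensional ℝ M] (V : Submodule ℝ M) (ev : ι → M →ₗ[ℝ] ℝ)
    (hsep : ∀ T ∈ V, (∀ i, ev i T = 0) → T = 0) :
    ∃ (A : Finset ι) (C : ℝ≥0), ∀ T ∈ V, ‖T‖ ≤ C * ∑ i ∈ A, ‖ev i T‖ := by
  classical
  let K : Finset ι → Submodule ℝ M := fun A => V ⊓ ⨅ i ∈ A, LinearMap.ker (ev i)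
  have hK : ∀ A T, T ∈ K A ↔ T ∈ V ∧ ∀ i ∈ A, ev i T = 0 := by
    intro A T
    simp [K, Submodule.mem_inf, Submodule.mem_iInf]
  -- A finite subfamily with the smallest common kernel has trivial common kernel.
  obtain ⟨A, hA⟩ : ∃ A, K A = ⊥ := by
    obtain ⟨A, hA⟩ : ∃ A, ∀ B, Module.finrank ℝ (K A) ≤ Module.finrank ℝ (K B) :=
      ⟨Function.argmin fun A => Module.finrank ℝ (K A), fun B =>
        Function.argmin_le (fun A => Module.finrank ℝ (K A)) B⟩
    refine ⟨A, (Submodule.eq_bot_iff _).2 fun T hT => ?_⟩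
    refine hsep T ((hK A T).1 hT).1 fun i => ?_
    have hKK : K (insert i A) ≤ K A := fun S hS =>
      (hK A S).2 ⟨((hK _ S).1 hS).1, fun j hj => ((hK _ S).1 hS).2 j (Finset.mem_insert_of_mem hj)⟩
    have hTm : T ∈ K (insert i A) := Submodule.eq_of_le_of_finrank_le hKK (hA _) ▸ hT
    exact ((hK _ T).1 hTm).2 i (Finset.mem_insert_self _ _)
  let L : V →ₗ[ℝ] (A → ℝ) := LinearMap.pi fun i => (ev i.1).comp V.subtype
  have hL : LinearMap.ker L = ⊥ := by
    rw [Submodule.eq_bot_iff]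
    intro T hT
    have h1 : (T : M) ∈ K A :=
      (hK A T).2 ⟨T.2, fun i hi => congrFun (LinearMap.mem_ker.1 hT) ⟨i, hi⟩⟩
    rw [hA] at h1
    exact Subtype.ext h1
  obtain ⟨C, -, hC⟩ := L.exists_antilipschitzWith hL
  refine ⟨A, C, fun T hT => ?_⟩
  have h1 : ‖T‖ ≤ C * ‖L ⟨T, hT⟩‖ := by
    simpa using! hC.le_mul_norm_sub (x := (⟨T, hT⟩ : V)) (y := 0)
  refine h1.trans (mul_le_mul_of_nonneg_left ?_ C.2)
  refine (pi_norm_le_iff_of_nonneg (Finset.sum_nonneg fun _ _ => norm_nonneg _)).2 fun i => ?_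
  exact Finset.single_le_sum (f := fun i => ‖ev i T‖) (fun _ _ => norm_nonneg _) i.2

/-- The norm of a symmetric `k`-linear form, `k ≥ 1`, is controlled by its values at finitely many
diagonal unit vectors, which do not depend on the form. -/
theorem exists_finset_norm_le_sum_diagonal [FiniteDimensional ℝ E] {k : ℕ} (hk : k ≠ 0) :
    ∃ (A : Finset (Metric.sphere (0 : E) 1)) (C : ℝ≥0),
      ∀ T : ContinuousMultilinearMap ℝ (fun _ : Fin k => E) ℝ,
        (∀ (v : Fin k → E) (σ : Equiv.Perm (Fin k)), T (v ∘ σ) = T v) →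
        ‖T‖ ≤ C * ∑ ξ ∈ A, ‖T (fun _ => (ξ : E))‖ := by
  let ev : (Fin k → E) → ContinuousMultilinearMap ℝ (fun _ : Fin k => E) ℝ →ₗ[ℝ] ℝ := fun v =>
    (ContinuousMultilinearMap.apply ℝ (fun _ : Fin k => E) ℝ v).toLinearMap
  let V : Submodule ℝ (ContinuousMultilinearMap ℝ (fun _ : Fin k => E) ℝ) :=
    ⨅ (v : Fin k → E) (σ : Equiv.Perm (Fin k)), LinearMap.ker (ev (v ∘ σ) - ev v)
  have hV : ∀ T : ContinuousMultilinearMap ℝ (fun _ : Fin k => E) ℝ, T ∈ V ↔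
      ∀ (v : Fin k → E) (σ : Equiv.Perm (Fin k)), T (v ∘ σ) = T v := by
    intro T
    simp only [V, Submodule.mem_iInf, LinearMap.mem_ker, LinearMap.sub_apply, sub_eq_zero]
    exact Iff.rfl
  obtain ⟨A, C, h⟩ := exists_finset_norm_le_sum V
    (fun ξ : Metric.sphere (0 : E) 1 => ev fun _ => (ξ : E)) (by
      intro T hT h0
      refine eq_zero_of_diagonal_eq_zero T ((hV T).1 hT) fun x => ?_
      by_cases hx : x = 0
      · subst hx
        exact T.map_coord_zero (⟨0, Nat.pos_of_ne_zero hk⟩ : Fin k) rfl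
      have h1 : T (fun _ => ‖x‖⁻¹ • x) = 0 := h0 ⟨‖x‖⁻¹ • x, by simp [norm_smul, hx]⟩
      have h2 := T.map_smul_univ (fun _ => ‖x‖⁻¹) (fun _ => x)
      rw [h1] at h2
      exact (smul_eq_zero.1 h2.symm).resolve_left (by simp [hx]))
  exact ⟨A, C, fun T hT => h T ((hV T).2 hT)⟩

end Multilinear

/-! ### Weak derivatives of smooth functions -/

section WeakDerivative
variable {N : ℕ}

theorem hasCompactSupport_iteratedFDeriv_apply {E F : Type*} [NormedAddCommGroup E]
    [NormedSpace ℝ E] [NormedAddCommGroup F] [NormedSpace ℝ F] {f : E → F}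
    (hf : HasCompactSupport f) (k : ℕ) (v : Fin k → E) :
    HasCompactSupport (fun y => iteratedFDeriv ℝ k f y v) :=
  (hf.iteratedFDeriv k).comp_left
    (g := fun T : ContinuousMultilinearMap ℝ (fun _ : Fin k => E) F => T v) rfl

theorem fderiv_iteratedFDeriv_comm {E : Type*} [NormedAddCommGroup E] [NormedSpace ℝ E]
    {u : E → ℝ} (hu : ContDiff ℝ ∞ u) (k : ℕ) (v : Fin k → E) (w x : E) :
    iteratedFDeriv ℝ k (fun y => fderiv ℝ u y w) x v
      = fderiv ℝ (fun y => iteratedFDeriv ℝ k u y v) x w := by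
  have hd : ContDiff ℝ ∞ (fderiv ℝ u) := hu.fderiv_right (m := ∞) (by simp)
  have h1 := (ContinuousLinearMap.apply ℝ ℝ w).iteratedFDeriv_comp_left
    (hd.contDiffAt (x := x)) (i := k) (by exact WithTop.coe_le_coe.2 le_top)
  have h2 : (⇑(ContinuousLinearMap.apply ℝ ℝ w) ∘ fderiv ℝ u) = fun y => fderiv ℝ u y w := rfl
  rw [h2] at h1
  rw [h1]
  have h3 := iteratedFDeriv_succ_apply_right (𝕜 := ℝ) (f := u) (x := x) (Fin.snoc v w)
  have h4 := iteratedFDeriv_succ_apply_left' hu k (Fin.cons w v) x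
  rw [Fin.init_snoc, Fin.snoc_last] at h3
  rw [Fin.tail_cons, Fin.cons_zero] at h4
  rw [← h4]
  refine Eq.trans h3.symm ?_
  have h5 : (Fin.snoc v w : Fin (k + 1) → E) = (Fin.cons w v : Fin (k + 1) → E) ∘ finRotate _ := by
    rw [Fin.snoc_eq_cons_rotate]; rfl
  rw [h5, iteratedFDeriv_comp_perm hu]

/-- Integration by parts of order `k` against a test function. -/
theorem integral_mul_iteratedFDeriv {u φ : Eucl N → ℝ} (hu : ContDiff ℝ ∞ u)
    (hφ : ContDiff ℝ ∞ φ) (hφc : HasCompactSupport φ) (k : ℕ) (v : Fin k → Eucl N) :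
    ∫ x, u x * iteratedFDeriv ℝ k φ x v = (-1) ^ k * ∫ x, iteratedFDeriv ℝ k u x v * φ x := by
  induction k generalizing u φ with
  | zero => simp
  | succ k ih =>
    have hD : ContDiff ℝ ∞ (fun y => fderiv ℝ u y (v 0)) :=
      (hu.fderiv_right (m := ∞) (by simp)).clm_apply contDiff_const
    let ψ : Eucl N → ℝ := fun y => iteratedFDeriv ℝ k φ y (Fin.tail v)
    have hψ : ContDiff ℝ ∞ ψ := contDiff_iteratedFDeriv_apply hφ k _
    have hψc : HasCompactSupport ψ := hasCompactSupport_iteratedFDeriv_apply hφc k _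
    have h1 : ∫ x, u x * fderiv ℝ ψ x (v 0) = - ∫ x, fderiv ℝ u x (v 0) * ψ x := by
      refine integral_mul_fderiv_eq_neg_fderiv_mul_of_integrable ?_ ?_ ?_
        (fun x _ => hu.differentiable (by simp) x) (fun x _ => hψ.differentiable (by simp) x)
      · exact (hD.continuous.mul hψ.continuous).integrable_of_hasCompactSupport hψc.mul_left
      · refine (hu.continuous.mul ?_).integrable_of_hasCompactSupport
          (HasCompactSupport.mul_left ?_)
        · exact ((hψ.fderiv_right (m := ∞) (by simp)).clm_apply contDiff_const).continuous
        · exact hψc.fderiv_apply (𝕜 := ℝ) (v 0)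
      · exact (hu.continuous.mul hψ.continuous).integrable_of_hasCompactSupport hψc.mul_left
    calc ∫ x, u x * iteratedFDeriv ℝ (k + 1) φ x v
        = ∫ x, u x * fderiv ℝ ψ x (v 0) := by
          simp only [iteratedFDeriv_succ_apply_left' hφ, ψ]
      _ = - ∫ x, fderiv ℝ u x (v 0) * iteratedFDeriv ℝ k φ x (Fin.tail v) := h1
      _ = (-1) ^ (k + 1) * ∫ x, iteratedFDeriv ℝ (k + 1) u x v * φ x := by
          rw [ih hD hφ hφc]
          simp only [fderiv_iteratedFDeriv_comm hu, ← iteratedFDeriv_succ_apply_left' hu]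
          ring

theorem hasWeakDeriv_of_contDiff {u : Eucl N → ℝ} (hu : ContDiff ℝ ∞ u) (k : ℕ) :
    HasWeakDeriv k u (iteratedFDeriv ℝ k u) :=
  ⟨hu.continuous.locallyIntegrable, (contDiff_iteratedFDeriv hu k).continuous.locallyIntegrable,
    fun _ hφ hφc v => integral_mul_iteratedFDeriv hu hφ hφc k v⟩

/-- The weak derivative, where it exists, is not the default value `0`. -/
theorem hasWeakDeriv_weakDeriv {k : ℕ} {f : Eucl N → ℝ} (h : ∃ G, HasWeakDeriv k f G) :
    HasWeakDeriv k f (weakDeriv k f) := by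
  rw [weakDeriv, dif_pos h]
  exact h.choose_spec

theorem HasWeakDeriv.ae_eq {k : ℕ} {f : Eucl N → ℝ}
    {G H : Eucl N → ContinuousMultilinearMap ℝ (fun _ : Fin k => Eucl N) ℝ}
    (hG : HasWeakDeriv k f G) (hH : HasWeakDeriv k f H) : G =ᵐ[volume] H := by
  refine ae_eq_of_integral_contDiff_smul_eq hG.2.1 hH.2.1 fun φ hφ hφc => ?_
  have hi : ∀ {G : Eucl N → ContinuousMultilinearMap ℝ (fun _ : Fin k => Eucl N) ℝ},
      HasWeakDeriv k f G → Integrable (fun x => φ x • G x) := fun hG =>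
    hG.2.1.integrable_smul_left_of_hasCompactSupport hφ.continuous hφc
  ext v
  have e : ∀ {G : Eucl N → ContinuousMultilinearMap ℝ (fun _ : Fin k => Eucl N) ℝ},
      HasWeakDeriv k f G → (∫ x, φ x • G x) v
        = (-1) ^ k * ∫ x, f x * iteratedFDeriv ℝ k φ x v := by
    intro G hG
    rw [hG.2.2 φ hφ hφc v, ← mul_assoc, ← mul_pow]
    simp only [mul_neg, mul_one, neg_neg, one_pow, one_mul]
    have := (ContinuousMultilinearMap.apply ℝ (fun _ : Fin k => Eucl N) ℝ v).integral_comp_comm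
      (hi hG)
    refine Eq.trans this.symm (integral_congr_ae (Eventually.of_forall fun x => ?_))
    simp [mul_comm]
  rw [e hG, e hH]

theorem weakDeriv_ae_eq_iteratedFDeriv {u : Eucl N → ℝ} (hu : ContDiff ℝ ∞ u) (k : ℕ) :
    weakDeriv k u =ᵐ[volume] iteratedFDeriv ℝ k u :=
  (hasWeakDeriv_weakDeriv ⟨_, hasWeakDeriv_of_contDiff hu k⟩).ae_eq (hasWeakDeriv_of_contDiff hu k)

end WeakDerivative

/-! ### Mollification -/

section Mollification
variable {N : ℕ} {F : Type*} [NormedAddCommGroup F] [NormedSpace ℝ F]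

/-- The regularisation `ρ * f` of a function `f` with values in a normed space by a kernel `ρ`. -/
noncomputable def mollify (ρ : Eucl N → ℝ) (f : Eucl N → F) (x : Eucl N) : F :=
  ∫ y, ρ (x - y) • f y

theorem mollify_eq_convolution (ρ : Eucl N → ℝ) (f : Eucl N → F) :
    mollify ρ f = convolution f ρ (ContinuousLinearMap.lsmul ℝ ℝ).flip volume := by
  funext x
  simp [mollify, convolution]

theorem mollify_eq_integral_sub (ρ : Eucl N → ℝ) (f : Eucl N → F) (x : Eucl N) :
    mollify ρ f x = ∫ t, ρ t • f (x - t) := by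
  rw [mollify, ← integral_sub_left_eq_self _ volume x]
  simp

theorem contDiff_mollify {ρ : Eucl N → ℝ} (hρ : ContDiff ℝ ∞ ρ) (hρc : HasCompactSupport ρ)
    {f : Eucl N → F} (hf : LocallyIntegrable f) : ContDiff ℝ ∞ (mollify ρ f) := by
  rw [mollify_eq_convolution]
  exact hρc.contDiff_convolution_right _ hf hρ

theorem integrable_mollify_integrand {ρ : Eucl N → ℝ} (hρ : Continuous ρ)
    (hρc : HasCompactSupport ρ) {f : Eucl N → F} (hf : LocallyIntegrable f) (x : Eucl N) :
    Integrable (fun y => ρ (x - y) • f y) :=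
  hf.integrable_smul_left_of_hasCompactSupport (by fun_prop)
    (hρc.comp_homeomorph (Homeomorph.subLeft x))

theorem fderiv_mollify {ρ f : Eucl N → ℝ} (hρ : ContDiff ℝ ∞ ρ)
    (hρc : HasCompactSupport ρ) (hf : LocallyIntegrable f) (x w : Eucl N) :
    fderiv ℝ (mollify ρ f) x w = mollify (fun y => fderiv ℝ ρ y w) f x := by
  have h := hρc.hasFDerivAt_convolution_right (ContinuousLinearMap.lsmul ℝ ℝ).flip hf
    (hρ.of_le (by exact WithTop.coe_le_coe.2 le_top)) x
  rw [mollify_eq_convolution, h.fderiv, convolution, mollify,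
    ContinuousLinearMap.integral_apply]
  · refine integral_congr_ae (Eventually.of_forall fun y => ?_)
    simp [ContinuousLinearMap.precompR]
  · exact (hρc.fderiv ℝ).convolutionExists_right _ hf
      (hρ.continuous_fderiv (by simp)) x

theorem iteratedFDeriv_mollify {ρ f : Eucl N → ℝ} (hρ : ContDiff ℝ ∞ ρ)
    (hρc : HasCompactSupport ρ) (hf : LocallyIntegrable f) (k : ℕ) (x : Eucl N)
    (v : Fin k → Eucl N) :
    iteratedFDeriv ℝ k (mollify ρ f) x v = mollify (fun y => iteratedFDeriv ℝ k ρ y v) f x := by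
  induction k generalizing x with
  | zero => simp
  | succ k ih =>
    rw [iteratedFDeriv_succ_apply_left' (contDiff_mollify hρ hρc hf)]
    simp only [ih, iteratedFDeriv_succ_apply_left' hρ]
    exact fderiv_mollify (contDiff_iteratedFDeriv_apply hρ k _)
      (hasCompactSupport_iteratedFDeriv_apply hρc k _) hf x (v 0)

theorem iteratedFDeriv_comp_const_sub {E F : Type*} [NormedAddCommGroup E] [NormedSpace ℝ E]
    [NormedAddCommGroup F] [NormedSpace ℝ F]
    {ρ : E → F} (hρ : ContDiff ℝ ∞ ρ) (k : ℕ) (x y : E)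
    (v : Fin k → E) :
    iteratedFDeriv ℝ k (fun y => ρ (x - y)) y v = (-1) ^ k • iteratedFDeriv ℝ k ρ (x - y) v := by
  induction k generalizing y with
  | zero => simp
  | succ k ih =>
    have h1 : ContDiff ℝ ∞ (fun y => ρ (x - y)) := hρ.comp (contDiff_const.sub contDiff_id)
    rw [iteratedFDeriv_succ_apply_left' h1, iteratedFDeriv_succ_apply_left' hρ]
    simp only [ih]
    have h2 := (contDiff_iteratedFDeriv_apply hρ k (Fin.tail v)).differentiable (by simp)
    have h3 : HasFDerivAt (fun y => iteratedFDeriv ℝ k ρ (x - y) (Fin.tail v))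
        ((fderiv ℝ (fun z => iteratedFDeriv ℝ k ρ z (Fin.tail v)) (x - y)).comp
          (-ContinuousLinearMap.id ℝ E)) y :=
      (h2 (x - y)).hasFDerivAt.comp y ((hasFDerivAt_id y).const_sub x)
    have h4 := h3.const_smul ((-1 : ℤ) ^ k)
    have h5 : fderiv ℝ (fun y => (-1 : ℤ) ^ k • iteratedFDeriv ℝ k ρ (x - y) (Fin.tail v)) y
      = _ := h4.fderiv
    rw [h5]
    simp [pow_succ]

/-- Regularisation commutes with weak differentiation. -/
theorem HasWeakDeriv.iteratedFDeriv_mollify {ρ : Eucl N → ℝ} (hρ : ContDiff ℝ ∞ ρ)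
    (hρc : HasCompactSupport ρ) {k : ℕ} {f : Eucl N → ℝ}
    {G : Eucl N → ContinuousMultilinearMap ℝ (fun _ : Fin k => Eucl N) ℝ}
    (hG : HasWeakDeriv k f G) (x : Eucl N) :
    iteratedFDeriv ℝ k (mollify ρ f) x = mollify ρ G x := by
  ext v
  have h1 := hG.2.2 (fun y => ρ (x - y)) (hρ.comp (contDiff_const.sub contDiff_id))
    (hρc.comp_homeomorph (Homeomorph.subLeft x)) v
  have h2 := (ContinuousMultilinearMap.apply ℝ (fun _ : Fin k => Eucl N) ℝ v).integral_comp_comm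
      (integrable_mollify_integrand hρ.continuous hρc hG.2.1 x)
  rw [AffineSobolev.iteratedFDeriv_mollify hρ hρc hG.1]
  refine Eq.trans ?_ h2
  have h3 : ∫ y, f y * iteratedFDeriv ℝ k (fun y => ρ (x - y)) y v
      = (-1) ^ k * mollify (fun y => iteratedFDeriv ℝ k ρ y v) f x := by
    rw [mollify, ← integral_const_mul]
    refine integral_congr_ae (Eventually.of_forall fun y => ?_)
    simp only [iteratedFDeriv_comp_const_sub hρ, zsmul_eq_mul, smul_eq_mul]
    push_cast
    ring
  rw [h3] at h1
  have h4 : ((-1 : ℝ) ^ k) ≠ 0 := by positivity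
  rw [mul_left_cancel₀ h4 h1]
  refine integral_congr_ae (Eventually.of_forall fun y => ?_)
  simp [mul_comm]

end Mollification

/-! ### Averages in `L^r` -/

section LpNorm
variable {X F : Type*} [MeasurableSpace X] [NormedAddCommGroup F] {m : Measure X} {r : ℝ}

theorem eLpNorm_eq_lintegral_rpow (hr : 0 < r) (f : X → F) :
    eLpNorm f (ENNReal.ofReal r) m = (∫⁻ x, ‖f x‖ₑ ^ r ∂m) ^ (1 / r) := by
  rw [eLpNorm_eq_lintegral_rpow_enorm_toReal (by simpa using hr) ENNReal.ofReal_ne_top,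
    ENNReal.toReal_ofReal hr.le]

theorem eLpNorm_rpow_eq_lintegral (hr : 0 < r) (f : X → F) :
    eLpNorm f (ENNReal.ofReal r) m ^ r = ∫⁻ x, ‖f x‖ₑ ^ r ∂m := by
  rw [eLpNorm_eq_lintegral_rpow hr, ← ENNReal.rpow_mul, one_div_mul_cancel hr.ne',
    ENNReal.rpow_one]

theorem eLpNorm_le_iff_lintegral_le (hr : 0 < r) (f : X → F) (c : ℝ≥0∞) :
    eLpNorm f (ENNReal.ofReal r) m ≤ c ↔ ∫⁻ x, ‖f x‖ₑ ^ r ∂m ≤ c ^ r := by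
  rw [← eLpNorm_rpow_eq_lintegral hr, ENNReal.rpow_le_rpow_iff hr]

end LpNorm

section Jensen

/-- Jensen's inequality for the power `r ≥ 1` and a probability measure. -/
theorem rpow_lintegral_le {T : Type*} [MeasurableSpace T] {P : Measure T}
    [IsProbabilityMeasure P] {r : ℝ} (hr : 1 < r) {g : T → ℝ≥0∞} (hg : AEMeasurable g P) :
    (∫⁻ t, g t ∂P) ^ r ≤ ∫⁻ t, g t ^ r ∂P := by
  have h := ENNReal.lintegral_mul_le_Lp_mul_Lq P (Real.HolderConjugate.conjExponent hr) hg
    (aemeasurable_const (b := (1 : ℝ≥0∞)))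
  simp only [Pi.mul_apply, mul_one, ENNReal.one_rpow, lintegral_const, measure_univ] at h
  calc (∫⁻ t, g t ∂P) ^ r ≤ ((∫⁻ t, g t ^ r ∂P) ^ (1 / r)) ^ r := by gcongr
    _ = ∫⁻ t, g t ^ r ∂P := by
      rw [← ENNReal.rpow_mul, one_div_mul_cancel (by positivity), ENNReal.rpow_one]

/-- The `L^r` norm of an average is at most the average of the `r`-th powers of the `L^r`
norms. -/
theorem lintegral_rpow_lintegral_le {X T : Type*} [MeasurableSpace X] [MeasurableSpace T]
    {m : Measure X} [SFinite m] {P : Measure T} [IsProbabilityMeasure P] {r : ℝ} (hr : 1 < r)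
    {h : X → T → ℝ≥0∞} (hh : Measurable (Function.uncurry h)) :
    ∫⁻ x, (∫⁻ t, h x t ∂P) ^ r ∂m ≤ ∫⁻ t, ∫⁻ x, h x t ^ r ∂m ∂P := by
  calc ∫⁻ x, (∫⁻ t, h x t ∂P) ^ r ∂m ≤ ∫⁻ x, ∫⁻ t, h x t ^ r ∂P ∂m :=
        lintegral_mono fun x => rpow_lintegral_le hr (hh.comp measurable_prodMk_left).aemeasurable
    _ = ∫⁻ t, ∫⁻ x, h x t ^ r ∂m ∂P :=
        lintegral_lintegral_swap (hh.pow_const r).aemeasurable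

end Jensen

section Mollification
variable {N : ℕ} {F : Type*} [NormedAddCommGroup F] [NormedSpace ℝ F]

/-- The measure with density `ρ`, a probability measure when `ρ` is a mollifier. A negative `ρ` is
truncated at `0`. -/
noncomputable def kernelMeasure (ρ : Eucl N → ℝ) : Measure (Eucl N) :=
  volume.withDensity fun t => ENNReal.ofReal (ρ t)

theorem isProbabilityMeasure_kernelMeasure {ρ : Eucl N → ℝ} (h0 : ∀ t, 0 ≤ ρ t)
    (hi : Integrable ρ) (h1 : ∫ t, ρ t = 1) : IsProbabilityMeasure (kernelMeasure ρ) := by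
  constructor
  rw [kernelMeasure, withDensity_apply _ MeasurableSet.univ, Measure.restrict_univ,
    ← ofReal_integral_eq_lintegral_ofReal hi (Eventually.of_forall h0), h1, ENNReal.ofReal_one]

/-- The pointwise error of a regularisation is at most the average oscillation. -/
theorem enorm_mollify_sub_le [CompleteSpace F] {ρ : Eucl N → ℝ} (hρ : Continuous ρ)
    (hρc : HasCompactSupport ρ) (h0 : ∀ t, 0 ≤ ρ t) (h1 : ∫ t, ρ t = 1) {f : Eucl N → F}
    (hf : LocallyIntegrable f) (x : Eucl N) :
    ‖mollify ρ f x - f x‖ₑ ≤ ∫⁻ t, ‖f (x - t) - f x‖ₑ ∂(kernelMeasure ρ) := by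
  have hρi : Integrable ρ := hρ.integrable_of_hasCompactSupport hρc
  have h2 : Integrable (fun t => ρ t • f (x - t)) := by
    have := (integrable_mollify_integrand hρ hρc hf x).comp_sub_left x
    simpa using this
  have h3 : mollify ρ f x - f x = ∫ t, ρ t • (f (x - t) - f x) := by
    have h4 : ∫ t, ρ t • f x = f x := by rw [integral_smul_const, h1, one_smul]
    rw [mollify_eq_integral_sub, ← h4, ← integral_sub h2 (hρi.smul_const _), h4]
    simp only [smul_sub]
  rw [h3]
  refine (enorm_integral_le_lintegral_enorm _).trans (le_of_eq ?_)
  rw [kernelMeasure, lintegral_withDensity_eq_lintegral_mul_non_measurable _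
    hρ.measurable.ennreal_ofReal (Eventually.of_forall fun t => ENNReal.ofReal_lt_top)]
  refine lintegral_congr fun t => ?_
  rw [enorm_smul, Pi.mul_apply, Real.enorm_of_nonneg (h0 t)]

/-- Translations are continuous in `L^r`. -/
theorem exists_forall_translate_le {F : Type*} [NormedAddCommGroup F] {r : ℝ} (hr : 1 < r)
    {f : Eucl N → F}
    (hf : MemLp f (ENNReal.ofReal r)) {ε : ℝ≥0∞} (hε : 0 < ε) :
    ∃ δ > 0, ∀ t : Eucl N, ‖t‖ < δ →
      eLpNorm (fun x => f (x - t) - f x) (ENNReal.ofReal r) volume ≤ ε := by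
  have : Fact (1 ≤ ENNReal.ofReal r) := ⟨by simpa using hr.le⟩
  let g : Eucl N → C(Eucl N, Eucl N) :=
    fun t => ⟨fun x => x - t, continuous_id.sub continuous_const⟩
  have hg : Continuous g := ContinuousMap.continuous_of_continuous_uncurry _
    (by simp only [Function.uncurry_def, g, ContinuousMap.coe_mk]; fun_prop)
  have hgm : ∀ t, MeasurePreserving (g t) volume volume := fun t =>
    measurePreserving_sub_right volume t
  have hc := (continuous_const (y := hf.toLp f)).compMeasurePreservingLp hg hgm
    ENNReal.ofReal_ne_top
  have h0 := hc.tendsto 0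
  rw [EMetric.tendsto_nhds] at h0
  obtain ⟨δ, hδ, h⟩ := Metric.eventually_nhds_iff.1 (h0 ε hε)
  refine ⟨δ, hδ, fun t ht => ?_⟩
  have h1 := (h (y := t) (by simpa using ht)).le
  rw [Lp.edist_def] at h1
  refine le_trans (le_of_eq (eLpNorm_congr_ae ?_)) h1
  have e : ∀ t, (Lp.compMeasurePreserving (g t) (hgm t) (hf.toLp f) : Eucl N → F)
      =ᵐ[volume] fun x => f (x - t) := fun t =>
    (Lp.coeFn_compMeasurePreserving _ (hgm t)).trans
      ((hgm t).quasiMeasurePreserving.ae_eq_comp hf.coeFn_toLp)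
  filter_upwards [e t, e 0] with x h1 h2
  rw [Pi.sub_apply, h1, h2, sub_zero]

/-- Regularisations converge in `L^r`. -/
theorem exists_forall_mollify_sub_le [CompleteSpace F] {r : ℝ} (hr : 1 < r) {f : Eucl N → F}
    (hf : MemLp f (ENNReal.ofReal r)) {ε : ℝ≥0∞} (hε : 0 < ε) :
    ∃ δ > 0, ∀ φ : ContDiffBump (0 : Eucl N), φ.rOut ≤ δ →
      eLpNorm (fun x => mollify (φ.normed volume) f x - f x) (ENNReal.ofReal r) volume ≤ ε := by
  have hr0 : 0 < r := by linarith
  obtain ⟨δ, hδ, h⟩ := exists_forall_translate_le hr hf hε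
  refine ⟨δ, hδ, fun φ hφ => ?_⟩
  set ρ := φ.normed volume
  have hP : IsProbabilityMeasure (kernelMeasure ρ) := isProbabilityMeasure_kernelMeasure
    φ.nonneg_normed φ.integrable_normed φ.integral_normed
  obtain ⟨g, hg, hfg⟩ := hf.1
  have hgL : MemLp g (ENNReal.ofReal r) := hf.ae_eq hfg
  have hmg : mollify ρ f = mollify ρ g := by
    funext x
    refine integral_congr_ae ?_
    filter_upwards [hfg] with y hy
    rw [hy]
  have e1 : (fun x => mollify ρ f x - f x) =ᵐ[volume] fun x => mollify ρ g x - g x := by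
    filter_upwards [hfg] with y hy
    rw [hy, hmg]
  have h' : ∀ t : Eucl N, ‖t‖ < δ → ∫⁻ x, ‖g (x - t) - g x‖ₑ ^ r ≤ ε ^ r := by
    intro t ht
    have h2 := h t ht
    have e2 : (fun x => f (x - t) - f x) =ᵐ[volume] fun x => g (x - t) - g x := by
      filter_upwards [hfg, (measurePreserving_sub_right volume t).quasiMeasurePreserving.ae_eq_comp
        hfg] with x hx hx2
      simp only [Function.comp_apply] at hx2
      rw [hx, hx2]
    rw [eLpNorm_congr_ae e2, eLpNorm_le_iff_lintegral_le hr0] at h2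
    exact h2
  rw [eLpNorm_congr_ae e1, eLpNorm_le_iff_lintegral_le hr0]
  have hgl : LocallyIntegrable g := hgL.locallyIntegrable (by simpa using hr.le)
  calc ∫⁻ x, ‖mollify ρ g x - g x‖ₑ ^ r
      ≤ ∫⁻ x, (∫⁻ t, ‖g (x - t) - g x‖ₑ ∂(kernelMeasure ρ)) ^ r := by
        gcongr with x
        exact enorm_mollify_sub_le φ.continuous_normed φ.hasCompactSupport_normed
          φ.nonneg_normed φ.integral_normed hgl x
    _ ≤ ∫⁻ t, ∫⁻ x, ‖g (x - t) - g x‖ₑ ^ r ∂volume ∂(kernelMeasure ρ) := by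
        refine lintegral_rpow_lintegral_le hr ?_
        exact ((hg.comp_measurable (measurable_fst.sub measurable_snd)).sub
          (hg.comp_measurable measurable_fst)).enorm
    _ ≤ ∫⁻ t, ε ^ r ∂(kernelMeasure ρ) := by
        refine lintegral_mono_ae ?_
        rw [kernelMeasure, ae_withDensity_iff φ.continuous_normed.measurable.ennreal_ofReal]
        refine Eventually.of_forall fun t ht => h' t ?_
        have : t ∈ Function.support ρ := fun h0 => ht (by
          change ENNReal.ofReal (ρ t) = 0
          rw [h0, ENNReal.ofReal_zero])
        rw [φ.support_normed_eq, mem_ball_zero_iff] at this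
        linarith
    _ = ε ^ r := by simp

end Mollification

/-! ### Smooth approximation in the Sobolev space -/

section Approximation
variable {N : ℕ}

/-- A function of the Sobolev space is approximated by smooth functions, in `L^q` together with
its derivatives of order `s` in `L^p`. -/
theorem MemSobolev.exists_contDiff_approx {s : ℕ} {p : ℝ} (hp : 1 < p)
    (hq : 1 < critExp N s p) {f : Eucl N → ℝ} (hf : MemSobolev s p f) {ε : ℝ≥0∞} (hε : 0 < ε) :
    ∃ g : Eucl N → ℝ, ContDiff ℝ ∞ g ∧
      eLpNorm (fun x => g x - f x) (ENNReal.ofReal (critExp N s p)) volume ≤ ε ∧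
      eLpNorm (fun x => iteratedFDeriv ℝ s g x - weakDeriv s f x) (ENNReal.ofReal p) volume ≤ ε := by
  obtain ⟨δ₁, hδ₁, h₁⟩ := exists_forall_mollify_sub_le hq hf.1 hε
  obtain ⟨δ₂, hδ₂, h₂⟩ := exists_forall_mollify_sub_le hp hf.2.2 hε
  have hδ : 0 < min δ₁ δ₂ := lt_min hδ₁ hδ₂
  let φ : ContDiffBump (0 : Eucl N) := ⟨min δ₁ δ₂ / 2, min δ₁ δ₂, half_pos hδ, half_lt_self hδ⟩
  have hw := hasWeakDeriv_weakDeriv (hf.2.1 s le_rfl)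
  refine ⟨mollify (φ.normed volume) f, contDiff_mollify φ.contDiff_normed
    φ.hasCompactSupport_normed hw.1, h₁ φ (min_le_left _ _), ?_⟩
  simp only [hw.iteratedFDeriv_mollify φ.contDiff_normed φ.hasCompactSupport_normed]
  exact h₂ φ (min_le_right _ _)

end Approximation

/-! ### The Sobolev inequality for test functions -/

section Sobolev
variable {N : ℕ}

/-- The Sobolev inequality of order `s` for test functions, by iterating the
Gagliardo-Nirenberg-Sobolev inequality. -/
theorem exists_eLpNorm_le_iteratedFDeriv (hN : 0 < N) (s : ℕ) (p q : ℝ≥0) (hp : 1 ≤ p) (hq : 0 < q)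
    (hpq : (q : ℝ)⁻¹ = (p : ℝ)⁻¹ - s * (N : ℝ)⁻¹) :
    ∃ C : ℝ≥0, ∀ u : Eucl N → ℝ, ContDiff ℝ ∞ u → HasCompactSupport u →
      eLpNorm u q volume ≤ C * eLpNorm (iteratedFDeriv ℝ s u) p volume := by
  induction s generalizing p with
  | zero =>
    have : q = p := by simpa [← NNReal.coe_inv] using hpq
    subst this
    refine ⟨1, fun u _ _ => le_of_eq ?_⟩
    rw [ENNReal.coe_one, one_mul]
    exact eLpNorm_congr_norm_ae (Eventually.of_forall fun x => (norm_iteratedFDeriv_zero).symm)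
  | succ s ih =>
    have hN' : 0 < (N : ℝ)⁻¹ := by positivity
    have hq' : 0 < (q : ℝ)⁻¹ := by positivity
    have hpos : 0 < (p : ℝ)⁻¹ - (N : ℝ)⁻¹ := by
      push_cast at hpq
      have : 0 ≤ (s : ℝ) * (N : ℝ)⁻¹ := by positivity
      linarith
    have hp0 : (0 : ℝ) < p := lt_of_lt_of_le one_pos (by exact_mod_cast hp)
    let p₁ : ℝ≥0 := ⟨((p : ℝ)⁻¹ - (N : ℝ)⁻¹)⁻¹, by positivity⟩
    have hp₁ : (p₁ : ℝ)⁻¹ = (p : ℝ)⁻¹ - (N : ℝ)⁻¹ := inv_inv _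
    have h1 : 1 ≤ p₁ := by
      refine hp.trans ?_
      have : (p : ℝ) ≤ ((p : ℝ)⁻¹ - (N : ℝ)⁻¹)⁻¹ := by
        rw [le_inv_comm₀ hp0 hpos]
        linarith
      exact_mod_cast this
    obtain ⟨C, hC⟩ := ih p₁ h1 (by rw [hp₁, hpq]; push_cast; ring)
    refine ⟨C * SNormLESNormFDerivOfEqConst
      (ContinuousMultilinearMap ℝ (fun _ : Fin s => Eucl N) ℝ) (volume : Measure (Eucl N)) p,
      fun u hu huc => (hC u hu huc).trans ?_⟩
    rw [ENNReal.coe_mul, mul_assoc]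
    gcongr
    refine (eLpNorm_le_eLpNorm_fderiv_of_eq volume
      ((contDiff_iteratedFDeriv hu s).of_le (by exact WithTop.coe_le_coe.2 le_top))
      (huc.iteratedFDeriv s) hp (by simpa using hN) (by simpa using hp₁)).trans_eq ?_
    congr 1
    exact eLpNorm_congr_norm_ae (Eventually.of_forall fun x => norm_fderiv_iteratedFDeriv)

end Sobolev

/-! ### The commutator of `D^s` and multiplication by a test function -/

section Leibniz
variable {E : Type*} [NormedAddCommGroup E] [NormedSpace ℝ E]

theorem natCast_le_top (s : ℕ) : (s : WithTop ℕ∞) ≤ ((⊤ : ℕ∞) : WithTop ℕ∞) :=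
  WithTop.coe_le_coe.2 le_top

/-- In the Leibniz formula for `D^s (φ g)`, all terms other than `φ D^s g` involve derivatives of
`g` of order less than `s`. -/
theorem exists_norm_iteratedFDeriv_mul_sub_le {φ : E → ℝ} (hφ : ContDiff ℝ ∞ φ)
    (hφc : HasCompactSupport φ) (s : ℕ) :
    ∃ C : ℝ≥0, ∀ g : E → ℝ, ContDiff ℝ ∞ g → ∀ x,
      ‖iteratedFDeriv ℝ s (fun y => φ y * g y) x - φ x • iteratedFDeriv ℝ s g x‖
        ≤ (tsupport φ).indicator (fun x => C * ∑ k ∈ Finset.range s, ‖iteratedFDeriv ℝ k g x‖) x := by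
  have hb : ∀ i, ∃ M : ℝ, ∀ x, ‖iteratedFDeriv ℝ i φ x‖ ≤ M := fun i =>
    (contDiff_iteratedFDeriv hφ i).continuous.bounded_above_of_compact_support
      (hφc.iteratedFDeriv i)
  choose M hM using hb
  let C : ℝ := ∑ i ∈ Finset.range s, s.choose (i + 1) * M (i + 1)
  have hM0 : ∀ i, 0 ≤ M i := fun i => (norm_nonneg _).trans (hM i 0)
  have hC : 0 ≤ C := Finset.sum_nonneg fun i _ => mul_nonneg (by positivity) (hM0 _)
  refine ⟨⟨C, hC⟩, fun g hg x => ?_⟩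
  by_cases hx : x ∈ tsupport φ
  · rw [Set.indicator_of_mem hx]
    -- Freezing the value of `φ` at `x` removes the term with no derivative on `φ`.
    have hψ : ContDiff ℝ ∞ (fun y => φ y - φ x) := hφ.sub contDiff_const
    have h1 : iteratedFDeriv ℝ s (fun y => φ y * g y) x - φ x • iteratedFDeriv ℝ s g x
        = iteratedFDeriv ℝ s (fun y => (φ y - φ x) * g y) x := by
      have e : (fun y => φ y * g y) = (fun y => (φ y - φ x) * g y) + fun y => φ x • g y := by
        funext y; simp; ring
      have hle := natCast_le_top s
      rw [e, iteratedFDeriv_add_apply ((hψ.mul hg).of_le hle).contDiffAt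
        ((hg.const_smul (φ x)).of_le hle).contDiffAt,
        show (fun y => φ x • g y) = φ x • g from rfl,
        iteratedFDeriv_const_smul_apply (hg.of_le hle).contDiffAt, add_sub_cancel_right]
    rw [h1]
    refine (norm_iteratedFDeriv_mul_le hψ hg x (n := s)
      (natCast_le_top s)).trans ?_
    rw [Finset.sum_range_succ']
    simp only [norm_iteratedFDeriv_zero, sub_self, norm_zero, mul_zero, zero_mul, add_zero]
    change _ ≤ C * _
    rw [Finset.sum_mul]
    refine Finset.sum_le_sum fun i hi => ?_
    have hi' := Finset.mem_range.1 hi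
    have h2 : iteratedFDeriv ℝ (i + 1) (fun y => φ y - φ x) x = iteratedFDeriv ℝ (i + 1) φ x := by
      have hle := natCast_le_top (i + 1)
      have := iteratedFDeriv_sub_apply (𝕜 := ℝ) (i := i + 1) (x := x) (f := φ)
        (g := fun _ => φ x) (hφ.of_le hle).contDiffAt contDiff_const.contDiffAt
      rw [iteratedFDeriv_const_of_ne (Nat.succ_ne_zero i)] at this
      simpa using! this
    rw [h2]
    gcongr
    · exact mul_nonneg (by positivity) (hM0 _)
    · exact hM _ x
    · exact Finset.single_le_sum (f := fun k => ‖iteratedFDeriv ℝ k g x‖)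
        (fun _ _ => norm_nonneg _) (Finset.mem_range.2 (by omega))
  · rw [Set.indicator_of_notMem hx, image_eq_zero_of_notMem_tsupport hx, zero_smul, sub_zero]
    have h1 : x ∉ tsupport fun y => φ y * g y := fun h => hx (tsupport_mul_subset_left h)
    rw [image_eq_zero_of_notMem_tsupport (fun h => h1 (tsupport_iteratedFDeriv_subset s h)),
      norm_zero]

end Leibniz

/-! ### A local Poincaré inequality -/

section Poincare
variable {N : ℕ} {F : Type*} [NormedAddCommGroup F] [NormedSpace ℝ F] [CompleteSpace F]

theorem enorm_sub_le_lintegral_fderiv {v : Eucl N → F} (hv : ContDiff ℝ 1 v) (x t : Eucl N) :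
    ‖v (x - t) - v x‖ₑ ≤ ∫⁻ θ in Set.Ioc (0 : ℝ) 1, ‖t‖ₑ * ‖fderiv ℝ v (x - θ • t)‖ₑ := by
  have hd : ∀ θ ∈ Set.uIcc (0 : ℝ) 1, HasDerivAt (fun θ : ℝ => v (x - θ • t))
      (fderiv ℝ v (x - θ • t) (-t)) θ := by
    intro θ _
    have h1 : HasDerivAt (fun θ : ℝ => x - θ • t) (-t) θ := by
      simpa using ((hasDerivAt_id θ).smul_const t).const_sub x
    exact ((hv.differentiable (by simp) _).hasFDerivAt).comp_hasDerivAt θ h1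
  have hc : Continuous fun θ : ℝ => fderiv ℝ v (x - θ • t) (-t) :=
    ((hv.continuous_fderiv (by simp)).comp (by fun_prop)).clm_apply continuous_const
  have h := intervalIntegral.integral_eq_sub_of_hasDerivAt hd (hc.intervalIntegrable 0 1)
  simp only [one_smul, zero_smul, sub_zero] at h
  rw [← h, intervalIntegral.integral_of_le zero_le_one]
  refine (enorm_integral_le_lintegral_enorm _).trans (lintegral_mono fun θ => ?_)
  rw [mul_comm, ← enorm_neg t]
  exact ContinuousLinearMap.le_opENorm _ _

/-- A function differs from its regularisation at scale `ε` by at most `ε` times its gradient,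
locally in `L^p`. -/
theorem eLpNorm_mollify_sub_le {p : ℝ} (hp : 1 < p) {v : Eucl N → F} (hv : ContDiff ℝ 1 v)
    (φ : ContDiffBump (0 : Eucl N)) (R : ℝ) :
    eLpNorm (fun x => mollify (φ.normed volume) v x - v x) (ENNReal.ofReal p)
        (volume.restrict (Metric.closedBall 0 R))
      ≤ ENNReal.ofReal φ.rOut * eLpNorm (fderiv ℝ v) (ENNReal.ofReal p)
        (volume.restrict (Metric.closedBall 0 (R + φ.rOut))) := by
  have hp0 : 0 < p := by linarith
  set ρ := φ.normed volume
  set ε := φ.rOut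
  have hP : IsProbabilityMeasure (kernelMeasure ρ) := isProbabilityMeasure_kernelMeasure
    φ.nonneg_normed φ.integrable_normed φ.integral_normed
  have hQ : IsProbabilityMeasure (volume.restrict (Set.Ioc (0 : ℝ) 1)) := ⟨by simp⟩
  have hsupp : ∀ᵐ t ∂(kernelMeasure ρ), ‖t‖ < ε := by
    rw [kernelMeasure, ae_withDensity_iff φ.continuous_normed.measurable.ennreal_ofReal]
    refine Eventually.of_forall fun t ht => ?_
    have : t ∈ Function.support ρ := fun h0 => ht (by
      change ENNReal.ofReal (ρ t) = 0
      rw [h0, ENNReal.ofReal_zero])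
    rwa [φ.support_normed_eq, mem_ball_zero_iff] at this
  have hDc : Continuous (fderiv ℝ v) := hv.continuous_fderiv (by simp)
  set B := Metric.closedBall (0 : Eucl N) R
  set B' := Metric.closedBall (0 : Eucl N) (R + ε)
  set I : ℝ≥0∞ := ∫⁻ y in B', ‖fderiv ℝ v y‖ₑ ^ p
  rw [eLpNorm_le_iff_lintegral_le hp0, ENNReal.mul_rpow_of_nonneg _ _ hp0.le,
    eLpNorm_rpow_eq_lintegral hp0]
  let h : Eucl N → Eucl N × ℝ → ℝ≥0∞ := fun x z => ‖z.1‖ₑ * ‖fderiv ℝ v (x - z.2 • z.1)‖ₑ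
  have hh : Measurable (Function.uncurry h) := by
    change Measurable fun a : Eucl N × Eucl N × ℝ =>
      ‖a.2.1‖ₑ * ‖fderiv ℝ v (a.1 - a.2.2 • a.2.1)‖ₑ
    refine Measurable.mul (measurable_fst.comp measurable_snd).enorm ?_
    exact (hDc.comp (by fun_prop : Continuous fun a : Eucl N × Eucl N × ℝ =>
      a.1 - a.2.2 • a.2.1)).measurable.enorm
  calc ∫⁻ x in B, ‖mollify ρ v x - v x‖ₑ ^ p
      ≤ ∫⁻ x in B, (∫⁻ z, h x z ∂((kernelMeasure ρ).prod (volume.restrict (Set.Ioc (0 : ℝ) 1))))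
          ^ p := by
        gcongr with x
        rw [lintegral_prod (fun z => h x z) (hh.comp measurable_prodMk_left).aemeasurable]
        refine (enorm_mollify_sub_le φ.continuous_normed φ.hasCompactSupport_normed
          φ.nonneg_normed φ.integral_normed hv.continuous.locallyIntegrable x).trans ?_
        exact lintegral_mono fun t => enorm_sub_le_lintegral_fderiv hv x t
    _ ≤ ∫⁻ z, (∫⁻ x in B, h x z ^ p)
          ∂((kernelMeasure ρ).prod (volume.restrict (Set.Ioc (0 : ℝ) 1))) :=
        lintegral_rpow_lintegral_le hp hh
    _ ≤ ∫⁻ _, ENNReal.ofReal ε ^ p * I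
          ∂((kernelMeasure ρ).prod (volume.restrict (Set.Ioc (0 : ℝ) 1))) := by
        refine lintegral_mono_ae ?_
        have h1 := Measure.quasiMeasurePreserving_fst (μ := kernelMeasure ρ)
          (ν := volume.restrict (Set.Ioc (0 : ℝ) 1)) |>.ae hsupp
        have h2 := Measure.quasiMeasurePreserving_snd (μ := kernelMeasure ρ)
          (ν := volume.restrict (Set.Ioc (0 : ℝ) 1)) |>.ae (ae_restrict_mem measurableSet_Ioc)
        filter_upwards [h1, h2] with z hz1 hz2
        have hz3 : ‖z.2 • z.1‖ ≤ ε := by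
          rw [norm_smul, Real.norm_of_nonneg hz2.1.le]
          nlinarith [norm_nonneg z.1, hz2.2, hz2.1]
        simp only [h, ENNReal.mul_rpow_of_nonneg _ _ hp0.le]
        rw [lintegral_const_mul' _ _ (ENNReal.rpow_ne_top_of_nonneg hp0.le enorm_ne_top)]
        gcongr
        · rw [← ofReal_norm]
          exact ENNReal.ofReal_le_ofReal hz1.le
        · have hm := measurePreserving_sub_right (volume : Measure (Eucl N)) (z.2 • z.1)
          have hsub : B ⊆ (fun x => x - z.2 • z.1) ⁻¹' B' := by
            intro x hx
            simp only [B, B', Set.mem_preimage, mem_closedBall_zero_iff] at hx ⊢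
            exact (norm_sub_le _ _).trans (add_le_add hx hz3)
          calc ∫⁻ x in B, ‖fderiv ℝ v (x - z.2 • z.1)‖ₑ ^ p
              ≤ ∫⁻ x in (fun x => x - z.2 • z.1) ⁻¹' B', ‖fderiv ℝ v (x - z.2 • z.1)‖ₑ ^ p :=
                lintegral_mono_set hsub
            _ = I := hm.setLIntegral_comp_preimage Metric.isClosed_closedBall.measurableSet
                (hDc.measurable.enorm.pow_const p)
    _ = ENNReal.ofReal ε ^ p * I := by simp

end Poincare

/-! ### Differences of higher order -/

section FiniteDifference
open fwdDiff

/-- If the derivatives of order `s` of a sequence of functions tend to zero pointwise and locally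
boundedly, so do the differences of order `s`. -/
theorem tendsto_fwdDiff_iter {s : ℕ} {c : ℕ → ℝ → ℝ} (hc : ∀ n, ContDiff ℝ ∞ (c n))
    (h0 : ∀ t, Tendsto (fun n => iteratedDeriv s (c n) t) atTop (𝓝 0))
    (hb : ∀ T, ∃ C, ∀ᶠ n in atTop, ∀ t, |t| ≤ T → |iteratedDeriv s (c n) t| ≤ C) (L t : ℝ) :
    Tendsto (fun n => (fwdDiff L)^[s] (c n) t) atTop (𝓝 0) := by
  induction s generalizing c with
  | zero => simpa using h0 t
  | succ s ih =>
    have hd : ∀ n, ContDiff ℝ ∞ (fwdDiff L (c n)) := fun n =>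
      ((hc n).comp (contDiff_id.add contDiff_const)).sub (hc n)
    have hD : ∀ n, ContDiff ℝ 1 (iteratedDeriv s (c n)) := fun n => by
      rw [iteratedDeriv_eq_iterate]
      exact ContDiff.iterate_deriv' 1 s ((hc n).of_le (by
        exact_mod_cast natCast_le_top (1 + s)))
    have e : ∀ n t, iteratedDeriv s (fwdDiff L (c n)) t
        = ∫ u in t..(t + L), iteratedDeriv (s + 1) (c n) u := by
      intro n t
      have h1 : fwdDiff L (c n) = (fun u => c n (u + L)) - c n := rfl
      have h2 := intervalIntegral.integral_deriv_eq_sub' (iteratedDeriv s (c n)) (a := t)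
        (b := t + L) iteratedDeriv_succ.symm (fun x _ => (hD n).differentiable (by simp) x)
        (by rw [iteratedDeriv_succ]; exact ((hD n).continuous_deriv le_rfl).continuousOn)
      rw [h2, h1, iteratedDeriv_sub, iteratedDeriv_comp_add_const]
      · exact (((hc n).comp (contDiff_id.add contDiff_const)).of_le (natCast_le_top s)).contDiffAt
      · exact ((hc n).of_le (natCast_le_top s)).contDiffAt
    simp only [Function.iterate_succ_apply]
    refine ih hd (fun t => ?_) (fun T => ?_)
    · obtain ⟨C, hC⟩ := hb (|t| + |L|)
      simp only [e]
      have := intervalIntegral.tendsto_integral_filter_of_dominated_convergence (μ := volume)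
        (a := t) (b := t + L) (l := atTop) (F := fun n u => iteratedDeriv (s + 1) (c n) u)
        (f := fun _ => 0) (fun _ => C) ?_ ?_ ?_ ?_
      · simpa using this
      · refine Eventually.of_forall fun n => ?_
        rw [iteratedDeriv_succ]
        exact ((hD n).continuous_deriv le_rfl).aestronglyMeasurable
      · filter_upwards [hC] with n hn
        refine Eventually.of_forall fun u hu => hn u ?_
        rcases Set.mem_uIoc.1 hu with h | h <;>
          cases abs_cases t <;> cases abs_cases L <;> cases abs_cases u <;> linarith [h.1, h.2]
      · exact intervalIntegrable_const
      · exact Eventually.of_forall fun u _ => h0 u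
    · obtain ⟨C, hC⟩ := hb (T + |L|)
      refine ⟨C * |L|, ?_⟩
      filter_upwards [hC] with n hn t ht
      rw [e, ← Real.norm_eq_abs]
      refine (intervalIntegral.norm_integral_le_of_norm_le_const (C := C) fun u hu => ?_).trans_eq
        (by simp)
      refine hn u ?_
      rcases Set.mem_uIoc.1 hu with h | h <;>
        cases abs_cases t <;> cases abs_cases L <;> cases abs_cases u <;> linarith [h.1, h.2]

end FiniteDifference

section Line
variable {E : Type*} [NormedAddCommGroup E] [NormedSpace ℝ E]

theorem iteratedDeriv_comp_line {H : E → ℝ} (hH : ContDiff ℝ ∞ H) (x e : E) (k : ℕ) (t : ℝ) :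
    iteratedDeriv k (fun t : ℝ => H (x + t • e)) t
      = iteratedFDeriv ℝ k H (x + t • e) (fun _ => e) := by
  induction k generalizing t with
  | zero => simp
  | succ k ih =>
    rw [iteratedDeriv_succ, funext ih, iteratedFDeriv_succ_apply_left' hH]
    have h1 : HasDerivAt (fun t : ℝ => x + t • e) e t := by
      simpa using ((hasDerivAt_id t).smul_const e).const_add x
    exact (((contDiff_iteratedFDeriv_apply hH k fun _ => e).differentiable
      (by simp) _).hasFDerivAt.comp_hasDerivAt t h1).deriv

end Line

/-! ### A Rellich type theorem -/

section Compactness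
variable {N : ℕ}

/-- A regularisation is bounded pointwise by local `L^r` norms. -/
theorem exists_enorm_mollify_le {F : Type*} [NormedAddCommGroup F] [NormedSpace ℝ F]
    {ρ : Eucl N → ℝ} (hρ : Continuous ρ) (hρc : HasCompactSupport ρ) {r : ℝ} (hr : 1 < r) :
    ∃ (d : ℝ) (C : ℝ≥0), 0 ≤ d ∧ ∀ g : Eucl N → F, Continuous g → ∀ x,
      ‖mollify ρ g x‖ₑ
        ≤ C * eLpNorm g (ENNReal.ofReal r) (volume.restrict (Metric.closedBall x d)) := by
  obtain ⟨M, hM⟩ := hρ.bounded_above_of_compact_support hρc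
  obtain ⟨d, hd0, hd⟩ := hρc.isCompact.isBounded.subset_closedBall_lt 0 0
  let V : ℝ≥0∞ := volume (Metric.closedBall (0 : Eucl N) d)
  have hV : V ≠ ⊤ := measure_closedBall_lt_top.ne
  have hr' : (1 : ℝ≥0∞) ≤ ENNReal.ofReal r := by simpa using hr.le
  let a : ℝ := 1 / (1 : ℝ≥0∞).toReal - 1 / (ENNReal.ofReal r).toReal
  have ha : 0 ≤ a := by
    simp only [a, ENNReal.toReal_one, ENNReal.toReal_ofReal (by linarith : 0 ≤ r)]
    rw [div_one, sub_nonneg, div_le_one (by linarith)]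
    exact hr.le
  refine ⟨d, (ENNReal.ofReal M * V ^ a).toNNReal, hd0.le, fun g hg x => ?_⟩
  rw [ENNReal.coe_toNNReal (ENNReal.mul_ne_top ENNReal.ofReal_ne_top
    (ENNReal.rpow_ne_top_of_nonneg ha hV))]
  calc ‖mollify ρ g x‖ₑ ≤ ∫⁻ y, ‖ρ (x - y) • g y‖ₑ := enorm_integral_le_lintegral_enorm _
    _ ≤ ∫⁻ y, (Metric.closedBall x d).indicator (fun y => ENNReal.ofReal M * ‖g y‖ₑ) y := by
        gcongr with y
        by_cases hy : y ∈ Metric.closedBall x d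
        · rw [Set.indicator_of_mem hy, enorm_smul]
          gcongr
          rw [← ofReal_norm]
          exact ENNReal.ofReal_le_ofReal (hM _)
        · have : ρ (x - y) = 0 := by
            refine image_eq_zero_of_notMem_tsupport fun h => hy ?_
            have := hd h
            rwa [mem_closedBall_zero_iff, ← dist_eq_norm, dist_comm] at this
          simp [this]
    _ = ENNReal.ofReal M * eLpNorm g 1 (volume.restrict (Metric.closedBall x d)) := by
        rw [lintegral_indicator Metric.isClosed_closedBall.measurableSet,
          lintegral_const_mul' _ _ ENNReal.ofReal_ne_top, eLpNorm_one_eq_lintegral_enorm]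
    _ ≤ ENNReal.ofReal M * (eLpNorm g (ENNReal.ofReal r)
          (volume.restrict (Metric.closedBall x d)) * V ^ a) := by
        gcongr
        refine (eLpNorm_le_eLpNorm_mul_rpow_measure_univ hr' hg.aestronglyMeasurable).trans_eq ?_
        rw [Measure.restrict_apply_univ, Measure.addHaar_closedBall_center]
    _ = _ := by ring

/-- A sequence of smooth functions that is locally bounded in `L^q`, small in `L^q` far away,
whose derivatives of order `s` are locally bounded in `L^p` and whose pure directional derivatives
of order `s` tend to zero as distributions. Bounds are required only eventually in `n`, for each
ball separately, as weak-`*` convergence provides them directly. -/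
structure WeaklyNull (s : ℕ) (p q : ℝ) (G : ℕ → Eucl N → ℝ) : Prop where
  contDiff : ∀ n, ContDiff ℝ ∞ (G n)
  bounded : ∀ R : ℝ, ∃ C : ℝ≥0, ∀ᶠ n in atTop,
    eLpNorm (G n) (ENNReal.ofReal q) (volume.restrict (Metric.closedBall 0 R)) ≤ C
  small : ∀ (R : ℝ) (ε : ℝ≥0), 0 < ε → ∃ L : ℝ, ∀ y : Eucl N, L ≤ ‖y‖ → ∀ᶠ n in atTop,
    eLpNorm (G n) (ENNReal.ofReal q) (volume.restrict (Metric.closedBall y R)) ≤ ε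
  bounded_deriv : ∀ R : ℝ, ∃ C : ℝ≥0, ∀ᶠ n in atTop,
    eLpNorm (iteratedFDeriv ℝ s (G n)) (ENNReal.ofReal p)
      (volume.restrict (Metric.closedBall 0 R)) ≤ C
  tendsto_deriv : ∀ (φ : Eucl N → ℝ), ContDiff ℝ ∞ φ → HasCompactSupport φ →
    ∀ ξ : UnitSphere N,
      Tendsto (fun n => ∫ x, iteratedFDeriv ℝ s (G n) x (fun _ => (ξ : Eucl N)) * φ x) atTop (𝓝 0)

variable {s : ℕ} {p q : ℝ} {G : ℕ → Eucl N → ℝ}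

theorem eLpNorm_restrict_le_of_subset {F : Type*} [NormedAddCommGroup F] (g : Eucl N → F)
    (r : ℝ≥0∞) {A B : Set (Eucl N)} (h : A ⊆ B) :
    eLpNorm g r (volume.restrict A) ≤ eLpNorm g r (volume.restrict B) :=
  eLpNorm_mono_measure g (Measure.restrict_mono h le_rfl)

/-- A weakly null sequence tends to zero as a sequence of distributions. On a line, differences of
order `s` of a regularisation tend to zero; with a large step, all the terms of such a difference
except one are small. -/
theorem WeaklyNull.tendsto_mollify (h : WeaklyNull s p q G) (hN : 0 < N) (hp : 1 < p) (hq : 1 < q)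
    {ρ : Eucl N → ℝ} (hρ : ContDiff ℝ ∞ ρ) (hρc : HasCompactSupport ρ) (x : Eucl N) :
    Tendsto (fun n => mollify ρ (G n) x) atTop (𝓝 0) := by
  let e : UnitSphere N := ⟨EuclideanSpace.single ⟨0, hN⟩ 1, by simp⟩
  have he : ‖(e : Eucl N)‖ = 1 := norm_eq_of_mem_sphere e
  have hH : ∀ n, ContDiff ℝ ∞ (mollify ρ (G n)) := fun n =>
    contDiff_mollify hρ hρc (h.contDiff n).continuous.locallyIntegrable
  let c : ℕ → ℝ → ℝ := fun n t => mollify ρ (G n) (x + t • (e : Eucl N))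
  have hc : ∀ n, ContDiff ℝ ∞ (c n) := fun n =>
    (hH n).comp (contDiff_const.add (contDiff_id.smul contDiff_const))
  have hw : ∀ n, HasWeakDeriv s (G n) (iteratedFDeriv ℝ s (G n)) := fun n =>
    hasWeakDeriv_of_contDiff (h.contDiff n) s
  have hcs : ∀ n t, iteratedDeriv s (c n) t
      = mollify ρ (iteratedFDeriv ℝ s (G n)) (x + t • (e : Eucl N)) (fun _ => (e : Eucl N)) := by
    intro n t
    rw [iteratedDeriv_comp_line (hH n), (hw n).iteratedFDeriv_mollify hρ hρc]
  -- The possible limits along the line are polynomials of degree less than `s`, which are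
  -- annihilated by differences of order `s`.
  have hΔ : ∀ L : ℝ, Tendsto (fun n => (fwdDiff L)^[s] (c n) 0) atTop (𝓝 0) := by
    intro L
    refine tendsto_fwdDiff_iter hc (fun t => ?_) (fun T => ?_) L 0
    · have h1 := h.tendsto_deriv (fun y => ρ (x + t • (e : Eucl N) - y))
        (hρ.comp (contDiff_const.sub contDiff_id))
        (hρc.comp_homeomorph (Homeomorph.subLeft _)) e
      refine h1.congr fun n => ?_
      rw [hcs]
      have h2 := (ContinuousMultilinearMap.apply ℝ (fun _ : Fin s => Eucl N) ℝ
        (fun _ => (e : Eucl N))).integral_comp_comm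
        (integrable_mollify_integrand hρ.continuous hρc (hw n).2.1 (x + t • (e : Eucl N)))
      refine Eq.trans (integral_congr_ae (Eventually.of_forall fun y => ?_)) h2
      simp [mul_comm]
    · obtain ⟨d, C, hd, hC⟩ := exists_enorm_mollify_le
        (F := ContinuousMultilinearMap ℝ (fun _ : Fin s => Eucl N) ℝ) hρ.continuous hρc hp
      obtain ⟨C', hC'⟩ := h.bounded_deriv (‖x‖ + T + d)
      refine ⟨C * C', ?_⟩
      filter_upwards [hC'] with n hn t ht
      have h1 := hC _ (contDiff_iteratedFDeriv (h.contDiff n) s).continuous (x + t • (e : Eucl N))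
      have h2 : ‖mollify ρ (iteratedFDeriv ℝ s (G n)) (x + t • (e : Eucl N))‖ₑ
          ≤ ((C * C' : ℝ≥0) : ℝ≥0∞) := by
        refine h1.trans ?_
        rw [ENNReal.coe_mul]
        gcongr
        refine (eLpNorm_restrict_le_of_subset _ _ ?_).trans hn
        refine Metric.closedBall_subset_closedBall' ?_
        rw [dist_zero_right]
        have : ‖x + t • (e : Eucl N)‖ ≤ ‖x‖ + T :=
          (norm_add_le _ _).trans (by rw [norm_smul, he, mul_one]; gcongr; exact ht)
        linarith
      rw [hcs, ← Real.norm_eq_abs]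
      refine (ContinuousMultilinearMap.le_opNorm _ _).trans ?_
      simp only [he, Finset.prod_const_one, mul_one]
      have h3 := ENNReal.toReal_mono ENNReal.coe_ne_top h2
      simpa using h3
  obtain ⟨d, C, hd, hC⟩ := exists_enorm_mollify_le (F := ℝ) hρ.continuous hρc hq
  rw [Metric.tendsto_nhds]
  intro ε hε
  let ε₀ : ℝ := ε / (2 * (C + 1) * 2 ^ s)
  have hε₀ : 0 < ε₀ := by positivity
  obtain ⟨L₀, hL₀⟩ := h.small d ⟨ε₀, hε₀.le⟩ hε₀
  -- With this step all the points of the difference other than `x` lie far away.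
  let L : ℝ := |L₀| + ‖x‖
  have hsmall : ∀ k ∈ Finset.range s, ∀ᶠ n in atTop, |c n (0 + (k + 1) • L)| ≤ C * ε₀ := by
    intro k _
    have h1 : L₀ ≤ ‖x + ((0 : ℝ) + (k + 1) • L) • (e : Eucl N)‖ := by
      have h2 : ‖((0 : ℝ) + (k + 1) • L) • (e : Eucl N)‖ - ‖x‖
          ≤ ‖x + ((0 : ℝ) + (k + 1) • L) • (e : Eucl N)‖ := by
        rw [add_comm x]
        exact norm_sub_le_norm_add _ _
      have hL : 0 ≤ L := by positivity
      rw [norm_smul, he, mul_one, Real.norm_of_nonneg (by positivity)] at h2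
      refine le_trans ?_ h2
      rw [zero_add, nsmul_eq_mul]
      push_cast
      have h3 : 0 ≤ (k : ℝ) * L := by positivity
      have h4 := le_abs_self L₀
      simp only [L] at h3 ⊢
      linarith
    filter_upwards [hL₀ _ h1] with n hn
    have h2 := (hC (G n) (h.contDiff n).continuous _).trans (mul_le_mul_right hn (C : ℝ≥0∞))
    have h3 := ENNReal.toReal_mono (ENNReal.mul_ne_top ENNReal.coe_ne_top ENNReal.coe_ne_top) h2
    rw [toReal_enorm, ENNReal.toReal_mul] at h3
    exact h3
  filter_upwards [(Filter.eventually_all_finset _).2 hsmall,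
    (Metric.tendsto_nhds.1 (hΔ L)) (ε / 2) (half_pos hε)] with n hn1 hn2
  rw [dist_zero_right, fwdDiff_iter_eq_sum_shift, Finset.sum_range_succ'] at hn2
  have hc0 : c n (0 + 0 • L) = mollify ρ (G n) x := by simp [c]
  rw [hc0] at hn2
  set S := ∑ k ∈ Finset.range s, ((-1 : ℤ) ^ (s - (k + 1)) * (s.choose (k + 1) : ℤ)) •
    c n (0 + (k + 1) • L) with hS
  have hSle : |S| ≤ ε / 2 := by
    calc |S| ≤ ∑ k ∈ Finset.range s, (s.choose (k + 1) : ℝ) * (C * ε₀) := by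
          refine (Finset.abs_sum_le_sum_abs _ _).trans (Finset.sum_le_sum fun k hk => ?_)
          rw [zsmul_eq_mul, abs_mul]
          push_cast
          rw [abs_mul, abs_pow, abs_neg, abs_one, one_pow, one_mul, Nat.abs_cast]
          gcongr
          exact hn1 k hk
      _ ≤ 2 ^ s * (C * ε₀) := by
          rw [← Finset.sum_mul]
          gcongr
          have h1 := Nat.sum_range_choose s
          rw [Finset.sum_range_succ'] at h1
          exact_mod_cast (Nat.le_add_right _ _).trans h1.le
      _ = C / (C + 1) * (ε / 2) := by simp only [ε₀]; field_simp
      _ ≤ 1 * (ε / 2) := by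
          gcongr
          rw [div_le_one (by positivity)]
          linarith
      _ = ε / 2 := one_mul _
  have h0 : ((-1 : ℤ) ^ (s - 0) * (s.choose 0 : ℤ)) • mollify ρ (G n) x
      = (-1 : ℝ) ^ s * mollify ρ (G n) x := by
    rw [zsmul_eq_mul]; simp
  rw [h0, Real.norm_eq_abs] at hn2
  rw [dist_zero_right, Real.norm_eq_abs]
  have h1 : |mollify ρ (G n) x| = |(-1 : ℝ) ^ s * mollify ρ (G n) x| := by
    rw [abs_mul, abs_pow, abs_neg, abs_one, one_pow, one_mul]
  rw [h1]
  have h2 := abs_sub (S + (-1 : ℝ) ^ s * mollify ρ (G n) x) S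
  rw [add_sub_cancel_left] at h2
  linarith

/-- Regularisations of a weakly null sequence tend to zero locally in `L^p`. -/
theorem WeaklyNull.tendsto_eLpNorm_mollify (h : WeaklyNull s p q G) (hN : 0 < N) (hp : 1 < p)
    (hq : 1 < q) {ρ : Eucl N → ℝ} (hρ : ContDiff ℝ ∞ ρ) (hρc : HasCompactSupport ρ) (R : ℝ) :
    Tendsto (fun n => eLpNorm (mollify ρ (G n)) (ENNReal.ofReal p)
      (volume.restrict (Metric.closedBall 0 R))) atTop (𝓝 0) := by
  have hp0 : 0 < p := by linarith
  obtain ⟨d, C, hd, hC⟩ := exists_enorm_mollify_le (F := ℝ) hρ.continuous hρc hq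
  obtain ⟨C', hC'⟩ := h.bounded (R + d)
  have h1 : Tendsto (fun n => ∫⁻ x in Metric.closedBall (0 : Eucl N) R,
      ‖mollify ρ (G n) x‖ₑ ^ p) atTop (𝓝 (∫⁻ _ in Metric.closedBall (0 : Eucl N) R, 0)) := by
    refine tendsto_lintegral_filter_of_dominated_convergence
      (fun _ => ((C : ℝ≥0∞) * C') ^ p) ?_ ?_ ?_ ?_
    · refine Eventually.of_forall fun n => ?_
      exact (contDiff_mollify hρ hρc
        (h.contDiff n).continuous.locallyIntegrable).continuous.measurable.enorm.pow_const p
    · filter_upwards [hC'] with n hn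
      filter_upwards [ae_restrict_mem Metric.isClosed_closedBall.measurableSet] with x hx
      gcongr
      refine (hC (G n) (h.contDiff n).continuous x).trans ?_
      gcongr
      refine (eLpNorm_restrict_le_of_subset _ _ ?_).trans hn
      refine Metric.closedBall_subset_closedBall' ?_
      rw [Metric.mem_closedBall] at hx
      linarith
    · rw [lintegral_const, Measure.restrict_apply_univ]
      exact ENNReal.mul_ne_top (ENNReal.rpow_ne_top_of_nonneg hp0.le
        (ENNReal.mul_ne_top ENNReal.coe_ne_top ENNReal.coe_ne_top)) measure_closedBall_lt_top.ne
    · refine Eventually.of_forall fun x => ?_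
      have h2 := (h.tendsto_mollify hN hp hq hρ hρc x).enorm.ennrpow_const p
      simpa [ENNReal.zero_rpow_of_pos hp0] using h2
  have h2 := h1.ennrpow_const (1 / p)
  simp only [lintegral_zero, ENNReal.zero_rpow_of_pos (one_div_pos.2 hp0)] at h2
  exact h2.congr fun n => (eLpNorm_eq_lintegral_rpow hp0 _).symm

/-- The regularised derivatives are derivatives of the kernel integrated against `G n`, to which
the case `k = 0` applies. -/
theorem WeaklyNull.tendsto_eLpNorm_mollify_iteratedFDeriv (h : WeaklyNull s p q G) (hN : 0 < N)
    (hp : 1 < p) (hq : 1 < q) {ρ : Eucl N → ℝ} (hρ : ContDiff ℝ ∞ ρ) (hρc : HasCompactSupport ρ)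
    (k : ℕ) (R : ℝ) :
    Tendsto (fun n => eLpNorm (mollify ρ (iteratedFDeriv ℝ k (G n))) (ENNReal.ofReal p)
      (volume.restrict (Metric.closedBall 0 R))) atTop (𝓝 0) := by
  obtain ⟨A, C, hC⟩ := exists_finset_norm_le_sum
    (⊤ : Submodule ℝ (ContinuousMultilinearMap ℝ (fun _ : Fin k => Eucl N) ℝ))
    (fun v => (ContinuousMultilinearMap.apply ℝ (fun _ : Fin k => Eucl N) ℝ v).toLinearMap)
    (fun T _ h0 => ContinuousMultilinearMap.ext h0)
  have hp1 : 1 ≤ ENNReal.ofReal p := by simpa using hp.le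
  have hρv : ∀ v, ContDiff ℝ ∞ fun y => iteratedFDeriv ℝ k ρ y v := fun v =>
    contDiff_iteratedFDeriv_apply hρ k v
  have hρvc : ∀ v, HasCompactSupport fun y => iteratedFDeriv ℝ k ρ y v := fun v =>
    hasCompactSupport_iteratedFDeriv_apply hρc k v
  have hcont : ∀ v n, Continuous (mollify (fun y => iteratedFDeriv ℝ k ρ y v) (G n)) := fun v n =>
    (contDiff_mollify (hρv v) (hρvc v) (h.contDiff n).continuous.locallyIntegrable).continuous
  have hle : ∀ n, eLpNorm (mollify ρ (iteratedFDeriv ℝ k (G n))) (ENNReal.ofReal p)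
      (volume.restrict (Metric.closedBall 0 R)) ≤ C * ∑ v ∈ A,
        eLpNorm (mollify (fun y => iteratedFDeriv ℝ k ρ y v) (G n)) (ENNReal.ofReal p)
          (volume.restrict (Metric.closedBall 0 R)) := by
    intro n
    have h1 : ∀ x, ‖mollify ρ (iteratedFDeriv ℝ k (G n)) x‖
        ≤ C * ‖∑ v ∈ A, ‖mollify (fun y => iteratedFDeriv ℝ k ρ y v) (G n) x‖‖ := by
      intro x
      rw [Real.norm_of_nonneg (Finset.sum_nonneg fun _ _ => norm_nonneg _)]
      refine (hC _ Submodule.mem_top).trans_eq ?_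
      congr 1
      refine Finset.sum_congr rfl fun v _ => ?_
      rw [← (hasWeakDeriv_of_contDiff (h.contDiff n) k).iteratedFDeriv_mollify hρ hρc]
      change ‖iteratedFDeriv ℝ k (mollify ρ (G n)) x v‖ = _
      rw [iteratedFDeriv_mollify hρ hρc (h.contDiff n).continuous.locallyIntegrable]
    refine (eLpNorm_le_nnreal_smul_eLpNorm_of_ae_le_mul (c := C)
      (Eventually.of_forall fun x => h1 x) _).trans ?_
    rw [ENNReal.smul_def, smul_eq_mul]
    gcongr
    have h2 := eLpNorm_sum_le (s := A) (p := ENNReal.ofReal p)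
      (μ := volume.restrict (Metric.closedBall (0 : Eucl N) R))
      (f := fun v x => ‖mollify (fun y => iteratedFDeriv ℝ k ρ y v) (G n) x‖)
      (fun v _ => (hcont v n).norm.aestronglyMeasurable) hp1
    simp only [eLpNorm_norm] at h2
    refine le_trans (le_of_eq ?_) h2
    congr 1
    funext x
    simp
  have hz : Tendsto (fun n => (C : ℝ≥0∞) * ∑ v ∈ A,
        eLpNorm (mollify (fun y => iteratedFDeriv ℝ k ρ y v) (G n)) (ENNReal.ofReal p)
          (volume.restrict (Metric.closedBall 0 R))) atTop (𝓝 (C * ∑ _v ∈ A, 0)) :=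
    ENNReal.Tendsto.const_mul (tendsto_finsetSum _ fun v _ =>
      h.tendsto_eLpNorm_mollify hN hp hq (hρv v) (hρvc v) R) (Or.inr ENNReal.coe_ne_top)
  rw [Finset.sum_const_zero, mul_zero] at hz
  exact tendsto_of_tendsto_of_tendsto_of_le_of_le tendsto_const_nhds hz (fun _ => zero_le) hle

/-- Compactness by regularisation: a bound for the derivatives of order `k + 1` makes those of
order `k` close to their regularisations, which tend to zero. -/
theorem WeaklyNull.tendsto_of_bounded_succ (h : WeaklyNull s p q G) (hN : 0 < N) (hp : 1 < p)
    (hq : 1 < q) (k : ℕ)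
    (hk : ∀ R : ℝ, ∃ C : ℝ≥0, ∀ᶠ n in atTop, eLpNorm (iteratedFDeriv ℝ (k + 1) (G n))
      (ENNReal.ofReal p) (volume.restrict (Metric.closedBall 0 R)) ≤ C) (R : ℝ) :
    Tendsto (fun n => eLpNorm (iteratedFDeriv ℝ k (G n)) (ENNReal.ofReal p)
      (volume.restrict (Metric.closedBall 0 R))) atTop (𝓝 0) := by
  have hp1 : 1 ≤ ENNReal.ofReal p := by simpa using hp.le
  rw [ENNReal.tendsto_nhds_zero]
  intro ε hε
  obtain ⟨C, hC⟩ := hk (R + 1)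
  obtain ⟨η, hη0, hη⟩ : ∃ η : ℝ≥0, 0 < η ∧ (η : ℝ≥0∞) * C ≤ ε / 2 := by
    rcases eq_or_ne ε ⊤ with rfl | hε'
    · exact ⟨1, one_pos, by simp [ENNReal.top_div_of_ne_top]⟩
    · lift ε to ℝ≥0 using hε'
      have hε0 : 0 < ε := by exact_mod_cast hε
      refine ⟨ε / 2 / (C + 1), by positivity, ?_⟩
      have : ε / 2 / (C + 1) * C ≤ ε / 2 := by
        rw [div_mul_eq_mul_div]
        refine div_le_of_le_mul₀ (by positivity) (by positivity) ?_
        gcongr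
        simp
      have h2 : ((ε / 2 : ℝ≥0) : ℝ≥0∞) = ε / 2 := by
        rw [ENNReal.coe_div two_ne_zero]; simp
      rw [← h2]
      exact_mod_cast this
  have hδ : 0 < min (η : ℝ) 1 := lt_min hη0 one_pos
  let φ : ContDiffBump (0 : Eucl N) := ⟨min (η : ℝ) 1 / 2, min (η : ℝ) 1, half_pos hδ,
    half_lt_self hδ⟩
  have h1 := h.tendsto_eLpNorm_mollify_iteratedFDeriv hN hp hq (φ.contDiff_normed (μ := volume))
    φ.hasCompactSupport_normed k R
  filter_upwards [hC, (ENNReal.tendsto_nhds_zero.1 h1) (ε / 2) (ENNReal.half_pos hε.ne')]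
    with n hn1 hn2
  have hv : ContDiff ℝ ∞ (iteratedFDeriv ℝ k (G n)) := contDiff_iteratedFDeriv (h.contDiff n) k
  have hm : Continuous (mollify (φ.normed volume) (iteratedFDeriv ℝ k (G n))) :=
    (contDiff_mollify φ.contDiff_normed φ.hasCompactSupport_normed
      hv.continuous.locallyIntegrable).continuous
  have h2 := eLpNorm_mollify_sub_le hp (hv.of_le (natCast_le_top 1)) φ R
  have h3 : eLpNorm (fun x => mollify (φ.normed volume) (iteratedFDeriv ℝ k (G n)) x
      - iteratedFDeriv ℝ k (G n) x) (ENNReal.ofReal p)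
        (volume.restrict (Metric.closedBall 0 R)) ≤ ε / 2 := by
    refine h2.trans (le_trans ?_ hη)
    gcongr
    · refine ENNReal.ofReal_le_of_le_toReal ?_
      exact min_le_left _ _
    · refine le_trans ?_ hn1
      refine le_trans (le_of_eq (eLpNorm_congr_norm_ae
        (Eventually.of_forall fun x => norm_fderiv_iteratedFDeriv)))
        (eLpNorm_restrict_le_of_subset _ _ (Metric.closedBall_subset_closedBall ?_))
      gcongr
      exact min_le_right _ _
  have h4 : iteratedFDeriv ℝ k (G n) = mollify (φ.normed volume) (iteratedFDeriv ℝ k (G n))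
      - fun x => mollify (φ.normed volume) (iteratedFDeriv ℝ k (G n)) x
        - iteratedFDeriv ℝ k (G n) x := by
    funext x
    simp
  rw [h4]
  refine (eLpNorm_sub_le hm.aestronglyMeasurable
    (hm.sub hv.continuous).aestronglyMeasurable hp1).trans ?_
  refine (add_le_add hn2 h3).trans_eq (ENNReal.add_halves ε)

/-- Rellich's theorem for weakly null sequences: all derivatives of order less than `s` tend to
zero locally in `L^p`. -/
theorem WeaklyNull.tendsto_eLpNorm_iteratedFDeriv (h : WeaklyNull s p q G) (hN : 0 < N)
    (hp : 1 < p) (hq : 1 < q) {k : ℕ} (hk : k < s) (R : ℝ) :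
    Tendsto (fun n => eLpNorm (iteratedFDeriv ℝ k (G n)) (ENNReal.ofReal p)
      (volume.restrict (Metric.closedBall 0 R))) atTop (𝓝 0) := by
  have key : ∀ k ≤ s, ∀ R : ℝ, ∃ C : ℝ≥0, ∀ᶠ n in atTop, eLpNorm (iteratedFDeriv ℝ k (G n))
      (ENNReal.ofReal p) (volume.restrict (Metric.closedBall 0 R)) ≤ C := by
    intro k hk
    refine Nat.decreasingInduction (motive := fun k _ => ∀ R : ℝ, ∃ C : ℝ≥0, ∀ᶠ n in atTop,
      eLpNorm (iteratedFDeriv ℝ k (G n)) (ENNReal.ofReal p)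
        (volume.restrict (Metric.closedBall 0 R)) ≤ C) ?_ h.bounded_deriv hk
    intro k _ ih R
    exact ⟨1, (h.tendsto_of_bounded_succ hN hp hq k ih R).eventually_le_const (by simp)⟩
  exact h.tendsto_of_bounded_succ hN hp hq k (key (k + 1) hk) R

end Compactness

/-! ### Weak-`*` convergence and localised norms -/

section WeakStar
variable {N : ℕ}

theorem WeakStarTendsto.tendsto_lintegral {m : ℕ → Measure (Eucl N)} {m₀ : Measure (Eucl N)}
    (h : WeakStarTendsto m m₀) (hm : ∀ n, IsFiniteMeasure (m n)) (hm₀ : IsFiniteMeasure m₀)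
    {φ : Eucl N → ℝ} (hφ : Continuous φ) (hφc : HasCompactSupport φ) (h0 : ∀ x, 0 ≤ φ x) :
    Tendsto (fun n => ∫⁻ x, ENNReal.ofReal (φ x) ∂(m n)) atTop
      (𝓝 (∫⁻ x, ENNReal.ofReal (φ x) ∂m₀)) := by
  let ψ : C₀(Eucl N, ℝ) := ⟨⟨φ, hφ⟩, hφc.is_zero_at_infty⟩
  have h1 := h ψ
  have e : ∀ m : Measure (Eucl N), IsFiniteMeasure m →
      ENNReal.ofReal (∫ x, ψ x ∂m) = ∫⁻ x, ENNReal.ofReal (φ x) ∂m := fun m hm =>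
    ofReal_integral_eq_lintegral_ofReal (hφ.integrable_of_hasCompactSupport hφc)
      (Eventually.of_forall h0)
  rw [← e m₀ hm₀]
  exact (ENNReal.tendsto_ofReal h1).congr fun n => e _ (hm n)

theorem isFiniteMeasure_powMeasure {u : Eucl N → ℝ} {r : ℝ} (hr : 0 < r)
    (hu : MemLp u (ENNReal.ofReal r)) : IsFiniteMeasure (powMeasure u r) := by
  refine isFiniteMeasure_withDensity ?_
  rw [← eLpNorm_rpow_eq_lintegral hr]
  exact ENNReal.rpow_ne_top_of_nonneg hr.le hu.2.ne

theorem lintegral_powMeasure {u : Eucl N → ℝ} {r : ℝ} (hr : 0 < r)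
    (hu : AEStronglyMeasurable u) (φ : Eucl N → ℝ) :
    ∫⁻ x, ‖φ x‖ₑ ^ r ∂(powMeasure u r)
      = eLpNorm (fun x => φ x * u x) (ENNReal.ofReal r) volume ^ r := by
  rw [eLpNorm_rpow_eq_lintegral hr, powMeasure,
    lintegral_withDensity_eq_lintegral_mul_non_measurable₀ _ (hu.enorm.pow_const r)
      (Eventually.of_forall fun x => ENNReal.rpow_lt_top_of_nonneg hr.le enorm_ne_top)]
  refine lintegral_congr fun x => ?_
  rw [Pi.mul_apply, enorm_mul, ENNReal.mul_rpow_of_nonneg _ _ hr.le, mul_comm]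

theorem eLpNorm_mul_eq_lintegral_powMeasure {u : Eucl N → ℝ} {r : ℝ} (hr : 0 < r)
    (hu : AEStronglyMeasurable u) (φ : Eucl N → ℝ) :
    eLpNorm (fun x => φ x * u x) (ENNReal.ofReal r) volume
      = (∫⁻ x, ‖φ x‖ₑ ^ r ∂(powMeasure u r)) ^ (1 / r) := by
  rw [lintegral_powMeasure hr hu, ← ENNReal.rpow_mul, mul_one_div_cancel hr.ne', ENNReal.rpow_one]

/-- Weak-`*` convergence of `|u_n|^r dx`, expressed by localised `L^r` norms. -/
theorem WeakStarTendsto.tendsto_eLpNorm {u : ℕ → Eucl N → ℝ} {r : ℝ} (hr : 0 < r)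
    (hu : ∀ n, MemLp (u n) (ENNReal.ofReal r)) {m : Measure (Eucl N)} (hm : IsFiniteMeasure m)
    (h : WeakStarTendsto (fun n => powMeasure (u n) r) m)
    {φ : Eucl N → ℝ} (hφ : Continuous φ) (hφc : HasCompactSupport φ) :
    Tendsto (fun n => eLpNorm (fun x => φ x * u n x) (ENNReal.ofReal r) volume) atTop
      (𝓝 ((∫⁻ x, ‖φ x‖ₑ ^ r ∂m) ^ (1 / r))) := by
  have h1 := h.tendsto_lintegral (fun n => isFiniteMeasure_powMeasure hr (hu n)) hm
    (φ := fun x => |φ x| ^ r) (hφ.abs.rpow_const fun _ => Or.inr hr.le)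
    (hφc.comp_left (g := fun y => |y| ^ r) (by simp [Real.zero_rpow hr.ne']))
    (fun x => by positivity)
  have e : ∀ x, ENNReal.ofReal (|φ x| ^ r) = ‖φ x‖ₑ ^ r := by
    intro x
    rw [← ENNReal.ofReal_rpow_of_nonneg (abs_nonneg _) hr.le, ← Real.norm_eq_abs, ofReal_norm]
  simp only [e] at h1
  refine (h1.ennrpow_const (1 / r)).congr fun n => ?_
  rw [eLpNorm_mul_eq_lintegral_powMeasure hr (hu n).1]

/-- The localised `L^r` norm is bounded by the mass of a set carrying the cut-off function. -/
theorem lintegral_enorm_rpow_le_measure {m : Measure (Eucl N)} {φ : Eucl N → ℝ} {r : ℝ}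
    (hr : 0 < r) {A : Set (Eucl N)} (hA : MeasurableSet A) (h1 : ∀ x, ‖φ x‖ ≤ 1)
    (h0 : ∀ x ∉ A, φ x = 0) : ∫⁻ x, ‖φ x‖ₑ ^ r ∂m ≤ m A := by
  rw [← lintegral_indicator_one hA]
  refine lintegral_mono fun x => ?_
  by_cases hx : x ∈ A
  · rw [Set.indicator_of_mem hx, Pi.one_apply]
    refine ENNReal.rpow_le_one ?_ hr.le
    rw [← ofReal_norm]
    simpa using h1 x
  · simp [h0 x hx, ENNReal.zero_rpow_of_pos hr]

theorem measure_le_lintegral_enorm_rpow {m : Measure (Eucl N)} {φ : Eucl N → ℝ} {r : ℝ}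
    {A : Set (Eucl N)} (hA : MeasurableSet A) (h1 : ∀ x ∈ A, φ x = 1) :
    m A ≤ ∫⁻ x, ‖φ x‖ₑ ^ r ∂m := by
  rw [← lintegral_indicator_one hA]
  refine lintegral_mono fun x => ?_
  by_cases hx : x ∈ A
  · simp [Set.indicator_of_mem hx, h1 x hx]
  · simp [hx]

end WeakStar

section Directional
variable {N s : ℕ} {p : ℝ}

theorem norm_apply_unit_le (ξ : UnitSphere N)
    (T : ContinuousMultilinearMap ℝ (fun _ : Fin s => Eucl N) ℝ) :
    ‖T (fun _ => (ξ : Eucl N))‖ ≤ ‖T‖ := by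
  refine (T.le_opNorm _).trans_eq ?_
  simp [norm_eq_of_mem_sphere]

theorem MemSobolev.memLp_dirDeriv {f : Eucl N → ℝ} (hf : MemSobolev s p f) (ξ : UnitSphere N) :
    MemLp (dirDeriv s ξ f) (ENNReal.ofReal p) := by
  refine hf.2.2.mono ?_ (Eventually.of_forall fun x => norm_apply_unit_le ξ _)
  exact (ContinuousMultilinearMap.apply ℝ (fun _ : Fin s => Eucl N) ℝ
    (fun _ => (ξ : Eucl N))).continuous.comp_aestronglyMeasurable hf.2.2.1

/-- The derivative of order `s` of a smooth function is controlled in `L^p` by finitely many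
directional derivatives. -/
theorem exists_finset_eLpNorm_iteratedFDeriv_le (hs : s ≠ 0) (hp : 1 < p) :
    ∃ (A : Finset (UnitSphere N)) (C : ℝ≥0), ∀ (m : Measure (Eucl N)) (g : Eucl N → ℝ),
      ContDiff ℝ ∞ g → eLpNorm (iteratedFDeriv ℝ s g) (ENNReal.ofReal p) m
        ≤ C * ∑ ξ ∈ A, eLpNorm (fun x => iteratedFDeriv ℝ s g x (fun _ => (ξ : Eucl N)))
          (ENNReal.ofReal p) m := by
  obtain ⟨A, C, hC⟩ := exists_finset_norm_le_sum_diagonal (E := Eucl N) hs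
  refine ⟨A, C, fun m g hg => ?_⟩
  have h1 : ∀ x, ‖iteratedFDeriv ℝ s g x‖
      ≤ C * ‖∑ ξ ∈ A, ‖iteratedFDeriv ℝ s g x (fun _ => (ξ : Eucl N))‖‖ := by
    intro x
    rw [Real.norm_of_nonneg (Finset.sum_nonneg fun _ _ => norm_nonneg _)]
    exact hC _ fun v σ => iteratedFDeriv_comp_perm hg x v σ
  refine (eLpNorm_le_nnreal_smul_eLpNorm_of_ae_le_mul (Eventually.of_forall h1) _).trans ?_
  rw [ENNReal.smul_def, smul_eq_mul]
  gcongr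
  have h2 := eLpNorm_sum_le (s := A) (p := ENNReal.ofReal p) (μ := m)
    (f := fun (ξ : UnitSphere N) x => ‖iteratedFDeriv ℝ s g x (fun _ => (ξ : Eucl N))‖)
    (fun ξ _ => (contDiff_iteratedFDeriv_apply hg s _).continuous.norm.aestronglyMeasurable)
    (by simpa using hp.le)
  simp only [eLpNorm_norm] at h2
  refine le_trans (le_of_eq ?_) h2
  congr 1
  funext x
  simp

end Directional

/-! ### The setting of the theorem -/

section Setting

/-- The hypotheses of the concentration-compactness principle: `f n` converges weakly to `f₀` in
the homogeneous Sobolev space, and the measures `|f_n|^q dx`, `|∂^s_ξ f_n|^p dx` converge weakly-`*`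
to `ν` and to `|∂^s_ξ f₀|^p dx + μ ξ`, for `s ≥ 1`, `p > 1` and `s p < N`. -/
structure Concentrates {N : ℕ} (s : ℕ) (p : ℝ) (f : ℕ → Eucl N → ℝ) (f₀ : Eucl N → ℝ)
    (ν : Measure (Eucl N)) (μ : UnitSphere N → Measure (Eucl N)) : Prop where
  one_le : 1 ≤ s
  one_lt : 1 < p
  lt_dim : (s : ℝ) * p < N
  mem : ∀ n, MemSobolev s p (f n)
  mem₀ : MemSobolev s p f₀
  weak : WeakTendsto s p f f₀
  finite : IsFiniteMeasure ν
  tendsto : WeakStarTendsto (fun n => powMeasure (f n) (critExp N s p)) ν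
  finite_deriv : ∀ ξ, IsFiniteMeasure (μ ξ)
  tendsto_deriv : ∀ ξ, WeakStarTendsto (fun n => powMeasure (dirDeriv s ξ (f n)) p)
      (powMeasure (dirDeriv s ξ f₀) p + μ ξ)

variable {N s : ℕ} {p : ℝ} {f : ℕ → Eucl N → ℝ} {f₀ : Eucl N → ℝ}
  {ν : Measure (Eucl N)} {μ : UnitSphere N → Measure (Eucl N)}

namespace Concentrates

theorem dim_pos (h : Concentrates s p f f₀ ν μ) : 0 < N := by
  have h1 : (1 : ℝ) ≤ s := by exact_mod_cast h.one_le
  have h2 := h.one_lt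
  have h3 := h.lt_dim
  have : (0 : ℝ) < N := by nlinarith
  exact_mod_cast this

theorem lt_critExp (h : Concentrates s p f f₀ ν μ) : p < critExp N s p := by
  have h1 : (1 : ℝ) ≤ s := by exact_mod_cast h.one_le
  have h2 := h.one_lt
  have h3 := h.lt_dim
  rw [critExp, lt_div_iff₀ (by linarith)]
  nlinarith [mul_pos (by linarith : (0 : ℝ) < s) (mul_pos (by linarith : (0 : ℝ) < p)
    (by linarith : (0 : ℝ) < p))]

theorem finite_limit (h : Concentrates s p f f₀ ν μ) (ξ : UnitSphere N) :
    IsFiniteMeasure (powMeasure (dirDeriv s ξ f₀) p + μ ξ) := by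
  have := h.finite_deriv ξ
  have := isFiniteMeasure_powMeasure (by linarith [h.one_lt]) (h.mem₀.memLp_dirDeriv ξ)
  infer_instance

theorem tendsto_eLpNorm (h : Concentrates s p f f₀ ν μ) {φ : Eucl N → ℝ} (hφ : Continuous φ)
    (hφc : HasCompactSupport φ) :
    Tendsto (fun n => eLpNorm (fun x => φ x * f n x) (ENNReal.ofReal (critExp N s p)) volume) atTop
      (𝓝 ((∫⁻ x, ‖φ x‖ₑ ^ critExp N s p ∂ν) ^ (1 / critExp N s p))) :=
  h.tendsto.tendsto_eLpNorm (by linarith [h.one_lt, h.lt_critExp]) (fun n => (h.mem n).1) h.finite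
    hφ hφc

theorem tendsto_eLpNorm_dirDeriv (h : Concentrates s p f f₀ ν μ) {φ : Eucl N → ℝ}
    (hφ : Continuous φ) (hφc : HasCompactSupport φ) (ξ : UnitSphere N) :
    Tendsto (fun n => eLpNorm (fun x => φ x * dirDeriv s ξ (f n) x) (ENNReal.ofReal p) volume) atTop
      (𝓝 ((∫⁻ x, ‖φ x‖ₑ ^ p ∂(powMeasure (dirDeriv s ξ f₀) p + μ ξ)) ^ (1 / p))) :=
  (h.tendsto_deriv ξ).tendsto_eLpNorm (by linarith [h.one_lt])
    (fun n => (h.mem n).memLp_dirDeriv ξ) (h.finite_limit ξ) hφ hφc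

end Concentrates
end Setting

section Setting
variable {N s : ℕ} {p : ℝ}

theorem exists_cutoff (y : Eucl N) (R : ℝ) : ∃ χ : Eucl N → ℝ, Continuous χ ∧
    HasCompactSupport χ ∧ (∀ x, ‖χ x‖ ≤ 1) ∧ (∀ x ∈ Metric.closedBall y R, χ x = 1) ∧
      ∀ x ∉ Metric.closedBall y (|R| + 2), χ x = 0 := by
  let χ : ContDiffBump y := ⟨|R| + 1, |R| + 2, by positivity, by linarith⟩
  refine ⟨χ, χ.continuous, χ.hasCompactSupport, fun x => ?_, fun x hx => ?_, fun x hx => ?_⟩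
  · rw [Real.norm_of_nonneg χ.nonneg]; exact χ.le_one
  · refine χ.one_of_mem_closedBall (Metric.closedBall_subset_closedBall ?_ hx)
    have := le_abs_self R
    change R ≤ |R| + 1
    linarith
  · refine χ.zero_of_le_dist ?_
    rw [Metric.mem_closedBall, not_le] at hx
    exact hx.le

theorem eLpNorm_le_of_eq_one {u χ : Eucl N → ℝ} {A : Set (Eucl N)} (hA : MeasurableSet A)
    (h1 : ∀ x ∈ A, χ x = 1) (r : ℝ≥0∞) :
    eLpNorm u r (volume.restrict A) ≤ eLpNorm (fun x => χ x * u x) r volume := by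
  refine le_trans (le_of_eq ?_) (eLpNorm_mono_measure _ (Measure.restrict_le_self (s := A)))
  refine eLpNorm_congr_ae ?_
  filter_upwards [ae_restrict_mem hA] with x hx
  rw [h1 x hx, one_mul]

theorem eLpNorm_restrict_eq_powMeasure {u : Eucl N → ℝ} {r : ℝ} (hr : 0 < r) {A : Set (Eucl N)}
    (hA : MeasurableSet A) :
    eLpNorm u (ENNReal.ofReal r) (volume.restrict A) = powMeasure u r A ^ (1 / r) := by
  rw [eLpNorm_eq_lintegral_rpow hr, powMeasure, withDensity_apply _ hA]

/-- Local bounds, uniform in `n`, for functions close in `L^r` to `u_n - u₀`. -/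
theorem eventually_eLpNorm_le {r : ℝ} (hr : 1 < r) {u : ℕ → Eucl N → ℝ} {u₀ : Eucl N → ℝ}
    (hu : ∀ n, MemLp (u n) (ENNReal.ofReal r)) (hu₀ : MemLp u₀ (ENNReal.ofReal r))
    {m : Measure (Eucl N)} (hm : IsFiniteMeasure m)
    (h : WeakStarTendsto (fun n => powMeasure (u n) r) m) {G : ℕ → Eucl N → ℝ}
    (hGc : ∀ n, Continuous (G n))
    (hG : Tendsto (fun n => eLpNorm (fun x => G n x - (u n x - u₀ x)) (ENNReal.ofReal r) volume)
      atTop (𝓝 0)) (y : Eucl N) (R : ℝ) {c : ℝ≥0∞}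
    (hc : m (Metric.closedBall y (|R| + 2)) ^ (1 / r)
      + powMeasure u₀ r (Metric.closedBall y (|R| + 2)) ^ (1 / r) < c) :
    ∀ᶠ n in atTop,
      eLpNorm (G n) (ENNReal.ofReal r) (volume.restrict (Metric.closedBall y R)) ≤ c := by
  have hr0 : 0 < r := by linarith
  have hr1 : 1 ≤ ENNReal.ofReal r := by simpa using hr.le
  have hB : ∀ R, MeasurableSet (Metric.closedBall y R) := fun R =>
    Metric.isClosed_closedBall.measurableSet
  obtain ⟨χ, hχ, hχc, hχ1, hχB, hχ0⟩ := exists_cutoff y R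
  have h1 := h.tendsto_eLpNorm hr0 hu hm hχ hχc
  have h2 := (hG.add h1).add_const (eLpNorm u₀ (ENNReal.ofReal r)
    (volume.restrict (Metric.closedBall y R)))
  have h3 : 0 + (∫⁻ x, ‖χ x‖ₑ ^ r ∂m) ^ (1 / r) + eLpNorm u₀ (ENNReal.ofReal r)
      (volume.restrict (Metric.closedBall y R)) < c := by
    refine lt_of_le_of_lt ?_ hc
    rw [zero_add, eLpNorm_restrict_eq_powMeasure hr0 (hB R)]
    have hR : R ≤ |R| + 2 := by linarith [le_abs_self R]
    have hr' : 0 ≤ 1 / r := by positivity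
    exact add_le_add
      (ENNReal.rpow_le_rpow (lintegral_enorm_rpow_le_measure hr0 (hB _) hχ1 hχ0) hr')
      (ENNReal.rpow_le_rpow (measure_mono (Metric.closedBall_subset_closedBall hR)) hr')
  filter_upwards [h2.eventually_lt_const h3] with n hn
  refine le_trans ?_ hn.le
  have hms := (hu n).1.restrict (s := Metric.closedBall y R)
  have hms₀ := hu₀.1.restrict (s := Metric.closedBall y R)
  have e : G n = (fun x => G n x - (u n x - u₀ x)) + (u n - u₀) := by funext x; simp
  calc eLpNorm (G n) (ENNReal.ofReal r) (volume.restrict (Metric.closedBall y R))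
      ≤ eLpNorm (fun x => G n x - (u n x - u₀ x)) (ENNReal.ofReal r)
          (volume.restrict (Metric.closedBall y R))
        + (eLpNorm (u n) (ENNReal.ofReal r) (volume.restrict (Metric.closedBall y R))
          + eLpNorm u₀ (ENNReal.ofReal r) (volume.restrict (Metric.closedBall y R))) := by
        conv_lhs => rw [e]
        refine (eLpNorm_add_le ((hGc n).aestronglyMeasurable.sub (hms.sub hms₀))
          (hms.sub hms₀) hr1).trans ?_
        exact add_le_add le_rfl (eLpNorm_sub_le hms hms₀ hr1)
    _ ≤ _ := by
        rw [← add_assoc]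
        exact add_le_add (add_le_add (eLpNorm_mono_measure _ Measure.restrict_le_self)
          (eLpNorm_le_of_eq_one (hB R) hχB _)) le_rfl

/-- Balls of fixed radius far away have small mass. -/
theorem exists_forall_measure_closedBall_lt {m : Measure (Eucl N)} (hm : IsFiniteMeasure m)
    (d : ℝ) {ε : ℝ≥0∞} (hε : 0 < ε) :
    ∃ L : ℝ, ∀ y : Eucl N, L ≤ ‖y‖ → m (Metric.closedBall y d) < ε := by
  have h1 : Tendsto (fun k : ℕ => m (Metric.ball (0 : Eucl N) k)ᶜ) atTop
      (𝓝 (m (⋂ k : ℕ, (Metric.ball (0 : Eucl N) k)ᶜ))) := by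
    refine tendsto_measure_iInter_atTop
      (fun k => Metric.isOpen_ball.measurableSet.compl.nullMeasurableSet) ?_
      ⟨0, measure_ne_top m _⟩
    intro i j hij
    exact Set.compl_subset_compl.2 (Metric.ball_subset_ball (by exact_mod_cast hij))
  have h2 : (⋂ k : ℕ, (Metric.ball (0 : Eucl N) k)ᶜ) = ∅ := by
    rw [← Set.compl_iUnion, Metric.iUnion_ball_nat, Set.compl_univ]
  rw [h2, measure_empty] at h1
  obtain ⟨k, hk⟩ := (h1.eventually_lt_const hε).exists
  refine ⟨k + d, fun y hy => lt_of_le_of_lt (measure_mono fun x hx => ?_) hk⟩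
  rw [Metric.mem_closedBall, dist_eq_norm] at hx
  rw [Set.mem_compl_iff, mem_ball_zero_iff, not_lt]
  have := norm_sub_norm_le y x
  rw [norm_sub_rev] at this
  linarith

theorem enorm_integral_mul_le (hp : 1 < p) {u φ : Eucl N → ℝ} (hu : AEStronglyMeasurable u)
    (hφ : AEStronglyMeasurable φ) :
    ‖∫ x, u x * φ x‖ₑ ≤ eLpNorm u (ENNReal.ofReal p) volume
      * eLpNorm φ (ENNReal.ofReal (Real.conjExponent p)) volume := by
  have hc := Real.HolderConjugate.conjExponent hp
  refine (enorm_integral_le_lintegral_enorm _).trans ?_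
  simp only [enorm_mul]
  rw [eLpNorm_eq_lintegral_rpow hc.pos, eLpNorm_eq_lintegral_rpow hc.symm.pos]
  exact ENNReal.lintegral_mul_le_Lp_mul_Lq volume hc hu.enorm hφ.enorm

variable {f : ℕ → Eucl N → ℝ} {f₀ : Eucl N → ℝ}
  {ν : Measure (Eucl N)} {μ : UnitSphere N → Measure (Eucl N)}

namespace Concentrates

/-- Smooth functions close to `f_n - f₀` in the Sobolev space form a weakly null sequence. -/
theorem exists_weaklyNull (h : Concentrates s p f f₀ ν μ) : ∃ G : ℕ → Eucl N → ℝ,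
    WeaklyNull s p (critExp N s p) G ∧
    Tendsto (fun n => eLpNorm (fun x => G n x - (f n x - f₀ x))
      (ENNReal.ofReal (critExp N s p)) volume) atTop (𝓝 0) ∧
    ∀ ξ : UnitSphere N, Tendsto (fun n => eLpNorm
      (fun x => iteratedFDeriv ℝ s (G n) x (fun _ => (ξ : Eucl N))
        - (dirDeriv s ξ (f n) x - dirDeriv s ξ f₀ x)) (ENNReal.ofReal p) volume)
      atTop (𝓝 0) := by
  have hp := h.one_lt
  have hq : 1 < critExp N s p := hp.trans h.lt_critExp
  have hp1 : 1 ≤ ENNReal.ofReal p := by simpa using hp.le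
  have hq1 : 1 ≤ ENNReal.ofReal (critExp N s p) := by simpa using hq.le
  have hε : ∀ n : ℕ, (0 : ℝ≥0∞) < ((1 / ((n : ℝ≥0) + 1) : ℝ≥0) : ℝ≥0∞) := fun n => by
    have : (0 : ℝ≥0) < 1 / ((n : ℝ≥0) + 1) := by positivity
    exact_mod_cast this
  choose A hA hA1 hA2 using fun n => (h.mem n).exists_contDiff_approx hp hq (hε n)
  choose B hB hB1 hB2 using fun n => h.mem₀.exists_contDiff_approx hp hq (hε n)
  have hlim : Tendsto (fun n : ℕ => ((1 / ((n : ℝ≥0) + 1) : ℝ≥0) : ℝ≥0∞)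
      + ((1 / ((n : ℝ≥0) + 1) : ℝ≥0) : ℝ≥0∞)) atTop (𝓝 0) := by
    have h1 : Tendsto (fun n : ℕ => 1 / ((n : ℝ≥0) + 1)) atTop (𝓝 0) :=
      tendsto_one_div_add_atTop_nhds_zero_nat
    have h2 : Tendsto (fun n : ℕ => ((1 / ((n : ℝ≥0) + 1) : ℝ≥0) : ℝ≥0∞)) atTop (𝓝 0) := by
      rw [← ENNReal.coe_zero]
      exact ENNReal.tendsto_coe.2 h1
    simpa using h2.add h2
  let G : ℕ → Eucl N → ℝ := fun n => A n - B n
  have hG : ∀ n, ContDiff ℝ ∞ (G n) := fun n => (hA n).sub (hB n)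
  have hGq : Tendsto (fun n => eLpNorm (fun x => G n x - (f n x - f₀ x))
      (ENNReal.ofReal (critExp N s p)) volume) atTop (𝓝 0) := by
    refine tendsto_of_tendsto_of_tendsto_of_le_of_le tendsto_const_nhds hlim
      (fun _ => zero_le) fun n => ?_
    have e : (fun x => G n x - (f n x - f₀ x))
        = (fun x => A n x - f n x) - fun x => B n x - f₀ x := by
      funext x; simp only [G, Pi.sub_apply]; ring
    rw [e]
    exact (eLpNorm_sub_le ((hA n).continuous.aestronglyMeasurable.sub (h.mem n).1.1)
      ((hB n).continuous.aestronglyMeasurable.sub h.mem₀.1.1) hq1).trans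
      (add_le_add (hA1 n) (hB1 n))
  have hGs : ∀ n x, iteratedFDeriv ℝ s (G n) x
      = iteratedFDeriv ℝ s (A n) x - iteratedFDeriv ℝ s (B n) x := fun n x =>
    iteratedFDeriv_sub_apply ((hA n).of_le (natCast_le_top s)).contDiffAt
      ((hB n).of_le (natCast_le_top s)).contDiffAt
  have hGp : ∀ ξ : UnitSphere N, Tendsto (fun n => eLpNorm
      (fun x => iteratedFDeriv ℝ s (G n) x (fun _ => (ξ : Eucl N))
        - (dirDeriv s ξ (f n) x - dirDeriv s ξ f₀ x)) (ENNReal.ofReal p) volume)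
      atTop (𝓝 0) := by
    intro ξ
    refine tendsto_of_tendsto_of_tendsto_of_le_of_le tendsto_const_nhds hlim
      (fun _ => zero_le) fun n => ?_
    have h1 : ∀ x, ‖iteratedFDeriv ℝ s (G n) x (fun _ => (ξ : Eucl N))
        - (dirDeriv s ξ (f n) x - dirDeriv s ξ f₀ x)‖
        ≤ ‖((fun x => iteratedFDeriv ℝ s (A n) x - weakDeriv s (f n) x)
          - fun x => iteratedFDeriv ℝ s (B n) x - weakDeriv s f₀ x) x‖ := by
      intro x
      refine le_trans (le_of_eq ?_) (norm_apply_unit_le ξ _)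
      rw [hGs]
      simp only [dirDeriv, Pi.sub_apply, sub_apply]
      congr 1
      ring
    refine (eLpNorm_mono h1).trans ((eLpNorm_sub_le ?_ ?_ hp1).trans (add_le_add (hA2 n) (hB2 n)))
    · exact (contDiff_iteratedFDeriv (hA n) s).continuous.aestronglyMeasurable.sub
        (h.mem n).2.2.1
    · exact (contDiff_iteratedFDeriv (hB n) s).continuous.aestronglyMeasurable.sub
        h.mem₀.2.2.1
  refine ⟨G, ⟨hG, ?_, ?_, ?_, ?_⟩, hGq, hGp⟩
  · intro R
    have := h.finite
    have := isFiniteMeasure_powMeasure (by linarith) h.mem₀.1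
    have hfin : ν (Metric.closedBall (0 : Eucl N) (|R| + 2)) ^ (1 / critExp N s p)
        + powMeasure f₀ (critExp N s p) (Metric.closedBall 0 (|R| + 2)) ^ (1 / critExp N s p)
        ≠ ⊤ := ENNReal.add_ne_top.2
      ⟨ENNReal.rpow_ne_top_of_nonneg (by positivity) (measure_ne_top _ _),
        ENNReal.rpow_ne_top_of_nonneg (by positivity) (measure_ne_top _ _)⟩
    obtain ⟨c, hc, -⟩ := ENNReal.lt_iff_exists_nnreal_btwn.1 hfin.lt_top
    exact ⟨c, eventually_eLpNorm_le hq (fun n => (h.mem n).1) h.mem₀.1 h.finite h.tendsto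
      (fun n => (hG n).continuous) hGq 0 R hc⟩
  · intro R ε hε
    have hF := isFiniteMeasure_powMeasure (by linarith) h.mem₀.1
    have hq0 : 0 < critExp N s p := by linarith
    have hδ : (0 : ℝ≥0∞) < ((ε : ℝ≥0∞) / 2) ^ critExp N s p :=
      ENNReal.rpow_pos (ENNReal.half_pos (by exact_mod_cast hε.ne')) (by
        exact (ENNReal.half_lt_self (by exact_mod_cast hε.ne') ENNReal.coe_ne_top).ne_top)
    -- The finite measures `ν` and `|f₀|^q dx` have little mass on balls far away.
    obtain ⟨L₁, hL₁⟩ := exists_forall_measure_closedBall_lt h.finite (|R| + 2) hδ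
    obtain ⟨L₂, hL₂⟩ := exists_forall_measure_closedBall_lt hF (|R| + 2) hδ
    refine ⟨max L₁ L₂, fun y hy => eventually_eLpNorm_le hq (fun n => (h.mem n).1) h.mem₀.1
      h.finite h.tendsto (fun n => (hG n).continuous) hGq y R ?_⟩
    have e : ∀ t : ℝ≥0∞, t < ((ε : ℝ≥0∞) / 2) ^ critExp N s p → t ^ (1 / critExp N s p)
        < (ε : ℝ≥0∞) / 2 := by
      intro t ht
      have := ENNReal.rpow_lt_rpow ht (one_div_pos.2 hq0)
      rwa [← ENNReal.rpow_mul, mul_one_div_cancel hq0.ne', ENNReal.rpow_one] at this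
    rw [← ENNReal.add_halves (ε : ℝ≥0∞)]
    exact ENNReal.add_lt_add (e _ (hL₁ y ((le_max_left _ _).trans hy)))
      (e _ (hL₂ y ((le_max_right _ _).trans hy)))
  · intro R
    obtain ⟨A', C, hC⟩ := exists_finset_eLpNorm_iteratedFDeriv_le (N := N)
      (Nat.one_le_iff_ne_zero.1 h.one_le) hp
    have hb : ∀ ξ : UnitSphere N, ∃ c : ℝ≥0, ∀ᶠ n in atTop,
        eLpNorm (fun x => iteratedFDeriv ℝ s (G n) x (fun _ => (ξ : Eucl N))) (ENNReal.ofReal p)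
          (volume.restrict (Metric.closedBall 0 R)) ≤ c := by
      intro ξ
      have := h.finite_limit ξ
      have := isFiniteMeasure_powMeasure (by linarith) (h.mem₀.memLp_dirDeriv ξ)
      have hfin : (powMeasure (dirDeriv s ξ f₀) p + μ ξ)
            (Metric.closedBall (0 : Eucl N) (|R| + 2)) ^ (1 / p)
          + powMeasure (dirDeriv s ξ f₀) p (Metric.closedBall 0 (|R| + 2)) ^ (1 / p)
          ≠ ⊤ := ENNReal.add_ne_top.2
        ⟨ENNReal.rpow_ne_top_of_nonneg (by positivity) (measure_ne_top _ _),
          ENNReal.rpow_ne_top_of_nonneg (by positivity) (measure_ne_top _ _)⟩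
      obtain ⟨c, hc, -⟩ := ENNReal.lt_iff_exists_nnreal_btwn.1 hfin.lt_top
      exact ⟨c, eventually_eLpNorm_le hp (fun n => (h.mem n).memLp_dirDeriv ξ)
        (h.mem₀.memLp_dirDeriv ξ) (h.finite_limit ξ) (h.tendsto_deriv ξ)
        (fun n => (contDiff_iteratedFDeriv_apply (hG n) s _).continuous) (hGp ξ) 0 R hc⟩
    choose c hc using hb
    refine ⟨C * ∑ ξ ∈ A', c ξ, ?_⟩
    filter_upwards [(Filter.eventually_all_finset A').2 fun ξ _ => hc ξ] with n hn
    refine (hC _ _ (hG n)).trans ?_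
    push_cast
    gcongr with ξ hξ
    exact hn ξ hξ
  · intro φ hφ hφc ξ
    have hφp : MemLp φ (ENNReal.ofReal (Real.conjExponent p)) :=
      hφ.continuous.memLp_of_hasCompactSupport hφc
    have hconj := Real.HolderConjugate.conjExponent hp
    have : ENNReal.HolderConjugate (ENNReal.ofReal p) (ENNReal.ofReal (Real.conjExponent p)) :=
      hconj.ennrealOfReal
    have hi : ∀ {u : Eucl N → ℝ}, MemSobolev s p u → Integrable fun x => dirDeriv s ξ u x * φ x :=
      fun hu => (hu.memLp_dirDeriv ξ).integrable_mul hφp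
    have hcont : ∀ n, Continuous fun x => iteratedFDeriv ℝ s (G n) x (fun _ => (ξ : Eucl N)) :=
      fun n => (contDiff_iteratedFDeriv_apply (hG n) s _).continuous
    have hiG : ∀ n, Integrable fun x => iteratedFDeriv ℝ s (G n) x (fun _ => (ξ : Eucl N)) * φ x :=
      fun n => ((hcont n).mul hφ.continuous).integrable_of_hasCompactSupport hφc.mul_left
    let D : ℕ → Eucl N → ℝ := fun n x => iteratedFDeriv ℝ s (G n) x (fun _ => (ξ : Eucl N))
        - (dirDeriv s ξ (f n) x - dirDeriv s ξ f₀ x)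
    have hD : Tendsto (fun n => ∫ x, D n x * φ x) atTop (𝓝 0) := by
      rw [tendsto_zero_iff_enorm_tendsto_zero]
      have h1 := ENNReal.Tendsto.mul_const (b := eLpNorm φ
        (ENNReal.ofReal (Real.conjExponent p)) volume) (hGp ξ) (Or.inr hφp.2.ne)
      rw [zero_mul] at h1
      refine tendsto_of_tendsto_of_tendsto_of_le_of_le tendsto_const_nhds h1
        (fun _ => zero_le) fun n => enorm_integral_mul_le hp ?_ hφp.1
      exact (hcont n).aestronglyMeasurable.sub
        (((h.mem n).memLp_dirDeriv ξ).1.sub (h.mem₀.memLp_dirDeriv ξ).1)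
    have hW := h.weak ξ φ hφp
    have hsum := hD.add (hW.sub_const (∫ x, dirDeriv s ξ f₀ x * φ x))
    rw [sub_self, add_zero] at hsum
    refine hsum.congr fun n => ?_
    have hiD : Integrable fun x => D n x * φ x := by
      refine ((hiG n).sub ((hi (h.mem n)).sub (hi h.mem₀))).congr
        (Eventually.of_forall fun x => ?_)
      simp only [D, Pi.sub_apply]
      ring
    rw [← integral_sub (hi (h.mem n)) (hi h.mem₀)]
    refine (integral_add hiD ((hi (h.mem n)).sub (hi h.mem₀))).symm.trans ?_
    refine integral_congr_ae (Eventually.of_forall fun x => ?_)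
    simp only [D, Pi.sub_apply]
    ring

end Concentrates
end Setting

/-! ### Localisation by test functions -/

section Localisation
variable {N s : ℕ} {p : ℝ}

theorem eLpNorm_mul_eq_powMeasure {u : Eucl N → ℝ} {r : ℝ} (hr : 0 < r)
    (hu : AEStronglyMeasurable u) (φ : Eucl N → ℝ) :
    eLpNorm (fun x => φ x * u x) (ENNReal.ofReal r) volume
      = eLpNorm φ (ENNReal.ofReal r) (powMeasure u r) := by
  rw [eLpNorm_mul_eq_lintegral_powMeasure hr hu, eLpNorm_eq_lintegral_rpow hr]

/-- The commutator of multiplication by a test function and differentiation of order `s` tends to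
zero in `L^p` along a weakly null sequence. -/
theorem WeaklyNull.tendsto_commutator {q : ℝ} {G : ℕ → Eucl N → ℝ} (h : WeaklyNull s p q G)
    (hN : 0 < N) (hp : 1 < p) (hq : 1 < q) {φ : Eucl N → ℝ} (hφ : ContDiff ℝ ∞ φ)
    (hφc : HasCompactSupport φ) :
    Tendsto (fun n => eLpNorm (fun x => iteratedFDeriv ℝ s (fun y => φ y * G n y) x
      - φ x • iteratedFDeriv ℝ s (G n) x) (ENNReal.ofReal p) volume) atTop (𝓝 0) := by
  obtain ⟨C, hC⟩ := exists_norm_iteratedFDeriv_mul_sub_le hφ hφc s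
  obtain ⟨R, hR⟩ := hφc.isCompact.isBounded.subset_closedBall (0 : Eucl N)
  have hB : MeasurableSet (Metric.closedBall (0 : Eucl N) R) :=
    Metric.isClosed_closedBall.measurableSet
  have hz : Tendsto (fun n => (C : ℝ≥0∞) * ∑ k ∈ Finset.range s,
      eLpNorm (iteratedFDeriv ℝ k (G n)) (ENNReal.ofReal p)
        (volume.restrict (Metric.closedBall 0 R))) atTop (𝓝 (C * ∑ _k ∈ Finset.range s, 0)) :=
    ENNReal.Tendsto.const_mul (tendsto_finsetSum _ fun k hk =>
      h.tendsto_eLpNorm_iteratedFDeriv hN hp hq (Finset.mem_range.1 hk) R)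
      (Or.inr ENNReal.coe_ne_top)
  rw [Finset.sum_const_zero, mul_zero] at hz
  refine tendsto_of_tendsto_of_tendsto_of_le_of_le tendsto_const_nhds hz (fun _ => zero_le)
    fun n => ?_
  have h1 : ∀ x, ‖iteratedFDeriv ℝ s (fun y => φ y * G n y) x
      - φ x • iteratedFDeriv ℝ s (G n) x‖ ≤ C * ‖(Metric.closedBall (0 : Eucl N) R).indicator
        (fun x => ∑ k ∈ Finset.range s, ‖iteratedFDeriv ℝ k (G n) x‖) x‖ := by
    intro x
    refine (hC (G n) (h.contDiff n) x).trans ?_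
    by_cases hx : x ∈ tsupport φ
    · rw [Set.indicator_of_mem hx, Set.indicator_of_mem (hR hx)]
      gcongr
      exact Real.le_norm_self _
    · rw [Set.indicator_of_notMem hx]
      positivity
  refine (eLpNorm_le_nnreal_smul_eLpNorm_of_ae_le_mul (Eventually.of_forall h1) _).trans ?_
  rw [ENNReal.smul_def, smul_eq_mul, eLpNorm_indicator_eq_eLpNorm_restrict hB]
  gcongr
  have h2 := eLpNorm_sum_le (s := Finset.range s) (p := ENNReal.ofReal p)
    (μ := volume.restrict (Metric.closedBall (0 : Eucl N) R))
    (f := fun k x => ‖iteratedFDeriv ℝ k (G n) x‖)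
    (fun k _ => (contDiff_iteratedFDeriv (h.contDiff n) k).continuous.norm.aestronglyMeasurable)
    (by simpa using hp.le)
  simp only [eLpNorm_norm] at h2
  refine le_trans (le_of_eq ?_) h2
  congr 1
  funext x
  simp

/-- The Sobolev inequality of order `s` for test functions, with the critical exponent. -/
theorem exists_eLpNorm_critExp_le (hN : 0 < N) (hp : 1 < p) (hsp : (s : ℝ) * p < N)
    (hq : 0 < critExp N s p) :
    ∃ C : ℝ≥0, ∀ u : Eucl N → ℝ, ContDiff ℝ ∞ u → HasCompactSupport u →
      eLpNorm u (ENNReal.ofReal (critExp N s p)) volume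
        ≤ C * eLpNorm (iteratedFDeriv ℝ s u) (ENNReal.ofReal p) volume := by
  refine exists_eLpNorm_le_iteratedFDeriv hN s p.toNNReal (critExp N s p).toNNReal
    (by simpa using hp.le) (by simpa using hq) ?_
  rw [Real.coe_toNNReal _ (by linarith : 0 ≤ p), Real.coe_toNNReal _ hq.le, critExp]
  have h1 : (N : ℝ) ≠ 0 := by positivity
  have h2 : p ≠ 0 := by linarith
  have h3 : (N : ℝ) - s * p ≠ 0 := by linarith
  field_simp

end Localisation

section Setting
variable {N s : ℕ} {p : ℝ} {f : ℕ → Eucl N → ℝ} {f₀ : Eucl N → ℝ}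
  {ν : Measure (Eucl N)} {μ : UnitSphere N → Measure (Eucl N)} {G : ℕ → Eucl N → ℝ}

namespace Concentrates

/-- Asymptotically, `‖∂^s_ξ (φ (f_n - f₀))‖_p` is at most the sum of the norms of `φ ∂^s_ξ f_n` and
of `φ ∂^s_ξ f₀`. -/
theorem exists_eLpNorm_deriv_mul_le (h : Concentrates s p f f₀ ν μ)
    (hG : WeaklyNull s p (critExp N s p) G)
    (hGp : ∀ ξ : UnitSphere N, Tendsto (fun n => eLpNorm
      (fun x => iteratedFDeriv ℝ s (G n) x (fun _ => (ξ : Eucl N))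
        - (dirDeriv s ξ (f n) x - dirDeriv s ξ f₀ x)) (ENNReal.ofReal p) volume) atTop (𝓝 0))
    {φ : Eucl N → ℝ} (hφ : ContDiff ℝ ∞ φ) (hφc : HasCompactSupport φ) (ξ : UnitSphere N) :
    ∃ b : ℕ → ℝ≥0∞,
      Tendsto b atTop (𝓝 (eLpNorm φ (ENNReal.ofReal p) (powMeasure (dirDeriv s ξ f₀) p + μ ξ)
        + eLpNorm φ (ENNReal.ofReal p) (powMeasure (dirDeriv s ξ f₀) p))) ∧
      ∀ n, eLpNorm (fun x => iteratedFDeriv ℝ s (fun y => φ y * G n y) x (fun _ => (ξ : Eucl N)))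
        (ENNReal.ofReal p) volume ≤ b n := by
  have hp := h.one_lt
  have hp0 : 0 < p := by linarith
  have hq : 1 < critExp N s p := hp.trans h.lt_critExp
  have hp1 : 1 ≤ ENNReal.ofReal p := by simpa using hp.le
  obtain ⟨M, hM⟩ := hφ.continuous.bounded_above_of_compact_support hφc
  have hM0 : 0 ≤ M := (norm_nonneg _).trans (hM 0)
  let d : ℕ → Eucl N → ℝ := fun n x => iteratedFDeriv ℝ s (G n) x (fun _ => (ξ : Eucl N))
  let e : ℕ → Eucl N → ℝ := fun n x => d n x - (dirDeriv s ξ (f n) x - dirDeriv s ξ f₀ x)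
  let c : ℕ → Eucl N → ℝ := fun n x =>
    iteratedFDeriv ℝ s (fun y => φ y * G n y) x (fun _ => (ξ : Eucl N)) - φ x * d n x
  have hd : ∀ n, Continuous (d n) := fun n =>
    (contDiff_iteratedFDeriv_apply (hG.contDiff n) s _).continuous
  have hu : ∀ n, ContDiff ℝ ∞ fun y => φ y * G n y := fun n => hφ.mul (hG.contDiff n)
  have hc : ∀ n, Continuous (c n) := fun n =>
    (contDiff_iteratedFDeriv_apply (hu n) s _).continuous.sub (hφ.continuous.mul (hd n))
  have hw : ∀ n, AEStronglyMeasurable (dirDeriv s ξ (f n)) := fun n =>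
    ((h.mem n).memLp_dirDeriv ξ).1
  have hw₀ : AEStronglyMeasurable (dirDeriv s ξ f₀) := (h.mem₀.memLp_dirDeriv ξ).1
  have hφm : AEStronglyMeasurable φ := hφ.continuous.aestronglyMeasurable
  refine ⟨fun n => eLpNorm (fun x => iteratedFDeriv ℝ s (fun y => φ y * G n y) x
      - φ x • iteratedFDeriv ℝ s (G n) x) (ENNReal.ofReal p) volume
    + (ENNReal.ofReal M * eLpNorm (e n) (ENNReal.ofReal p) volume
    + (eLpNorm (fun x => φ x * dirDeriv s ξ (f n) x) (ENNReal.ofReal p) volume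
    + eLpNorm (fun x => φ x * dirDeriv s ξ f₀ x) (ENNReal.ofReal p) volume)), ?_, fun n => ?_⟩
  · have h1 := hG.tendsto_commutator h.dim_pos hp hq hφ hφc
    have h2 := ENNReal.Tendsto.const_mul (a := ENNReal.ofReal M) (hGp ξ)
      (Or.inr ENNReal.ofReal_ne_top)
    have h3 := h.tendsto_eLpNorm_dirDeriv hφ.continuous hφc ξ
    rw [← eLpNorm_eq_lintegral_rpow hp0] at h3
    rw [mul_zero] at h2
    have h4 := h1.add (h2.add (h3.add_const
      (eLpNorm (fun x => φ x * dirDeriv s ξ f₀ x) (ENNReal.ofReal p) volume)))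
    rw [zero_add, zero_add, eLpNorm_mul_eq_powMeasure hp0 hw₀] at h4
    simp only [eLpNorm_mul_eq_powMeasure hp0 hw₀]
    exact h4
  · have e1 : (fun x => iteratedFDeriv ℝ s (fun y => φ y * G n y) x (fun _ => (ξ : Eucl N)))
        = c n + ((fun x => φ x * e n x) + ((fun x => φ x * dirDeriv s ξ (f n) x)
          - fun x => φ x * dirDeriv s ξ f₀ x)) := by
      funext x
      simp only [c, e, Pi.add_apply, Pi.sub_apply]
      ring
    have m1 : AEStronglyMeasurable (fun x => φ x * e n x) :=
      hφm.mul ((hd n).aestronglyMeasurable.sub ((hw n).sub hw₀))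
    have m2 : AEStronglyMeasurable (fun x => φ x * dirDeriv s ξ (f n) x) := hφm.mul (hw n)
    have m3 : AEStronglyMeasurable (fun x => φ x * dirDeriv s ξ f₀ x) := hφm.mul hw₀
    rw [e1]
    refine (eLpNorm_add_le (hc n).aestronglyMeasurable (m1.add (m2.sub m3)) hp1).trans
      (add_le_add ?_ ((eLpNorm_add_le m1 (m2.sub m3) hp1).trans
        (add_le_add ?_ (eLpNorm_sub_le m2 m3 hp1))))
    · refine eLpNorm_mono fun x => ?_
      refine le_trans (le_of_eq ?_) (norm_apply_unit_le ξ _)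
      simp [c, d]
    · refine eLpNorm_le_mul_eLpNorm_of_ae_le_mul (Eventually.of_forall fun x => ?_) _
      rw [norm_mul]
      gcongr
      exact hM x

/-- Asymptotically, `‖φ f_n‖_q` is at most the sum of the norms of `φ (f_n - f₀)` and of
`φ f₀`. -/
theorem exists_eLpNorm_mul_le (h : Concentrates s p f f₀ ν μ)
    (hG : WeaklyNull s p (critExp N s p) G)
    (hGq : Tendsto (fun n => eLpNorm (fun x => G n x - (f n x - f₀ x))
      (ENNReal.ofReal (critExp N s p)) volume) atTop (𝓝 0))
    {φ : Eucl N → ℝ} (hφ : ContDiff ℝ ∞ φ) (hφc : HasCompactSupport φ) :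
    ∃ b : ℕ → ℝ≥0∞,
      Tendsto b atTop (𝓝 (eLpNorm φ (ENNReal.ofReal (critExp N s p))
        (powMeasure f₀ (critExp N s p)))) ∧
      ∀ n, eLpNorm (fun x => φ x * f n x) (ENNReal.ofReal (critExp N s p)) volume
        ≤ eLpNorm (fun x => φ x * G n x) (ENNReal.ofReal (critExp N s p)) volume + b n := by
  have hq : 1 < critExp N s p := h.one_lt.trans h.lt_critExp
  have hq0 : 0 < critExp N s p := by linarith
  have hq1 : 1 ≤ ENNReal.ofReal (critExp N s p) := by simpa using hq.le
  obtain ⟨M, hM⟩ := hφ.continuous.bounded_above_of_compact_support hφc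
  have hφm : AEStronglyMeasurable φ := hφ.continuous.aestronglyMeasurable
  have hw := fun n => (h.mem n).1.1
  have hw₀ := h.mem₀.1.1
  have hGm := fun n => (hG.contDiff n).continuous.aestronglyMeasurable (μ := volume)
  refine ⟨fun n => ENNReal.ofReal M * eLpNorm (fun x => G n x - (f n x - f₀ x))
      (ENNReal.ofReal (critExp N s p)) volume
    + eLpNorm (fun x => φ x * f₀ x) (ENNReal.ofReal (critExp N s p)) volume, ?_, fun n => ?_⟩
  · have h2 := ENNReal.Tendsto.const_mul (a := ENNReal.ofReal M) hGq (Or.inr ENNReal.ofReal_ne_top)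
    rw [mul_zero] at h2
    have h4 := h2.add_const
      (eLpNorm (fun x => φ x * f₀ x) (ENNReal.ofReal (critExp N s p)) volume)
    rw [zero_add, eLpNorm_mul_eq_powMeasure hq0 hw₀] at h4
    simp only [eLpNorm_mul_eq_powMeasure hq0 hw₀]
    exact h4
  · have e1 : (fun x => φ x * f n x) = ((fun x => φ x * G n x)
        - fun x => φ x * (G n x - (f n x - f₀ x))) + fun x => φ x * f₀ x := by
      funext x
      simp only [Pi.add_apply, Pi.sub_apply]
      ring
    have m1 : AEStronglyMeasurable (fun x => φ x * G n x) := hφm.mul (hGm n)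
    have m2 : AEStronglyMeasurable (fun x => φ x * (G n x - (f n x - f₀ x))) :=
      hφm.mul ((hGm n).sub ((hw n).sub hw₀))
    have m3 : AEStronglyMeasurable (fun x => φ x * f₀ x) := hφm.mul hw₀
    conv_lhs => rw [e1]
    refine (eLpNorm_add_le (m1.sub m2) m3 hq1).trans ?_
    rw [← add_assoc]
    refine add_le_add ((eLpNorm_sub_le m1 m2 hq1).trans (add_le_add le_rfl ?_)) le_rfl
    refine eLpNorm_le_mul_eLpNorm_of_ae_le_mul (Eventually.of_forall fun x => ?_) _
    rw [norm_mul]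
    gcongr
    exact hM x

/-- The reverse Hölder inequality between `ν` and a finite measure which controls all the
measures `|∂^s_ξ f₀|^p dx + μ ξ`, up to the contribution of `f₀`. -/
theorem exists_eLpNorm_le (h : Concentrates s p f f₀ ν μ) :
    ∃ (m : Measure (Eucl N)) (C : ℝ≥0), IsFiniteMeasure m ∧
      ∀ φ : Eucl N → ℝ, ContDiff ℝ ∞ φ → HasCompactSupport φ →
        eLpNorm φ (ENNReal.ofReal (critExp N s p)) ν
          ≤ eLpNorm φ (ENNReal.ofReal (critExp N s p)) (powMeasure f₀ (critExp N s p))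
            + C * eLpNorm φ (ENNReal.ofReal p) m := by
  have hp := h.one_lt
  have hq0 : 0 < critExp N s p := by linarith [h.lt_critExp]
  obtain ⟨G, hG, hGq, hGp⟩ := h.exists_weaklyNull
  obtain ⟨C, hC⟩ := exists_eLpNorm_critExp_le h.dim_pos hp h.lt_dim hq0
  obtain ⟨A, C', hC'⟩ := exists_finset_eLpNorm_iteratedFDeriv_le (N := N)
      (Nat.one_le_iff_ne_zero.1 h.one_le) hp
  let m₁ : UnitSphere N → Measure (Eucl N) := fun ξ => powMeasure (dirDeriv s ξ f₀) p + μ ξ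
  have := h.finite_limit
  refine ⟨∑ ξ ∈ A, m₁ ξ, C * (C' * (A.card * 2)), ?_, fun φ hφ hφc => ?_⟩
  · constructor
    rw [Measure.finsetSum_apply]
    exact ENNReal.sum_lt_top.2 fun ξ _ => measure_lt_top (m₁ ξ) _
  choose b hb hbn using fun ξ => h.exists_eLpNorm_deriv_mul_le hG hGp hφ hφc ξ
  obtain ⟨b', hb', hbn'⟩ := h.exists_eLpNorm_mul_le hG hGq hφ hφc
  have h1 := h.tendsto_eLpNorm hφ.continuous hφc
  rw [← eLpNorm_eq_lintegral_rpow hq0] at h1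
  have h2 := (ENNReal.Tendsto.const_mul (a := (C : ℝ≥0∞)) (ENNReal.Tendsto.const_mul
    (a := (C' : ℝ≥0∞)) (tendsto_finsetSum A fun ξ _ => hb ξ) (Or.inr ENNReal.coe_ne_top))
    (Or.inr ENNReal.coe_ne_top)).add hb'
  refine (le_of_tendsto_of_tendsto' h1 h2 fun n => ?_).trans ?_
  · refine (hbn' n).trans (add_le_add ?_ le_rfl)
    refine (hC _ (hφ.mul (hG.contDiff n)) hφc.mul_right).trans ?_
    gcongr
    refine (hC' _ _ (hφ.mul (hG.contDiff n))).trans ?_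
    gcongr with ξ
    exact hbn ξ n
  · rw [add_comm]
    refine add_le_add le_rfl ?_
    push_cast
    rw [mul_assoc, mul_assoc]
    refine mul_le_mul_right (mul_le_mul_right ?_ _) _
    rw [mul_assoc, ← nsmul_eq_mul]
    refine Finset.sum_le_card_nsmul _ _ _ fun ξ hξ => ?_
    rw [two_mul]
    have hle : m₁ ξ ≤ ∑ ξ ∈ A, m₁ ξ := by
      refine Measure.le_iff.2 fun B _ => ?_
      rw [Measure.finsetSum_apply]
      exact Finset.single_le_sum (f := fun ξ => m₁ ξ B) (fun _ _ => zero_le) hξ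
    exact add_le_add (eLpNorm_mono_measure _ hle)
      (eLpNorm_mono_measure _ (le_trans (Measure.le_add_right le_rfl) hle))

/-- Lower semicontinuity: by Rellich's theorem `f_n` tends to `f₀` locally, and Fatou's lemma
applies along an almost everywhere convergent subsequence. -/
theorem eLpNorm_powMeasure_le (h : Concentrates s p f f₀ ν μ) {φ : Eucl N → ℝ}
    (hφ : ContDiff ℝ ∞ φ) (hφc : HasCompactSupport φ) :
    eLpNorm φ (ENNReal.ofReal (critExp N s p)) (powMeasure f₀ (critExp N s p))
      ≤ eLpNorm φ (ENNReal.ofReal (critExp N s p)) ν := by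
  have hp := h.one_lt
  have hq : 1 < critExp N s p := hp.trans h.lt_critExp
  have hq0 : 0 < critExp N s p := by linarith [h.lt_critExp]
  have hp1 : 1 ≤ ENNReal.ofReal p := by simpa using hp.le
  obtain ⟨G, hG, hGq, hGp⟩ := h.exists_weaklyNull
  obtain ⟨R, hR⟩ := hφc.isCompact.isBounded.subset_closedBall (0 : Eucl N)
  have hB : MeasurableSet (Metric.closedBall (0 : Eucl N) R) :=
    Metric.isClosed_closedBall.measurableSet
  set mB := volume.restrict (Metric.closedBall (0 : Eucl N) R) with hmB
  have hfin : IsFiniteMeasure mB := ⟨by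
    rw [hmB, Measure.restrict_apply_univ]; exact measure_closedBall_lt_top⟩
  have hw := fun n => (h.mem n).1.1.restrict (s := Metric.closedBall (0 : Eucl N) R)
  have hw₀ := h.mem₀.1.1.restrict (s := Metric.closedBall (0 : Eucl N) R)
  have hGm := fun n => (hG.contDiff n).continuous.aestronglyMeasurable (μ := mB)
  have hlim : Tendsto (fun n => eLpNorm (f n - f₀) (ENNReal.ofReal p) mB) atTop (𝓝 0) := by
    have h1 := hG.tendsto_eLpNorm_iteratedFDeriv h.dim_pos hp hq (k := 0) h.one_le R
    have hpq : ENNReal.ofReal p ≤ ENNReal.ofReal (critExp N s p) :=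
      ENNReal.ofReal_le_ofReal h.lt_critExp.le
    let a : ℝ := 1 / (ENNReal.ofReal p).toReal - 1 / (ENNReal.ofReal (critExp N s p)).toReal
    have ha : 0 ≤ a := by
      simp only [a, ENNReal.toReal_ofReal hq0.le, ENNReal.toReal_ofReal (by linarith : 0 ≤ p)]
      rw [sub_nonneg]
      exact one_div_le_one_div_of_le (by linarith) h.lt_critExp.le
    have h2 := h1.add (ENNReal.Tendsto.mul_const (b := mB Set.univ ^ a) hGq
      (Or.inr (ENNReal.rpow_ne_top_of_nonneg ha (measure_ne_top _ _))))
    rw [zero_mul, add_zero] at h2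
    refine tendsto_of_tendsto_of_tendsto_of_le_of_le tendsto_const_nhds h2 (fun _ => zero_le)
      fun n => ?_
    have e : f n - f₀ = G n - fun x => G n x - (f n x - f₀ x) := by
      funext x
      simp only [Pi.sub_apply]
      ring
    have m2 : AEStronglyMeasurable (fun x => G n x - (f n x - f₀ x)) mB :=
      (hGm n).sub ((hw n).sub hw₀)
    rw [e]
    refine (eLpNorm_sub_le (hGm n) m2 hp1).trans (add_le_add ?_ ?_)
    · refine le_of_eq (eLpNorm_congr_norm_ae (Eventually.of_forall fun x => ?_))
      exact norm_iteratedFDeriv_zero.symm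
    · refine (eLpNorm_le_eLpNorm_mul_rpow_measure_univ hpq m2).trans ?_
      exact mul_le_mul_left (eLpNorm_mono_measure _ Measure.restrict_le_self) _
  have hmeas := tendstoInMeasure_of_tendsto_eLpNorm (by simpa using (by linarith : 0 < p))
    hw hw₀ hlim
  obtain ⟨k, hk, hae⟩ := hmeas.exists_seq_tendsto_ae
  have hφm : AEStronglyMeasurable φ mB := hφ.continuous.aestronglyMeasurable
  have hF := Lp.eLpNorm_lim_le_liminf_eLpNorm (p := ENNReal.ofReal (critExp N s p)) (μ := mB)
    (f := fun n x => φ x * f (k n) x) (fun n => hφm.mul (hw (k n))) (fun x => φ x * f₀ x)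
    (by filter_upwards [hae] with x hx using hx.const_mul _)
  have hglob : ∀ u : Eucl N → ℝ, eLpNorm (fun x => φ x * u x)
      (ENNReal.ofReal (critExp N s p)) volume
      = eLpNorm (fun x => φ x * u x) (ENNReal.ofReal (critExp N s p)) mB := by
    intro u
    rw [hmB, ← eLpNorm_indicator_eq_eLpNorm_restrict hB]
    congr 1
    funext x
    by_cases hx : x ∈ Metric.closedBall (0 : Eucl N) R
    · rw [Set.indicator_of_mem hx]
    · rw [Set.indicator_of_notMem hx, image_eq_zero_of_notMem_tsupport (fun h => hx (hR h)),
        zero_mul]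
  have h1 := (h.tendsto_eLpNorm hφ.continuous hφc).comp hk.tendsto_atTop
  rw [← eLpNorm_eq_lintegral_rpow hq0] at h1
  rw [← eLpNorm_mul_eq_powMeasure hq0 h.mem₀.1.1, hglob, ← h1.liminf_eq]
  refine hF.trans (le_of_eq ?_)
  congr 1
  funext n
  exact (hglob _).symm

end Concentrates
end Setting

/-! ### Reverse Hölder inequalities and atoms -/

section ReverseHolder
variable {N : ℕ} {p q : ℝ}

/-- A smooth cut-off function between a compact set and one of its thickenings. -/
theorem exists_contDiff_cutoff {K : Set (Eucl N)} (hK : IsCompact K) {δ : ℝ} (hδ : 0 < δ) :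
    ∃ φ : Eucl N → ℝ, ContDiff ℝ ∞ φ ∧ HasCompactSupport φ ∧ (∀ x, ‖φ x‖ ≤ 1) ∧
      (∀ x ∈ K, φ x = 1) ∧ ∀ x ∉ Metric.cthickening δ K, φ x = 0 := by
  have hd : Disjoint (Metric.thickening δ K)ᶜ K := by
    rw [Set.disjoint_compl_left_iff_subset]
    exact Metric.self_subset_thickening hδ K
  obtain ⟨φ, h0, h1, h2⟩ := exists_contMDiffMap_zero_one_of_isClosed (n := ⊤)
    (modelWithCornersSelf ℝ (Eucl N)) Metric.isOpen_thickening.isClosed_compl hK.isClosed hd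
  have h3 : ∀ x ∉ Metric.cthickening δ K, φ x = 0 := fun x hx =>
    h0 fun h => hx (Metric.thickening_subset_cthickening δ K h)
  refine ⟨φ, φ.contMDiff.contDiff, HasCompactSupport.intro hK.cthickening h3, fun x => ?_,
    fun x hx => h1 hx, h3⟩
  rw [Real.norm_of_nonneg (h2 x).1]
  exact (h2 x).2

/-- An inequality between the norms of all test functions with respect to three measures passes
to all Borel sets. -/
theorem measure_rpow_le_of_eLpNorm_le (hp : 0 < p) (hq : 0 < q) {κ F m : Measure (Eucl N)}
    [IsFiniteMeasure κ] [IsFiniteMeasure F] [IsFiniteMeasure m] {C : ℝ≥0}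
    (h : ∀ φ : Eucl N → ℝ, ContDiff ℝ ∞ φ → HasCompactSupport φ →
      eLpNorm φ (ENNReal.ofReal q) κ
        ≤ eLpNorm φ (ENNReal.ofReal q) F + C * eLpNorm φ (ENNReal.ofReal p) m)
    {A : Set (Eucl N)} (hA : MeasurableSet A) :
    κ A ^ (1 / q) ≤ F A ^ (1 / q) + C * m A ^ (1 / p) := by
  have hK : ∀ K : Set (Eucl N), IsCompact K →
      κ K ^ (1 / q) ≤ F K ^ (1 / q) + C * m K ^ (1 / p) := by
    intro K hK
    have h1 := ((tendsto_measure_cthickening_of_isCompact (μ := F) hK).ennrpow_const (1 / q)).add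
      (ENNReal.Tendsto.const_mul (a := (C : ℝ≥0∞))
        ((tendsto_measure_cthickening_of_isCompact (μ := m) hK).ennrpow_const (1 / p))
        (Or.inr ENNReal.coe_ne_top))
    refine ge_of_tendsto (h1.mono_left (nhdsWithin_le_nhds (s := Set.Ioi 0))) ?_
    filter_upwards [self_mem_nhdsWithin] with δ hδ
    obtain ⟨φ, hφ, hφc, hφ1, hφK, hφ0⟩ := exists_contDiff_cutoff hK hδ
    have hB : MeasurableSet (Metric.cthickening δ K) := Metric.isClosed_cthickening.measurableSet
    have h2 := h φ hφ hφc
    simp only [eLpNorm_eq_lintegral_rpow hp, eLpNorm_eq_lintegral_rpow hq] at h2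
    calc κ K ^ (1 / q) ≤ (∫⁻ x, ‖φ x‖ₑ ^ q ∂κ) ^ (1 / q) := by
          gcongr
          exact measure_le_lintegral_enorm_rpow hK.measurableSet hφK
      _ ≤ _ := h2
      _ ≤ _ := by
          gcongr
          · exact lintegral_enorm_rpow_le_measure hq hB hφ1 hφ0
          · exact lintegral_enorm_rpow_le_measure hp hB hφ1 hφ0
  rw [one_div, ENNReal.rpow_inv_le_iff hq, hA.measure_eq_iSup_isCompact κ]
  refine iSup_le fun K => iSup_le fun hKA => iSup_le fun hKc => ?_
  rw [← ENNReal.rpow_inv_le_iff hq, ← one_div]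
  refine (hK K hKc).trans ?_
  gcongr

/-- The reverse Hölder inequality forces `κ ≤ F` where `m` has no atoms: on a set of small
`m`-measure the term `m A ^ (1 / p)` is negligible in `ℓ^q` since `p < q`. -/
theorem measure_le_of_forall_singleton_eq_zero (hp : 0 < p) (hpq : p < q) (hq : 1 ≤ q)
    {κ F m : Measure (Eucl N)} [IsFiniteMeasure m] {C : ℝ≥0}
    (h : ∀ A, MeasurableSet A → κ A ^ (1 / q) ≤ F A ^ (1 / q) + C * m A ^ (1 / p))
    {A : Set (Eucl N)} (hA : MeasurableSet A) (hA0 : ∀ x ∈ A, m {x} = 0) : κ A ≤ F A := by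
  have hq0 : 0 < q := by linarith
  have ha : 0 < q / p - 1 := by
    rw [sub_pos, one_lt_div hp]
    exact hpq
  have key : ∀ ε : ℝ≥0∞, 0 < ε →
      κ A ^ (1 / q) ≤ F A ^ (1 / q) + (C ^ q * (ε ^ (q / p - 1) * m A)) ^ (1 / q) := by
    intro ε hε
    rcases A.eq_empty_or_nonempty with rfl | hne
    · simp [ENNReal.zero_rpow_of_pos, hq0]
    have hU : ∀ x ∈ A, ∃ U, IsOpen U ∧ x ∈ U ∧ m U < ε := by
      intro x hx
      obtain ⟨U, hxU, hU, hm⟩ := Set.exists_isOpen_lt_of_lt {x} ε (by rwa [hA0 x hx])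
      exact ⟨U, hU, hxU rfl, hm⟩
    choose! U hUo hxU hUm using hU
    obtain ⟨t, htA, htc, hcov⟩ := TopologicalSpace.countable_cover_nhdsWithin (s := A) (f := U)
      fun x hx => mem_nhdsWithin_of_mem_nhds ((hUo x hx).mem_nhds (hxU x hx))
    have htne : t.Nonempty := by
      obtain ⟨x, hx⟩ := hne
      obtain ⟨y, hy, -⟩ := Set.mem_iUnion₂.1 (hcov hx)
      exact ⟨y, hy⟩
    obtain ⟨e, rfl⟩ := htc.exists_eq_range htne
    have heA : ∀ n, e n ∈ A := fun n => htA ⟨n, rfl⟩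
    let V : ℕ → Set (Eucl N) := fun n => U (e n)
    have hVm : ∀ n, MeasurableSet (V n) := fun n => (hUo _ (heA n)).measurableSet
    let B : ℕ → Set (Eucl N) := fun n => A ∩ disjointed V n
    have hBm : ∀ n, MeasurableSet (B n) := fun n =>
      hA.inter (MeasurableSet.disjointed hVm n)
    have hBd : Pairwise (Function.onFun Disjoint B) := fun i j hij =>
      (disjoint_disjointed V hij).mono Set.inter_subset_right Set.inter_subset_right
    have hBA : ⋃ n, B n = A := by
      rw [← Set.inter_iUnion, iUnion_disjointed, Set.inter_eq_left]
      intro x hx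
      obtain ⟨y, ⟨n, rfl⟩, hy⟩ := Set.mem_iUnion₂.1 (hcov hx)
      exact Set.mem_iUnion.2 ⟨n, hy⟩
    have hsum : ∀ μ : Measure (Eucl N), ∑' n, μ (B n) = μ A := fun μ => by
      rw [← measure_iUnion hBd hBm, hBA]
    have hsmall : ∀ n, m (B n) ≤ ε := fun n =>
      (measure_mono (Set.inter_subset_right.trans (disjointed_subset V n))).trans
        (hUm _ (heA n)).le
    have hid : ∀ a : ℝ≥0∞, (a ^ (1 / q)) ^ q = a := fun a => by
      rw [← ENNReal.rpow_mul, one_div_mul_cancel hq0.ne', ENNReal.rpow_one]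
    have hterm : ∀ n, ((C : ℝ≥0∞) * m (B n) ^ (1 / p)) ^ q
        ≤ C ^ q * (ε ^ (q / p - 1) * m (B n)) := by
      intro n
      rw [ENNReal.mul_rpow_of_nonneg _ _ hq0.le, ← ENNReal.rpow_mul]
      refine mul_le_mul_right ?_ _
      have e1 : 1 / p * q = (q / p - 1) + 1 := by ring
      rw [e1, ENNReal.rpow_add_of_nonneg _ _ ha.le zero_le_one, ENNReal.rpow_one]
      exact mul_le_mul_left (ENNReal.rpow_le_rpow (hsmall n) ha.le) _
    have hmink := ENNReal.lintegral_Lp_add_le (μ := (Measure.count : Measure ℕ))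
      (f := fun n => F (B n) ^ (1 / q)) (g := fun n => (C : ℝ≥0∞) * m (B n) ^ (1 / p))
      (measurable_of_countable _).aemeasurable (measurable_of_countable _).aemeasurable hq
    simp only [lintegral_count, Pi.add_apply, hid, hsum] at hmink
    calc κ A ^ (1 / q) = (∑' n, (κ (B n) ^ (1 / q)) ^ q) ^ (1 / q) := by
          simp only [hid, hsum]
      _ ≤ (∑' n, (F (B n) ^ (1 / q) + C * m (B n) ^ (1 / p)) ^ q) ^ (1 / q) := by
          gcongr with n
          exact h _ (hBm n)
      _ ≤ _ := hmink
      _ ≤ _ := by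
          gcongr
          rw [← hsum m, ← ENNReal.tsum_mul_left, ← ENNReal.tsum_mul_left]
          exact ENNReal.tsum_le_tsum hterm
  have hlim : Tendsto (fun ε : ℝ≥0∞ => F A ^ (1 / q)
      + ((C : ℝ≥0∞) ^ q * (ε ^ (q / p - 1) * m A)) ^ (1 / q)) (𝓝[>] 0)
      (𝓝 (F A ^ (1 / q) + ((C : ℝ≥0∞) ^ q * (0 ^ (q / p - 1) * m A)) ^ (1 / q))) := by
    refine tendsto_const_nhds.add (Tendsto.ennrpow_const (1 / q) ?_)
    refine ENNReal.Tendsto.const_mul (ENNReal.Tendsto.mul_const ?_ (Or.inr (measure_ne_top _ _)))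
      (Or.inr (ENNReal.rpow_ne_top_of_nonneg hq0.le ENNReal.coe_ne_top))
    exact (tendsto_id.mono_left nhdsWithin_le_nhds).ennrpow_const _
  rw [ENNReal.zero_rpow_of_pos ha, zero_mul, mul_zero, ENNReal.zero_rpow_of_pos (by positivity),
    add_zero] at hlim
  have h1 := ge_of_tendsto hlim (by filter_upwards [self_mem_nhdsWithin] with ε hε using key ε hε)
  rwa [ENNReal.rpow_le_rpow_iff (by positivity)] at h1

theorem countable_singleton_ne_zero (m : Measure (Eucl N)) [IsFiniteMeasure m] :
    {x | m {x} ≠ 0}.Countable := by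
  simp only [← pos_iff_ne_zero]
  exact Measure.countable_meas_pos_of_disjoint_iUnion (fun x => measurableSet_singleton x)
    fun x y hxy => by simpa [Function.onFun] using hxy

/-- Under the reverse Hölder inequality, `ν` exceeds `F` by its atoms only. -/
theorem eq_add_sum_dirac (hp : 0 < p) (hpq : p < q) (hq : 1 ≤ q)
    {ν F m : Measure (Eucl N)} [IsFiniteMeasure ν] [IsFiniteMeasure m] [NullSingletonClass F]
    {C : ℝ≥0}
    (h : ∀ A, MeasurableSet A → ν A ^ (1 / q) ≤ F A ^ (1 / q) + C * m A ^ (1 / p)) (hF : F ≤ ν) :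
    ν = F + Measure.sum fun i : {x | ν {x} ≠ 0} => (ν {(i : Eucl N)}).toNNReal •
      Measure.dirac (i : Eucl N) := by
  have hJ := countable_singleton_ne_zero ν
  have hD := countable_singleton_ne_zero m
  set J : Set (Eucl N) := {x | ν {x} ≠ 0} with hJdef
  have := hJ.to_subtype
  refine Measure.ext fun A hA => ?_
  have h1 : ν (A \ J) = F A := by
    refine le_antisymm ?_ ?_
    · have h2 : ν ((A \ J) \ {x | m {x} ≠ 0}) ≤ F ((A \ J) \ {x | m {x} ≠ 0}) :=
        measure_le_of_forall_singleton_eq_zero hp hpq hq h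
          ((hA.diff hJ.measurableSet).diff hD.measurableSet) fun x hx => by simpa using hx.2
      have h3 : ν ((A \ J) ∩ {x | m {x} ≠ 0}) = 0 := by
        refine (measure_null_iff_singleton (hD.mono Set.inter_subset_right)).2 fun x hx => ?_
        simpa [hJdef] using hx.1.2
      rw [← measure_inter_add_sdiff (A \ J) hD.measurableSet, h3, zero_add]
      exact h2.trans (measure_mono (Set.sdiff_subset.trans Set.sdiff_subset))
    · rw [← measure_inter_add_sdiff A hJ.measurableSet,
        measure_mono_null Set.inter_subset_right (hJ.measure_zero F), zero_add]
      exact hF _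
  rw [← measure_inter_add_sdiff A hJ.measurableSet, h1, add_comm, Measure.add_apply,
    Measure.sum_apply _ hA]
  congr 1
  have e : A ∩ J = ⋃ i : J, A ∩ {(i : Eucl N)} := by
    rw [← Set.inter_iUnion, Set.iUnion_of_singleton_coe]
  rw [e, measure_iUnion]
  · refine tsum_congr fun i => ?_
    rw [Measure.smul_apply, Measure.dirac_apply' _ hA, ENNReal.smul_def, smul_eq_mul,
      ENNReal.coe_toNNReal (measure_ne_top _ _)]
    by_cases hi : (i : Eucl N) ∈ A
    · rw [Set.indicator_of_mem hi, Pi.one_apply, mul_one,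
        Set.inter_eq_right.2 (Set.singleton_subset_iff.2 hi)]
    · rw [Set.indicator_of_notMem hi, mul_zero, Set.inter_singleton_eq_empty.2 hi, measure_empty]
  · intro i j hij
    refine Disjoint.mono Set.inter_subset_right Set.inter_subset_right ?_
    simpa using fun h => hij (Subtype.ext h)
  · exact fun i => hA.inter (measurableSet_singleton _)

end ReverseHolder

section Setting
variable {N s : ℕ} {p : ℝ} {f : ℕ → Eucl N → ℝ} {f₀ : Eucl N → ℝ}
  {ν : Measure (Eucl N)} {μ : UnitSphere N → Measure (Eucl N)} {G : ℕ → Eucl N → ℝ}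

theorem nullSingletonClass_powMeasure (hN : 0 < N) (u : Eucl N → ℝ) (r : ℝ) :
    NullSingletonClass (powMeasure u r) := by
  have : Nonempty (Fin N) := ⟨⟨0, hN⟩⟩
  have : NullSingletonClass (volume : Measure (Eucl N)) := inferInstance
  exact ⟨fun x => withDensity_absolutelyContinuous _ _ (measure_singleton x)⟩

/-- The structure of the limit measure: `|f₀|^q dx` plus the atoms of `ν`. -/
theorem Concentrates.eq_add_sum_dirac (h : Concentrates s p f f₀ ν μ) :
    ν = powMeasure f₀ (critExp N s p)
      + Measure.sum fun i : {x | ν {x} ≠ 0} => (ν {(i : Eucl N)}).toNNReal •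
        Measure.dirac (i : Eucl N) := by
  have hp : 0 < p := by linarith [h.one_lt]
  have hq : 1 < critExp N s p := h.one_lt.trans h.lt_critExp
  have hq0 : 0 < critExp N s p := by linarith
  have := h.finite
  have hFfin := isFiniteMeasure_powMeasure hq0 h.mem₀.1
  have hFna := nullSingletonClass_powMeasure h.dim_pos f₀ (critExp N s p)
  obtain ⟨m, C, hm, hC⟩ := h.exists_eLpNorm_le
  refine AffineSobolev.eq_add_sum_dirac hp h.lt_critExp hq.le
    (fun A hA => measure_rpow_le_of_eLpNorm_le hp hq0 hC hA) (Measure.le_iff.2 fun A hA => ?_)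
  have h1 := measure_rpow_le_of_eLpNorm_le (m := (0 : Measure (Eucl N))) (C := 0) hp hq0
    (fun φ hφ hφc => (h.eLpNorm_powMeasure_le hφ hφc).trans (self_le_add_right _ _)) hA
  rw [ENNReal.coe_zero, zero_mul, add_zero, ENNReal.rpow_le_rpow_iff (by positivity)] at h1
  exact h1

end Setting

/-! ### Integrals of negative powers -/

section NegativeExponents
variable {α : Type*} [MeasurableSpace α] {σ : Measure α}

theorem rpow_neg_le_rpow_neg {x y : ℝ≥0∞} (h : x ≤ y) {t : ℝ} (ht : 0 ≤ t) :
    y ^ (-t) ≤ x ^ (-t) := by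
  rw [ENNReal.rpow_neg, ENNReal.rpow_neg]
  exact ENNReal.inv_le_inv.2 (ENNReal.rpow_le_rpow h ht)

/-- A form of Fatou's lemma. The lower bounds `a n` need not be measurable; the limit `a₀` is
replaced by the measurable function `liminf h` above it. -/
theorem exists_measurable_ge_of_tendsto {h a : ℕ → α → ℝ≥0∞} {a₀ : α → ℝ≥0∞}
    (hm : ∀ n, Measurable (h n)) (ha : ∀ x, Tendsto (fun n => a n x) atTop (𝓝 (a₀ x)))
    (hle : ∀ n x, a n x ≤ h n x) {t : ℝ} (ht : 0 ≤ t) {u b : ℕ → ℝ≥0∞} {u₀ b₀ : ℝ≥0∞}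
    (hu : Tendsto u atTop (𝓝 u₀)) (hb : Tendsto b atTop (𝓝 b₀))
    (hub : ∀ n, u n ≤ b n + (∫⁻ x, h n x ∂σ) ^ (-t)) :
    ∃ H : α → ℝ≥0∞, Measurable H ∧ (∀ x, a₀ x ≤ H x) ∧
      u₀ ≤ b₀ + (∫⁻ x, H x ∂σ) ^ (-t) := by
  let g : ℕ → α → ℝ≥0∞ := fun n x => ⨅ i : ℕ, h (i + n) x
  have hgm : ∀ n, Measurable (g n) := fun n => Measurable.iInf fun i => hm _
  have hg : Monotone g := by
    intro n k hnk x
    refine le_iInf fun i => (iInf_le _ (i + (k - n))).trans_eq ?_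
    congr 1
    omega
  refine ⟨fun x => ⨆ n, g n x, Measurable.iSup hgm, fun x => ?_, ?_⟩
  · rw [← (ha x).liminf_eq, liminf_eq_iSup_iInf_of_nat']
    exact iSup_mono fun n => iInf_mono fun i => hle _ _
  · have h1 : Tendsto (fun n => ∫⁻ x, g n x ∂σ) atTop (𝓝 (∫⁻ x, ⨆ n, g n x ∂σ)) := by
      rw [lintegral_iSup hgm hg]
      exact tendsto_atTop_iSup fun n k hnk => lintegral_mono (hg hnk)
    refine le_of_tendsto_of_tendsto' hu (hb.add (h1.ennrpow_const (-t))) fun n => ?_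
    refine (hub n).trans (add_le_add le_rfl (rpow_neg_le_rpow_neg (lintegral_mono fun x => ?_) ht))
    refine (iInf_le _ 0).trans_eq ?_
    rw [zero_add]

/-- Convexity of `x ↦ x ^ (-a)` on `[0, ∞]`. -/
theorem add_rpow_neg_le {a : ℝ} (ha : 0 < a) {θ η : ℝ≥0} (hθ : 0 < θ) (hη : 0 < η)
    (h : θ + η = 1) (x y : ℝ≥0∞) :
    (θ * x + η * y) ^ (-a) ≤ θ * x ^ (-a) + η * y ^ (-a) := by
  have hna : -a < 0 := by linarith
  have hθ' : (θ : ℝ≥0∞) ≠ 0 := by exact_mod_cast hθ.ne'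
  have hη' : (η : ℝ≥0∞) ≠ 0 := by exact_mod_cast hη.ne'
  rcases eq_or_ne x 0 with rfl | hx0
  · simp [ENNReal.zero_rpow_of_neg hna, ENNReal.mul_top hθ']
  rcases eq_or_ne y 0 with rfl | hy0
  · simp [ENNReal.zero_rpow_of_neg hna, ENNReal.mul_top hη']
  rcases eq_or_ne x ⊤ with rfl | hx
  · simp [ENNReal.mul_top hθ', ENNReal.top_rpow_of_neg hna]
  rcases eq_or_ne y ⊤ with rfl | hy
  · simp [ENNReal.mul_top hη', ENNReal.top_rpow_of_neg hna]
  lift x to ℝ≥0 using hx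
  lift y to ℝ≥0 using hy
  have hx0 : x ≠ 0 := by exact_mod_cast hx0
  have hy0 : y ≠ 0 := by exact_mod_cast hy0
  have hxp : 0 < x := pos_iff_ne_zero.2 hx0
  have hyp : 0 < y := pos_iff_ne_zero.2 hy0
  have hxy : θ * x + η * y ≠ 0 := by positivity
  rw [← ENNReal.coe_rpow_of_ne_zero hx0, ← ENNReal.coe_rpow_of_ne_zero hy0]
  rw [← ENNReal.coe_mul, ← ENNReal.coe_mul, ← ENNReal.coe_add,
    ← ENNReal.coe_rpow_of_ne_zero hxy, ← ENNReal.coe_mul, ← ENNReal.coe_mul, ← ENNReal.coe_add,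
    ENNReal.coe_le_coe]
  -- The weighted geometric mean separates the two sides
  have h1 := NNReal.geom_mean_le_arith_mean2_weighted θ η x y h
  have h2 := NNReal.geom_mean_le_arith_mean2_weighted θ η (x ^ (-a)) (y ^ (-a)) h
  refine le_trans ?_ h2
  have e : (x ^ (-a)) ^ (θ : ℝ) * (y ^ (-a)) ^ (η : ℝ)
      = (x ^ (θ : ℝ) * y ^ (η : ℝ)) ^ (-a) := by
    rw [NNReal.mul_rpow, ← NNReal.rpow_mul, ← NNReal.rpow_mul, ← NNReal.rpow_mul,
      ← NNReal.rpow_mul, mul_comm (-a), mul_comm (-a)]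
  rw [e, NNReal.rpow_neg, NNReal.rpow_neg]
  have hpos : 0 < x ^ (θ : ℝ) * y ^ (η : ℝ) := by positivity
  gcongr

/-- The reverse Minkowski inequality for negative exponents. -/
theorem lintegral_rpow_neg_add_le {a : ℝ} (ha : 0 < a) {g h : α → ℝ≥0∞} (hg : Measurable g) :
    (∫⁻ x, g x ^ (-a) ∂σ) ^ (-(1 / a)) + (∫⁻ x, h x ^ (-a) ∂σ) ^ (-(1 / a))
      ≤ (∫⁻ x, (g x + h x) ^ (-a) ∂σ) ^ (-(1 / a)) := by
  have ha' : 0 < 1 / a := by positivity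
  have hinv : ∀ z : ℝ≥0∞, (z ^ (-(1 / a))) ^ (-a) = z := fun z => by
    rw [← ENNReal.rpow_mul]
    have : -(1 / a) * -a = 1 := by field_simp
    rw [this, ENNReal.rpow_one]
  have hinv' : ∀ z : ℝ≥0∞, (z ^ (-a)) ^ (-(1 / a)) = z := fun z => by
    rw [← ENNReal.rpow_mul]
    have : -a * -(1 / a) = 1 := by field_simp
    rw [this, ENNReal.rpow_one]
  have hmono₁ : (∫⁻ x, g x ^ (-a) ∂σ) ^ (-(1 / a)) ≤ (∫⁻ x, (g x + h x) ^ (-a) ∂σ) ^ (-(1 / a)) :=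
    rpow_neg_le_rpow_neg (lintegral_mono fun x => rpow_neg_le_rpow_neg le_self_add ha.le) ha'.le
  have hmono₂ : (∫⁻ x, h x ^ (-a) ∂σ) ^ (-(1 / a)) ≤ (∫⁻ x, (g x + h x) ^ (-a) ∂σ) ^ (-(1 / a)) :=
    rpow_neg_le_rpow_neg (lintegral_mono fun x => rpow_neg_le_rpow_neg le_add_self ha.le) ha'.le
  have hA := hinv (∫⁻ x, g x ^ (-a) ∂σ)
  have hB := hinv (∫⁻ x, h x ^ (-a) ∂σ)
  generalize (∫⁻ x, g x ^ (-a) ∂σ) ^ (-(1 / a)) = A at *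
  generalize (∫⁻ x, h x ^ (-a) ∂σ) ^ (-(1 / a)) = B at *
  rcases eq_or_ne A 0 with rfl | hA0
  · simpa using hmono₂
  rcases eq_or_ne B 0 with rfl | hB0
  · simpa using hmono₁
  rcases eq_or_ne A ⊤ with rfl | hAt
  · rw [top_le_iff.1 hmono₁]; exact le_top
  rcases eq_or_ne B ⊤ with rfl | hBt
  · rw [top_le_iff.1 hmono₂]; exact le_top
  lift A to ℝ≥0 using hAt
  lift B to ℝ≥0 using hBt
  have hA0 : 0 < A := pos_iff_ne_zero.2 (by exact_mod_cast hA0)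
  have hB0 : 0 < B := pos_iff_ne_zero.2 (by exact_mod_cast hB0)
  -- Convexity is applied to `g / θ` and `h / η`, where `θ : η = A : B`
  set θ : ℝ≥0 := A / (A + B) with hθdef
  set η : ℝ≥0 := B / (A + B) with hηdef
  have hθ : 0 < θ := by positivity
  have hη : 0 < η := by positivity
  have hsum : θ + η = 1 := by
    rw [hθdef, hηdef, ← add_div, div_self (by positivity)]
  have hscale : ∀ {κ D : ℝ≥0} (z : ℝ≥0∞), 0 < κ → κ = D / (A + B) → z = (D : ℝ≥0∞) ^ (-a) →
      (κ : ℝ≥0∞) * ((κ⁻¹ : ℝ≥0) ^ (-a) * z) = κ * ((A + B : ℝ≥0) : ℝ≥0∞) ^ (-a) := by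
    intro κ D z hκ hκD hz
    have hD : D ≠ 0 := by
      rintro rfl
      rw [zero_div] at hκD
      exact hκ.ne' hκD
    have hκ' : κ⁻¹ ≠ 0 := by positivity
    rw [hz, ← ENNReal.coe_rpow_of_ne_zero hκ', ← ENNReal.coe_rpow_of_ne_zero hD,
      ← ENNReal.coe_rpow_of_ne_zero (by positivity : A + B ≠ 0), ← ENNReal.coe_mul,
      ← NNReal.mul_rpow, hκD, inv_div, div_mul_cancel₀ _ hD]
  have hpt : ∀ x, (g x + h x) ^ (-a) ≤ θ * ((θ⁻¹ : ℝ≥0) ^ (-a) * g x ^ (-a))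
      + η * ((η⁻¹ : ℝ≥0) ^ (-a) * h x ^ (-a)) := by
    intro x
    have h1 := add_rpow_neg_le ha hθ hη hsum ((θ⁻¹ : ℝ≥0) * g x) ((η⁻¹ : ℝ≥0) * h x)
    rw [← mul_assoc, ← mul_assoc, ← ENNReal.coe_mul, ← ENNReal.coe_mul, mul_inv_cancel₀ hθ.ne',
      mul_inv_cancel₀ hη.ne', ENNReal.coe_one, one_mul, one_mul] at h1
    have hm : ∀ {κ : ℝ≥0} (z : ℝ≥0∞), 0 < κ →
        ((κ⁻¹ : ℝ≥0) * z) ^ (-a) = ((κ⁻¹ : ℝ≥0) : ℝ≥0∞) ^ (-a) * z ^ (-a) := by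
      intro κ z hκ
      have hκ' : ((κ⁻¹ : ℝ≥0) : ℝ≥0∞) ≠ 0 := by
        rw [ENNReal.coe_ne_zero]; positivity
      rw [ENNReal.rpow_neg, ENNReal.mul_rpow_of_nonneg _ _ ha.le, ENNReal.rpow_neg,
        ENNReal.rpow_neg, ENNReal.mul_inv]
      · exact Or.inl (ENNReal.rpow_pos (pos_iff_ne_zero.2 hκ') ENNReal.coe_ne_top).ne'
      · exact Or.inl (ENNReal.rpow_ne_top_of_nonneg ha.le ENNReal.coe_ne_top)
    rwa [hm _ hθ, hm _ hη] at h1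
  have hint : ∫⁻ x, (g x + h x) ^ (-a) ∂σ ≤ ((A + B : ℝ≥0) : ℝ≥0∞) ^ (-a) := by
    refine (lintegral_mono hpt).trans ?_
    have hc : ∀ {κ : ℝ≥0}, 0 < κ → ((κ⁻¹ : ℝ≥0) : ℝ≥0∞) ^ (-a) ≠ ⊤ := by
      intro κ hκ
      have hκ' : κ⁻¹ ≠ 0 := by positivity
      rw [← ENNReal.coe_rpow_of_ne_zero hκ']
      exact ENNReal.coe_ne_top
    rw [lintegral_add_left (by fun_prop), lintegral_const_mul' _ _ ENNReal.coe_ne_top,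
      lintegral_const_mul' _ _ ENNReal.coe_ne_top, lintegral_const_mul' _ _ (hc hθ),
      lintegral_const_mul' _ _ (hc hη), hscale _ hθ hθdef hA.symm, hscale _ hη hηdef hB.symm,
      ← add_mul, ← ENNReal.coe_add, hsum, ENNReal.coe_one, one_mul]
  rw [← ENNReal.coe_add, ← hinv' ((A + B : ℝ≥0) : ℝ≥0∞)]
  exact rpow_neg_le_rpow_neg hint ha'.le

theorem sum_lintegral_rpow_neg_le {ι : Type*} {a : ℝ} (ha : 0 < a) {g : ι → α → ℝ≥0∞}
    (hg : ∀ i, Measurable (g i)) (A : Finset ι) :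
    ∑ i ∈ A, (∫⁻ x, g i x ^ (-a) ∂σ) ^ (-(1 / a))
      ≤ (∫⁻ x, (∑ i ∈ A, g i x) ^ (-a) ∂σ) ^ (-(1 / a)) := by
  classical
  induction A using Finset.induction_on with
  | empty => simp
  | insert i A hi ih =>
    simp only [Finset.sum_insert hi]
    exact (add_le_add le_rfl ih).trans (lintegral_rpow_neg_add_le ha (hg i))

end NegativeExponents

/-! ### The affine Sobolev inequality at the atoms -/

section TestFunctions
variable {N s : ℕ} {p : ℝ}

theorem measurable_lintegral_iteratedFDeriv {u : Eucl N → ℝ} (hu : ContDiff ℝ ∞ u) :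
    Measurable fun ξ : UnitSphere N =>
      ∫⁻ x, ‖iteratedFDeriv ℝ s u x (fun _ => (ξ : Eucl N))‖ₑ ^ p := by
  have h1 : Continuous fun z : UnitSphere N × Eucl N =>
      iteratedFDeriv ℝ s u z.2 (fun _ => (z.1 : Eucl N)) :=
    ((contDiff_iteratedFDeriv hu s).continuous.comp continuous_snd).eval
      (continuous_pi fun _ => continuous_subtype_val.comp continuous_fst)
  exact (h1.measurable.enorm.pow_const p).lintegral_prod_right'

theorem memSobolev_of_contDiff {u : Eucl N → ℝ} (hu : ContDiff ℝ ∞ u) (huc : HasCompactSupport u) :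
    MemSobolev s p u :=
  ⟨hu.continuous.memLp_of_hasCompactSupport huc,
    fun k _ => ⟨_, hasWeakDeriv_of_contDiff hu k⟩,
    (memLp_congr_ae (weakDeriv_ae_eq_iteratedFDeriv hu s)).2
      ((contDiff_iteratedFDeriv hu s).continuous.memLp_of_hasCompactSupport
        (huc.iteratedFDeriv s))⟩

theorem affineEnergy_eq_of_contDiff {u : Eucl N → ℝ} (hu : ContDiff ℝ ∞ u) :
    affineEnergy s p u = (∫⁻ ξ : UnitSphere N,
      (∫⁻ x, ‖iteratedFDeriv ℝ s u x (fun _ => (ξ : Eucl N))‖ₑ ^ p) ^ (-(N / (s * p) : ℝ))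
        ∂(surfaceMeasure N)) ^ (-(s / N : ℝ)) := by
  rw [affineEnergy]
  congr 1
  refine lintegral_congr fun ξ => ?_
  congr 1
  refine lintegral_congr_ae ?_
  filter_upwards [weakDeriv_ae_eq_iteratedFDeriv hu s] with x hx
  rw [dirDeriv, hx]

end TestFunctions

section Setting
variable {N s : ℕ} {p : ℝ} {f : ℕ → Eucl N → ℝ} {f₀ : Eucl N → ℝ}
  {ν : Measure (Eucl N)} {μ : UnitSphere N → Measure (Eucl N)}

namespace Concentrates

/-- The affine Sobolev inequality in the limit, localised by a test function. The function `H` is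
a measurable substitute for the negative power of the localised energy in the direction `ξ`, which
need not be measurable in `ξ`. -/
theorem exists_measurable_mul_eLpNorm_le (h : Concentrates s p f f₀ ν μ) {C : ℝ≥0}
    (hC : ∀ u : Eucl N → ℝ, MemSobolev s p u →
      C * eLpNorm u (ENNReal.ofReal (critExp N s p)) volume ≤ affineEnergy s p u)
    {φ : Eucl N → ℝ} (hφ : ContDiff ℝ ∞ φ) (hφc : HasCompactSupport φ) :
    ∃ H : UnitSphere N → ℝ≥0∞, Measurable H ∧
      (∀ ξ, ((eLpNorm φ (ENNReal.ofReal p) (powMeasure (dirDeriv s ξ f₀) p + μ ξ)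
        + eLpNorm φ (ENNReal.ofReal p) (powMeasure (dirDeriv s ξ f₀) p)) ^ p)
          ^ (-(N / (s * p) : ℝ)) ≤ H ξ) ∧
      C * eLpNorm φ (ENNReal.ofReal (critExp N s p)) ν
        ≤ C * eLpNorm φ (ENNReal.ofReal (critExp N s p)) (powMeasure f₀ (critExp N s p))
          + (∫⁻ ξ, H ξ ∂(surfaceMeasure N)) ^ (-(s / N : ℝ)) := by
  have hp0 : 0 < p := by linarith [h.one_lt]
  have hq0 : 0 < critExp N s p := by linarith [h.lt_critExp]
  obtain ⟨G, hG, hGq, hGp⟩ := h.exists_weaklyNull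
  choose b hb hbn using fun ξ => h.exists_eLpNorm_deriv_mul_le hG hGp hφ hφc ξ
  obtain ⟨b', hb', hbn'⟩ := h.exists_eLpNorm_mul_le hG hGq hφ hφc
  have hu : ∀ n, ContDiff ℝ ∞ fun y => φ y * G n y := fun n => hφ.mul (hG.contDiff n)
  have h1 := h.tendsto_eLpNorm hφ.continuous hφc
  rw [← eLpNorm_eq_lintegral_rpow hq0] at h1
  refine exists_measurable_ge_of_tendsto
    (h := fun n (ξ : UnitSphere N) => (∫⁻ x, ‖iteratedFDeriv ℝ s (fun y => φ y * G n y) x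
      (fun _ => (ξ : Eucl N))‖ₑ ^ p) ^ (-(N / (s * p) : ℝ)))
    (a := fun n (ξ : UnitSphere N) => (b ξ n ^ p) ^ (-(N / (s * p) : ℝ)))
    (fun n => (measurable_lintegral_iteratedFDeriv (hu n)).pow_const _)
    (fun ξ => ((hb ξ).ennrpow_const p).ennrpow_const _) (fun n ξ => ?_) (by positivity)
    (ENNReal.Tendsto.const_mul h1 (Or.inr ENNReal.coe_ne_top))
    (ENNReal.Tendsto.const_mul hb' (Or.inr ENNReal.coe_ne_top)) fun n => ?_
  · refine rpow_neg_le_rpow_neg ?_ (by positivity)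
    rw [← eLpNorm_rpow_eq_lintegral hp0]
    exact ENNReal.rpow_le_rpow (hbn ξ n) hp0.le
  · rw [← affineEnergy_eq_of_contDiff (hu n), add_comm]
    refine (mul_le_mul_right (hbn' n) _).trans ?_
    rw [mul_add]
    exact add_le_add (hC _ (memSobolev_of_contDiff (hu n) hφc.mul_right)) le_rfl

/-- The affine Sobolev inequality at an atom of `ν`: the cut-off functions shrink to the point, and
the contributions of `f₀` disappear. -/
theorem exists_measurable_le_atom (h : Concentrates s p f f₀ ν μ) {C : ℝ≥0}
    (hC : ∀ u : Eucl N → ℝ, MemSobolev s p u →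
      C * eLpNorm u (ENNReal.ofReal (critExp N s p)) volume ≤ affineEnergy s p u) (x : Eucl N) :
    ∃ m : UnitSphere N → ℝ≥0∞, Measurable m ∧ (∀ ξ, m ξ ≤ μ ξ {x}) ∧
      (C : ℝ≥0∞) ^ p * ν {x} ^ (p / critExp N s p)
        ≤ (∫⁻ ξ, m ξ ^ (-(N / (s * p) : ℝ)) ∂(surfaceMeasure N)) ^ (-(s * p / N : ℝ)) := by
  have hp0 : 0 < p := by linarith [h.one_lt]
  have hq0 : 0 < critExp N s p := by linarith [h.lt_critExp]
  have hN : (0 : ℝ) < N := by exact_mod_cast h.dim_pos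
  have hs : (0 : ℝ) < s := by exact_mod_cast h.one_le
  have := h.finite
  have hFfin := isFiniteMeasure_powMeasure hq0 h.mem₀.1
  have hFna := nullSingletonClass_powMeasure h.dim_pos f₀ (critExp N s p)
  have hPna := fun ξ => nullSingletonClass_powMeasure h.dim_pos (dirDeriv s ξ f₀) p
  have hPfin := fun ξ => isFiniteMeasure_powMeasure hp0 (h.mem₀.memLp_dirDeriv ξ)
  have hPμ := h.finite_limit
  let δ : ℕ → ℝ := fun k => 1 / ((k : ℝ) + 1)
  have hδ : ∀ k, 0 < δ k := fun k => by positivity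
  have hδ0 : Tendsto δ atTop (𝓝 0) := tendsto_one_div_add_atTop_nhds_zero_nat
  let B : ℕ → Set (Eucl N) := fun k => Metric.cthickening (δ k) {x}
  have hBm : ∀ k, MeasurableSet (B k) := fun k => Metric.isClosed_cthickening.measurableSet
  have hB : ∀ m : Measure (Eucl N), IsFiniteMeasure m →
      Tendsto (fun k => m (B k)) atTop (𝓝 (m {x})) := fun m hm =>
    (tendsto_measure_cthickening_of_isCompact (μ := m) isCompact_singleton).comp hδ0
  choose φ hφ hφc hφ1 hφx hφ0 using fun k =>
    exists_contDiff_cutoff (isCompact_singleton (x := x)) (hδ k)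
  choose H' hH'm hH' hH'le using fun k => h.exists_measurable_mul_eLpNorm_le hC (hφ k) (hφc k)
  have hup : ∀ {r : ℝ} (_ : 0 < r) (m : Measure (Eucl N)) (k : ℕ),
      eLpNorm (φ k) (ENNReal.ofReal r) m ≤ m (B k) ^ (1 / r) := fun {r} hr m k => by
    rw [eLpNorm_eq_lintegral_rpow hr]
    exact ENNReal.rpow_le_rpow
      (lintegral_enorm_rpow_le_measure hr (hBm k) (hφ1 k) (hφ0 k)) (by positivity)
  have hid : ∀ {r : ℝ} (_ : 0 < r) (a : ℝ≥0∞), (a ^ (1 / r)) ^ r = a := fun {r} hr a => by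
    rw [← ENNReal.rpow_mul, one_div_mul_cancel hr.ne', ENNReal.rpow_one]
  obtain ⟨H, hHm, hH, hHle⟩ : ∃ H : UnitSphere N → ℝ≥0∞, Measurable H ∧
      (∀ ξ, μ ξ {x} ^ (-(N / (s * p) : ℝ)) ≤ H ξ) ∧ C * ν {x} ^ (1 / critExp N s p)
        ≤ 0 + (∫⁻ ξ, H ξ ∂(surfaceMeasure N)) ^ (-(s / N : ℝ)) := by
    refine exists_measurable_ge_of_tendsto (σ := surfaceMeasure N)
      (t := (s / N : ℝ)) (h := H')
      (a := fun k ξ => (((powMeasure (dirDeriv s ξ f₀) p + μ ξ) (B k) ^ (1 / p)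
        + powMeasure (dirDeriv s ξ f₀) p (B k) ^ (1 / p)) ^ p) ^ (-(N / (s * p) : ℝ)))
      (a₀ := fun ξ => μ ξ {x} ^ (-(N / (s * p) : ℝ)))
      (u := fun _ => C * ν {x} ^ (1 / critExp N s p)) (u₀ := C * ν {x} ^ (1 / critExp N s p))
      (b := fun k => C * powMeasure f₀ (critExp N s p) (B k) ^ (1 / critExp N s p)) (b₀ := 0)
      hH'm (fun ξ => ?_) (fun k ξ => ?_) (by positivity) tendsto_const_nhds ?_ fun k => ?_
    · have h1 := ((hB _ (hPμ ξ)).ennrpow_const (1 / p)).add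
        ((hB _ (hPfin ξ)).ennrpow_const (1 / p))
      have h2 := (h1.ennrpow_const p).ennrpow_const (-(N / (s * p) : ℝ))
      rwa [Measure.add_apply, measure_singleton, zero_add, ENNReal.zero_rpow_of_pos (by positivity),
        add_zero, hid hp0] at h2
    · refine le_trans (rpow_neg_le_rpow_neg ?_ (by positivity)) (hH' k ξ)
      exact ENNReal.rpow_le_rpow (add_le_add (hup hp0 _ k) (hup hp0 _ k)) hp0.le
    · have h1 := ENNReal.Tendsto.const_mul (a := (C : ℝ≥0∞))
        ((hB _ hFfin).ennrpow_const (1 / critExp N s p)) (Or.inr ENNReal.coe_ne_top)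
      rwa [measure_singleton, ENNReal.zero_rpow_of_pos (by positivity), mul_zero] at h1
    · refine le_trans ?_ ((hH'le k).trans (add_le_add (mul_le_mul_right (hup hq0 _ k) _) le_rfl))
      rw [eLpNorm_eq_lintegral_rpow hq0]
      gcongr
      exact measure_le_lintegral_enorm_rpow (measurableSet_singleton x) (hφx k)
  refine ⟨fun ξ => H ξ ^ (-(s * p / N : ℝ)), hHm.pow_const _, fun ξ => ?_, ?_⟩
  · have h1 := rpow_neg_le_rpow_neg (hH ξ) (t := s * p / N) (by positivity)
    rw [← ENNReal.rpow_mul] at h1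
    have e : -(N / (s * p) : ℝ) * -(s * p / N : ℝ) = 1 := by field_simp
    rwa [e, ENNReal.rpow_one] at h1
  · have h1 := ENNReal.rpow_le_rpow hHle hp0.le
    rw [zero_add, ENNReal.mul_rpow_of_nonneg _ _ hp0.le, ← ENNReal.rpow_mul,
      ← ENNReal.rpow_mul] at h1
    have e : -(s * p / N : ℝ) * -(N / (s * p) : ℝ) = 1 := by field_simp
    simp only [← ENNReal.rpow_mul, e, ENNReal.rpow_one]
    have e1 : 1 / critExp N s p * p = p / critExp N s p := by ring
    have e2 : -(s / N : ℝ) * p = -(s * p / N) := by ring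
    rwa [e1, e2] at h1

/-- The affine Sobolev inequality for a family of atoms. The points `x i` need not be distinct. -/
theorem tsum_bestConst_le (h : Concentrates s p f f₀ ν μ) {I : Type*} {x : I → Eucl N} :
    ∑' i, bestConst N s p ^ p * ν {x i} ^ (p / critExp N s p)
      ≤ (∫⁻ ξ, (∑' i, μ ξ {x i}) ^ (-(N / (s * p) : ℝ)) ∂(surfaceMeasure N))
          ^ (-(s * p / N : ℝ)) := by
  have hp0 : 0 < p := by linarith [h.one_lt]
  have hq0 : 0 < critExp N s p := by linarith [h.lt_critExp]
  have hN : (0 : ℝ) < N := by exact_mod_cast h.dim_pos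
  have hs : (0 : ℝ) < s := by exact_mod_cast h.one_le
  have := h.finite
  rw [ENNReal.tsum_eq_iSup_sum]
  refine iSup_le fun A => ?_
  rw [← Finset.mul_sum]
  set T := ∑ i ∈ A, ν {x i} ^ (p / critExp N s p) with hT
  set X := (∫⁻ ξ, (∑' i, μ ξ {x i}) ^ (-(N / (s * p) : ℝ)) ∂(surfaceMeasure N))
          ^ (-(s * p / N : ℝ)) with hX
  have hTt : T ≠ ⊤ := by
    refine (ENNReal.sum_lt_top.2 fun i _ => ?_).ne
    exact (ENNReal.rpow_ne_top_of_nonneg (by positivity) (measure_ne_top _ _)).lt_top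
  rcases eq_or_ne T 0 with hT0 | hT0
  · rw [hT0, mul_zero]
    exact zero_le
  -- The best constant is approached by finite admissible constants, whether or not it is finite.
  have key : ∀ C : ℝ≥0, (∀ u : Eucl N → ℝ, MemSobolev s p u →
      C * eLpNorm u (ENNReal.ofReal (critExp N s p)) volume ≤ affineEnergy s p u) →
      (C : ℝ≥0∞) ^ p * T ≤ X := by
    intro C hC
    choose m hm hmμ hmle using fun i => h.exists_measurable_le_atom hC (x i)
    rw [hT, Finset.mul_sum]
    refine (Finset.sum_le_sum fun i _ => hmle i).trans ?_
    have h1 := sum_lintegral_rpow_neg_le (σ := surfaceMeasure N) (a := N / (s * p))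
      (by positivity) hm A
    rw [one_div_div] at h1
    -- Only monotonicity is left to use, so measurability of `μ ξ {x i}` in `ξ` is not needed.
    refine h1.trans (rpow_neg_le_rpow_neg (lintegral_mono fun ξ => ?_) (by positivity))
    refine rpow_neg_le_rpow_neg ?_ (by positivity)
    exact (Finset.sum_le_sum fun i _ => hmμ i ξ).trans (ENNReal.sum_le_tsum A)
  rw [← ENNReal.le_div_iff_mul_le (Or.inl hT0) (Or.inl hTt), ← ENNReal.le_rpow_inv_iff hp0]
  refine le_of_forall_lt_imp_le_of_dense fun c hc => ?_
  obtain ⟨C, hC, hcC⟩ := lt_sSup_iff.1 hc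
  lift c to ℝ≥0 using hcC.ne_top
  rw [ENNReal.le_rpow_inv_iff hp0, ENNReal.le_div_iff_mul_le (Or.inl hT0) (Or.inl hTt)]
  exact key c fun u hu => (mul_le_mul_left hcC.le _).trans (hC u hu)

end Concentrates
end Setting

end AffineSobolev

theorem lemma4p1 (N s : ℕ) (p : ℝ) (hs : 1 ≤ s) (hp : 1 < p) (hsp : (s : ℝ) * p < N)
    (f : ℕ → AffineSobolev.Eucl N → ℝ) (f₀ : AffineSobolev.Eucl N → ℝ)
    (hf : ∀ n, AffineSobolev.MemSobolev s p (f n))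
    (hf₀ : AffineSobolev.MemSobolev s p f₀)
    (hweak : AffineSobolev.WeakTendsto s p f f₀)
    (ν : Measure (AffineSobolev.Eucl N)) (hν : IsFiniteMeasure ν)
    (hfν : AffineSobolev.WeakStarTendsto
      (fun n => AffineSobolev.powMeasure (f n) (AffineSobolev.critExp N s p)) ν)
    (μ : AffineSobolev.UnitSphere N → Measure (AffineSobolev.Eucl N))
    (hμ : ∀ ξ, IsFiniteMeasure (μ ξ))
    (hfμ : ∀ ξ, AffineSobolev.WeakStarTendsto
      (fun n => AffineSobolev.powMeasure (AffineSobolev.dirDeriv s ξ (f n)) p)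
      (AffineSobolev.powMeasure (AffineSobolev.dirDeriv s ξ f₀) p + μ ξ)) :
    ∃ (I : Type) (_ : Countable I) (x : I → AffineSobolev.Eucl N) (w : I → ℝ≥0),
      Function.Injective x ∧ (∀ i, 0 < w i) ∧
      ν = AffineSobolev.powMeasure f₀ (AffineSobolev.critExp N s p)
        + Measure.sum (fun i => w i • Measure.dirac (x i)) ∧
      (∑' i, AffineSobolev.bestConst N s p ^ p
          * (w i : ℝ≥0∞) ^ (p / AffineSobolev.critExp N s p))
        ≤ (∫⁻ ξ, (∑' i, μ ξ {x i}) ^ (-(N / (s * p) : ℝ)) ∂(AffineSobolev.surfaceMeasure N))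
            ^ (-(s * p / N : ℝ)) := by
  have h : AffineSobolev.Concentrates s p f f₀ ν μ :=
    ⟨hs, hp, hsp, hf, hf₀, hweak, hν, hfν, hμ, hfμ⟩
  have hcount := AffineSobolev.countable_singleton_ne_zero ν
  refine ⟨{x | ν {x} ≠ 0}, hcount.to_subtype, Subtype.val,
    fun i => (ν {(i : AffineSobolev.Eucl N)}).toNNReal, Subtype.val_injective, fun i => ?_,
    h.eq_add_sum_dirac, ?_⟩
  · exact ENNReal.toNNReal_pos i.2 (measure_ne_top _ _)
  · simp only [ENNReal.coe_toNNReal (measure_ne_top ν _)]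
    exact h.tsum_bestConst_le
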